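/- **Setting.** Let $M$ be a matroid without loops and coloops, of rank $r+1$, on the ordered ground set $E=\{0<1<\dots<n\}$, with dual $M^\perp$ and closure operators $\mathrm{cl}$, $\mathrm{cl}^\perp$ of $M$, $M^\perp$. A *biflat* $F|G$ of $M$ is a pair of a nonempty flat $F$ of $M$ and a nonempty flat $G$ of $M^\perp$, not both equal to $E$, with $F\cup G=E$. A *biflag* is a set of biflats that are pairwise compatible (for any two of them $F|G$ and $F'|G'$, either $F\subseteq F'$ and $G\supseteq G'$, or $F\supseteq F'$ and $G\subseteq G'$) and for which $\bigcup F\cap G\neq E$; its length is the number of its biflats. Let $S_{M}$ be the polynomial ring over $\mathbb R$ in variables $x_{F|G}$ indexed by the biflats, write $x_{\mathscr F|\mathscr G}=\prod_{F|G\in\mathscr F|\mathscr G}x_{F|G}$ for a set $\mathscr F|\mathscr G$ of biflats, and for $i\in E$ put $$\gamma_i=\sum_{i\in F,\,F\ne E}x_{F|G},\qquad \overline\gamma_i=\sum_{i\in G,\,G\ne E}x_{F|G},\qquad \delta_i=\sum_{i\in F\cap G}x_{F|G}.$$ The *conormal Chow ring* $A=A_{M,M^\perp}$ is the quotient of $S_M$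 by the ideal generated by the monomials $x_{\mathscr F|\mathscr G}$ of the sets of biflats that are not biflags and by all $\gamma_i-\gamma_j$ and $\overline\gamma_i-\overline\gamma_j$ ($i,j\in E$). The classes $\gamma$ of $\gamma_i$ and $\delta$ of $\delta_i$ in $A$ do not depend on $i$. For a basis $B$ let $B^\perp=E-B$. Its *internally active set* $IA(B)$ consists of the $i\in B$ that are the minimum of the unique cocircuit contained in $B^\perp\cup i$, and its *externally active set* of the $i\notin B$ that are the minimum of the unique circuit contained in $B\cup i$. An *nbc basis* is a basis whose externally active set is empty; its *internal activity* is $|IA(B)|$. Let $B$ be an nbc basis with $|IA(B)|=k+1$. Put $S=B-IA(B)=\{e_1>\dots>e_{r-k}\}$, $T=B^\perp-\min B^\perp=\{e_{r-k+1}<\dots<e_{n-k-1}\}$, $IA(B)=\{c_1>\dots>c_{k+1}\}$, and let $i$ be the largest index with $c_i\notin \mathrm{cl}(S)\cup\mathrm{cl}^\perp(T)$. The *extended nbc biflag* $\mathscr F^+(B)|\mathscr G^+(B)$ is the set of the pairs $F_j^+|G_j^+$, $1\le j\le n-1$, given by $$F^+_j|G^+_j=\begin{cases}\mathrm{cl}\{e_1,\dots,e_j\}\,|\,E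 & 1\le j\le r-k,\\ \mathrm{cl}(S\cup\{c_1,\dots,c_{j-(r-k)}\})\,|\,E & 1\le j-(r-k)\le i-1,\\ \mathrm{cl}(S\cup\{c_1,\dots,c_{j-(r-k)}\})\,|\,\mathrm{cl}^\perp(T) & i\le j-(r-k)\le k,\\ E\,|\,\mathrm{cl}^\perp\{e_{j-k},\dots,e_{n-k-1}\} & 1\le j-r\le n-r-1.\end{cases}$$ The *broken circuit complex* $BC(M)$ is the simplicial complex of the subsets of $E$ that contain no set $C-\min C$ with $C$ a circuit of $M$. It has dimension $r$. With $f_i$ the number of its faces with $i$ vertices, its $h$-vector $(h_0,\dots,h_{r+1})$ is defined by $\sum_{i=0}^{r+1} f_i\,q^{r+1-i}=\sum_{i=0}^{r+1} h_i\,(q+1)^{r+1-i}$. **Theorem.** Let $0\le k\le r$. For every nbc basis $B$ of $M$ of internal activity $k+1$, $\mathscr F^+(B)|\mathscr G^+(B)$ is a biflag of $M$ of length $n-1$, and in the conormal Chow ring of $M$ $$\gamma^k\delta^{\,n-k-1}=\sum_B x_{\mathscr F^+(B)|\mathscr G^+(B)},$$ the sum over the nbc bases $B$ of $M$ of internal activity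 $k+1$. There is a unique linear map $\deg:A^{n-1}\to\mathbb R$ on the degree $n-1$ part of $A$ that sends, for every set $\mathscr F|\mathscr G$ of $n-1$ biflats, $x_{\mathscr F|\mathscr G}$ to $1$ if $\mathscr F|\mathscr G$ is a biflag and to $0$ otherwise. Each monomial in the sum has degree $1$, the number of nbc bases of internal activity $k+1$ is $h_{r-k}(BC(M))$, and hence $$\deg(\gamma^k\delta^{\,n-k-1})=h_{r-k}(BC(M)).$$ -/

import Mathlib

/-! Throughout, a matroid on `n + 1` elements has the ordered ground set
`E = {0 < 1 < ⋯ < n} = Fin (n + 1)`, that is, `M.E = Set.univ`.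
The dual matroid is Mathlib's `M✶`. -/

noncomputable section

open scoped Classical

namespace LagrangianMatroid

variable {n : ℕ}

/-! ### Biflats and biflags -/

/-- `F|G` is a biflat of `M`: a nonempty flat `F` of `M` and a nonempty flat `G` of the dual,
not both equal to `E`, whose union is `E`. -/
structure IsBiflat (M : Matroid (Fin (n + 1))) (F G : Set (Fin (n + 1))) : Prop where
  flat_left : M.IsFlat F
  flat_right : M✶.IsFlat G
  nonempty_left : F.Nonempty
  nonempty_right : G.Nonempty
  not_both : ¬ (F = M.E ∧ G = M.E)
  union_eq : F ∪ G = M.E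

/-- The type of biflats `F|G` of `M`; `p.1.1` is `F` and `p.1.2` is `G`. -/
def Biflat (M : Matroid (Fin (n + 1))) : Type :=
  {p : Set (Fin (n + 1)) × Set (Fin (n + 1)) // IsBiflat M p.1 p.2}

instance (M : Matroid (Fin (n + 1))) : Finite (Biflat M) :=
  inferInstanceAs (Finite {p : Set (Fin (n + 1)) × Set (Fin (n + 1)) // IsBiflat M p.1 p.2})

instance (M : Matroid (Fin (n + 1))) : Fintype (Biflat M) := Fintype.ofFinite _

/-- The flat `F` of a biflat `F|G`. -/
def Biflat.F {M : Matroid (Fin (n + 1))} (p : Biflat M) : Set (Fin (n + 1)) := p.1.1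

/-- The coflat `G` of a biflat `F|G`. -/
def Biflat.G {M : Matroid (Fin (n + 1))} (p : Biflat M) : Set (Fin (n + 1)) := p.1.2

/-- Compatibility of two biflats. -/
def Compatible {M : Matroid (Fin (n + 1))} (p q : Biflat M) : Prop :=
  (p.F ⊆ q.F ∧ q.G ⊆ p.G) ∨ (q.F ⊆ p.F ∧ p.G ⊆ q.G)

/-- A set of biflats is a biflag if its members are pairwise compatible and
the union of the sets `F ∩ G` is not `E`. -/
def IsBiflag (M : Matroid (Fin (n + 1))) (S : Finset (Biflat M)) : Prop :=
  (∀ p ∈ S, ∀ q ∈ S, Compatible p q) ∧ (⋃ p ∈ S, p.F ∩ p.G) ≠ M.E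

/-! ### The conormal Chow ring -/

/-- The polynomial ring over `ℝ` with one variable for each biflat. -/
abbrev PolyRing (M : Matroid (Fin (n + 1))) : Type := MvPolynomial (Biflat M) ℝ

/-- The squarefree monomial of a set of biflats. -/
def mono (M : Matroid (Fin (n + 1))) (S : Finset (Biflat M)) : PolyRing M :=
  ∏ p ∈ S, MvPolynomial.X p

/-- `γ_i`, the sum of `x_{F|G}` over the biflats with `i ∈ F` and `F ≠ E`. -/
def gammaForm (M : Matroid (Fin (n + 1))) (i : Fin (n + 1)) : PolyRing M :=
  ∑ p : Biflat M with i ∈ p.F ∧ p.F ≠ M.E, MvPolynomial.X p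

/-- `γ̄_i`, the sum of `x_{F|G}` over the biflats with `i ∈ G` and `G ≠ E`. -/
def gammaBarForm (M : Matroid (Fin (n + 1))) (i : Fin (n + 1)) : PolyRing M :=
  ∑ p : Biflat M with i ∈ p.G ∧ p.G ≠ M.E, MvPolynomial.X p

/-- `δ_i`, the sum of `x_{F|G}` over the biflats with `i ∈ F ∩ G`. -/
def deltaForm (M : Matroid (Fin (n + 1))) (i : Fin (n + 1)) : PolyRing M :=
  ∑ p : Biflat M with i ∈ p.F ∩ p.G, MvPolynomial.X p

/-- The ideal generated by the monomials of sets of biflats that are not biflags. -/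
def idealI (M : Matroid (Fin (n + 1))) : Ideal (PolyRing M) :=
  Ideal.span {f | ∃ S : Finset (Biflat M), ¬ IsBiflag M S ∧ f = mono M S}

/-- The ideal generated by the differences `γ_i - γ_j` and `γ̄_i - γ̄_j`. -/
def idealJ (M : Matroid (Fin (n + 1))) : Ideal (PolyRing M) :=
  Ideal.span {f | ∃ i j : Fin (n + 1),
    f = gammaForm M i - gammaForm M j ∨ f = gammaBarForm M i - gammaBarForm M j}

/-- The conormal Chow ring of `M`. -/
abbrev ChowRing (M : Matroid (Fin (n + 1))) : Type := PolyRing M ⧸ (idealI M ⊔ idealJ M)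

/-- The quotient map onto the conormal Chow ring, as an `ℝ`-algebra homomorphism. -/
def toChow (M : Matroid (Fin (n + 1))) : PolyRing M →ₐ[ℝ] ChowRing M :=
  Ideal.Quotient.mkₐ ℝ (idealI M ⊔ idealJ M)

/-- The class of `γ_i`, which does not depend on `i`; see `toChow_gammaForm`. -/
def gamma (M : Matroid (Fin (n + 1))) : ChowRing M := toChow M (gammaForm M 0)

/-- The class of `δ_i`, which does not depend on `i`; see `toChow_deltaForm`. -/
def delta (M : Matroid (Fin (n + 1))) : ChowRing M := toChow M (deltaForm M 0)

/-- The class in the conormal Chow ring of the monomial of a set of biflats. -/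
def xmono (M : Matroid (Fin (n + 1))) (S : Finset (Biflat M)) : ChowRing M :=
  toChow M (mono M S)

theorem toChow_gammaForm (M : Matroid (Fin (n + 1))) (i : Fin (n + 1)) :
    toChow M (gammaForm M i) = gamma M := by
  refine Ideal.Quotient.eq.2 (Ideal.mem_sup_right (Ideal.subset_span ⟨i, 0, Or.inl rfl⟩))

theorem toChow_gammaBarForm (M : Matroid (Fin (n + 1))) (i j : Fin (n + 1)) :
    toChow M (gammaBarForm M i) = toChow M (gammaBarForm M j) := by
  refine Ideal.Quotient.eq.2 (Ideal.mem_sup_right (Ideal.subset_span ⟨i, j, Or.inr rfl⟩))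

theorem deltaForm_eq (M : Matroid (Fin (n + 1))) (hE : M.E = Set.univ) (i : Fin (n + 1)) :
    deltaForm M i = gammaForm M i + gammaBarForm M i
      - ∑ p : Biflat M with p.F ≠ M.E ∧ p.G ≠ M.E, MvPolynomial.X p := by
  unfold deltaForm gammaForm gammaBarForm
  simp only [Finset.sum_filter]
  rw [← Finset.sum_add_distrib, ← Finset.sum_sub_distrib]
  refine Finset.sum_congr rfl fun p _ => ?_
  have hu : i ∈ p.F ∪ p.G := by
    have h : p.F ∪ p.G = M.E := p.2.union_eq
    rw [h, hE]; trivial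
  have hn : ¬ (p.F = M.E ∧ p.G = M.E) := p.2.not_both
  have h1 : p.F = M.E → i ∈ p.F := by intro h; rw [h, hE]; trivial
  have h2 : p.G = M.E → i ∈ p.G := by intro h; rw [h, hE]; trivial
  simp only [Set.mem_inter_iff]
  by_cases hF : p.F = M.E <;> by_cases hG : p.G = M.E <;>
    by_cases iF : i ∈ p.F <;> by_cases iG : i ∈ p.G <;> simp_all

theorem toChow_deltaForm (M : Matroid (Fin (n + 1))) (hE : M.E = Set.univ) (i : Fin (n + 1)) :
    toChow M (deltaForm M i) = delta M := by
  unfold delta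
  rw [deltaForm_eq M hE i, deltaForm_eq M hE 0]
  simp only [map_sub, map_add]
  rw [toChow_gammaForm M i, toChow_gammaForm M 0, toChow_gammaBarForm M i 0]

/-- The graded piece of degree `d` of the conormal Chow ring: the classes of the homogeneous
polynomials of degree `d`. -/
def chowPiece (M : Matroid (Fin (n + 1))) (d : ℕ) : Submodule ℝ (ChowRing M) :=
  (MvPolynomial.homogeneousSubmodule (Biflat M) ℝ d).map (toChow M).toLinearMap

theorem xmono_mem_chowPiece (M : Matroid (Fin (n + 1))) (S : Finset (Biflat M)) {d : ℕ}
    (hS : S.card = d) : xmono M S ∈ chowPiece M d := by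
  refine ⟨mono M S, ?_, rfl⟩
  have h := MvPolynomial.IsHomogeneous.prod S (fun p => (MvPolynomial.X p : PolyRing M))
    (fun _ => 1) (fun p _ => MvPolynomial.isHomogeneous_X ℝ p)
  simpa [mono, hS] using h

/-- `deg : A^{n-1} → ℝ` is the degree map if it is linear and sends the monomial of a set of
`n - 1` biflats to `1` if that set is a biflag, and to `0` otherwise. -/
def IsDegreeMap (M : Matroid (Fin (n + 1))) (deg : chowPiece M (n - 1) →ₗ[ℝ] ℝ) : Prop :=
  ∀ (S : Finset (Biflat M)) (hS : S.card = n - 1),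
    deg ⟨xmono M S, xmono_mem_chowPiece M S hS⟩ = if IsBiflag M S then 1 else 0

/-! ### Activities and nbc bases -/

/-- The externally active set of a basis `B`: the `i ∉ B` that are least in the fundamental
circuit `C(B, i)`. -/
def extActive (M : Matroid (Fin (n + 1))) (B : Finset (Fin (n + 1))) : Finset (Fin (n + 1)) :=
  {i | i ∉ B ∧ IsLeast (M.fundCircuit i B) i}

/-- The internally active set of a basis `B`: the `i ∈ B` that are least in the fundamental
cocircuit of `B` and `i`. -/
def intActive (M : Matroid (Fin (n + 1))) (B : Finset (Fin (n + 1))) : Finset (Fin (n + 1)) :=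
  {i | i ∈ B ∧ IsLeast (M.fundCocircuit i B) i}

/-- `B` is an nbc basis: a basis with no externally active element. -/
def IsNbcBasis (M : Matroid (Fin (n + 1))) (B : Finset (Fin (n + 1))) : Prop :=
  M.IsBase (B : Set (Fin (n + 1))) ∧ extActive M B = ∅

/-- The finite set of nbc bases of internal activity `a`. -/
def nbcBases (M : Matroid (Fin (n + 1))) (a : ℕ) : Finset (Finset (Fin (n + 1))) :=
  {B | IsNbcBasis M B ∧ (intActive M B).card = a}

/-! ### Extended nbc biflags -/

/-- `S = B - IA(B)`. -/
def setS (M : Matroid (Fin (n + 1))) (B : Finset (Fin (n + 1))) : Finset (Fin (n + 1)) :=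
  B \ intActive M B

/-- `T = B^⊥ - min B^⊥`, where `B^⊥ = E - B`: the elements outside `B` that are not the least
element outside `B`. -/
def setT (B : Finset (Fin (n + 1))) : Finset (Fin (n + 1)) :=
  {e ∈ Bᶜ | ∃ m ∈ Bᶜ, m < e}

/-- The list `e_1 > ⋯ > e_{r-k}` of the elements of `S`. -/
def listS (M : Matroid (Fin (n + 1))) (B : Finset (Fin (n + 1))) : List (Fin (n + 1)) :=
  (setS M B).sort (fun a b => b ≤ a)

/-- The list `e_{r-k+1} < ⋯ < e_{n-k-1}` of the elements of `T`. -/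
def listT (B : Finset (Fin (n + 1))) : List (Fin (n + 1)) :=
  (setT B).sort (fun a b => a ≤ b)

/-- The list `c_1 > ⋯ > c_{k+1}` of the internally active elements of `B`. -/
def listC (M : Matroid (Fin (n + 1))) (B : Finset (Fin (n + 1))) : List (Fin (n + 1)) :=
  (intActive M B).sort (fun a b => b ≤ a)

/-- The largest index `i` (counted from `1`) such that `c_i ∉ cl(S) ∪ cl^⊥(T)`. -/
def switchIndex (M : Matroid (Fin (n + 1))) (B : Finset (Fin (n + 1))) : ℕ :=
  ({i ∈ Finset.Icc 1 (intActive M B).card | ∃ c, (listC M B)[i - 1]? = some c ∧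
      c ∉ M.closure (setS M B) ∪ M✶.closure (setT B)}).sup id

/-- The flat in column `j` (`1 ≤ j ≤ n - 1`) of the extended nbc biflag of `B`. With
`r - k = |S|` and `k + 1 = |IA(B)|` it is `cl(e_1, …, e_j)` for `j ≤ r - k`,
`cl(S, c_1, …, c_{j-(r-k)})` for `r - k < j ≤ r`, and `E` for `j > r`. -/
def extF (M : Matroid (Fin (n + 1))) (B : Finset (Fin (n + 1))) (j : ℕ) : Set (Fin (n + 1)) :=
  if j ≤ (setS M B).card then
    M.closure {e | e ∈ (listS M B).take j}
  else if j + 1 ≤ (setS M B).card + (intActive M B).card then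
    M.closure ((setS M B : Set (Fin (n + 1))) ∪
      {e | e ∈ (listC M B).take (j - (setS M B).card)})
  else M.E

/-- The coflat in column `j` (`1 ≤ j ≤ n - 1`) of the extended nbc biflag of `B`. With `i` the
switch index it is `E` for `j ≤ (r - k) + (i - 1)`, then `cl^⊥(T)` for
`(r - k) + i ≤ j ≤ r`, and `cl^⊥(e_{j-k}, …, e_{n-k-1})` for `j > r`, where
`(e_{j-k}, …, e_{n-k-1})` is the list of the elements of `T` without its first `j - r - 1`
entries. -/
def extG (M : Matroid (Fin (n + 1))) (B : Finset (Fin (n + 1))) (j : ℕ) : Set (Fin (n + 1)) :=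
  if j + 1 ≤ (setS M B).card + switchIndex M B then M.E
  else if j + 1 ≤ (setS M B).card + (intActive M B).card then
    M✶.closure (setT B)
  else
    M✶.closure {e | e ∈ (listT B).drop (j - ((setS M B).card + (intActive M B).card))}

/-- The extended nbc biflag of `B`, as the set of its columns `F⁺_j|G⁺_j`, `1 ≤ j ≤ n - 1`. -/
def extBiflag (M : Matroid (Fin (n + 1))) (B : Finset (Fin (n + 1))) : Finset (Biflat M) :=
  {p | ∃ j ∈ Finset.Icc 1 (n - 1), p.F = extF M B j ∧ p.G = extG M B j}

/-! ### The broken circuit complex and its `h`-vector -/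

/-- The broken circuit complex: the subsets of `E` that contain no broken circuit, that is, no
set `C - min C` with `C` a circuit. -/
def brokenCircuitComplex (M : Matroid (Fin (n + 1))) : Finset (Finset (Fin (n + 1))) :=
  {I | ∀ (C : Set (Fin (n + 1))) (m : Fin (n + 1)), M.IsCircuit C → IsLeast C m →
    ¬ (C \ {m} ⊆ (I : Set (Fin (n + 1))))}

/-- The largest size of a face of `Δ`, which is the dimension of `Δ` plus one. -/
def maxFace (Δ : Finset (Finset (Fin (n + 1)))) : ℕ := Δ.sup Finset.card

/-- `f_i(Δ)`, the number of faces with `i` vertices. -/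
def fVec (Δ : Finset (Finset (Fin (n + 1)))) (i : ℕ) : ℕ := (Δ.filter (fun I => I.card = i)).card

/-- The polynomial `∑ f_i q^{d-i}`, where `d = dim Δ + 1`. -/
def fPoly (Δ : Finset (Finset (Fin (n + 1)))) : Polynomial ℤ :=
  ∑ i ∈ Finset.range (maxFace Δ + 1),
    Polynomial.C (fVec Δ i : ℤ) * Polynomial.X ^ (maxFace Δ - i)

/-- `h_i(Δ)` for `0 ≤ i ≤ d = dim Δ + 1`: the coefficient of `(q + 1)^{d-i}` in the expansion
of `∑ f_i q^{d-i}` in powers of `q + 1`; see `sum_hVec`. -/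
def hVec (Δ : Finset (Finset (Fin (n + 1)))) (i : ℕ) : ℤ :=
  ((fPoly Δ).comp (Polynomial.X - 1)).coeff (maxFace Δ - i)

theorem sum_hVec (Δ : Finset (Finset (Fin (n + 1)))) :
    fPoly Δ = ∑ i ∈ Finset.range (maxFace Δ + 1),
      Polynomial.C (hVec Δ i) * (Polynomial.X + 1) ^ (maxFace Δ - i) := by
  have hdeg : ((fPoly Δ).comp (Polynomial.X - 1)).natDegree < maxFace Δ + 1 := by
    refine Nat.lt_succ_of_le (Polynomial.natDegree_comp_le.trans ?_)
    have h1 : (Polynomial.X - 1 : Polynomial ℤ).natDegree ≤ 1 := by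
      simpa using Polynomial.natDegree_X_sub_C_le (R := ℤ) 1
    have h2 : (fPoly Δ).natDegree ≤ maxFace Δ := by
      refine Polynomial.natDegree_sum_le_of_forall_le _ _ fun i _ => ?_
      exact (Polynomial.natDegree_C_mul_X_pow_le _ _).trans (Nat.sub_le _ _)
    calc _ ≤ maxFace Δ * 1 := Nat.mul_le_mul h2 h1
      _ = maxFace Δ := Nat.mul_one _
  have h := Polynomial.as_sum_range_C_mul_X_pow' _ hdeg
  have h3 := congrArg (fun p : Polynomial ℤ => p.comp (Polynomial.X + 1)) h
  simp only [Polynomial.comp_assoc] at h3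
  rw [Polynomial.sum_comp] at h3
  simp only [Polynomial.sub_comp, Polynomial.X_comp, Polynomial.one_comp, add_sub_cancel_right,
    Polynomial.comp_X, Polynomial.mul_comp, Polynomial.C_comp, Polynomial.pow_comp] at h3
  rw [h3, ← Finset.sum_range_reflect]
  refine Finset.sum_congr rfl fun i _ => ?_
  simp [hVec]

end LagrangianMatroid

end

/-! The expansion is computed by multiplying by `δ` one factor at a time, representing `δ` each time
by the form at a well chosen index. A set `S` of biflats leaves a gap: the elements lying in no `F ∩
G`. If `i` is in the gap, `δ_i x_S` is a sum of squarefree monomials `x_{S ∪ q}` with `i ∈ q.F ∩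
q.G`. The index used is the greatest element `e` of the gap. Suppose the biflag so far consists of
the flags `cl(L_{≥x})|E` and `E|cl^⊥(T_{≥x})` of a pair `L`, `T`, so that the gap is `gapSet M L T`.
After multiplication by all remaining factors, including `γ^k`, only the two biflats `cl(L ∪ e)|E`
and `E|cl^⊥(T ∪ e)` can contribute. Thus `e` moves into `L` or into `T`, and the product unfolds as
a binary tree (`IsGreedy.xmono_mul_delta_pow`).

The decisive point is that a biflat `q` proper on both sides contributes nothing. In a biflag of
length `n - 1` with gap element `i`, the height of `q`, corrected at the gap, gives the exact number
of members below `q` (`card_below_eq`). On the other hand one may choose the later indices `i` so as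
to fill the part of the gap outside `q.G` first, and a rank count bounds the number of such
insertions (`BelowState.card_le`). This bounds the height of `q` from above; the dual strategy
bounds it from below. Together the bounds say that `q.F ∩ q.G` has at most as many elements as `L ∩
q.G` and `T ∩ q.F` together, although it contains both, which are disjoint, and also `e`
(`IsGreedy.xmono_mul_eq_zero_of_ne_univ`). If one side of `q` is `E`, the same count fixes the rank
of the other side.

A leaf of the tree is a greedy pair with `|L| + |T| = n - k - 1`. If `|L| > r - k`, there is no room
for `k` further flats and `γ^k` kills it. Otherwise `|T| = n - r - 1`, and greedy pairs of this size
are exactly the pairs `S`, `T` of nbc bases, the basis being recovered from the greatest gap element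
`z = min B^⊥` (`IsNbcBasis.isGreedy`, `IsGreedy.exists_nbcBasis`). Multiplication by `γ` at `c_1,
c_2, …` in turn then has only one surviving term each time: the rank leaves one flat, and the coflat
is `E` or `cl^⊥(T)` according to whether the gap is still open
(`IsNbcBasis.xmono_partialBiflag_mul_gamma`).

The degree map is a separate matter. Uniqueness holds because squarefree monomials span each graded
piece. For existence, the function equal to one on maximal biflags is shown to be a Minkowski weight
on the conormal fan (`FlatPair.sum_fill_eq_zero`). Ray variables act on Minkowski weights by
commuting operators which satisfy the relations of the ring, so acting on this weight and evaluating
at the trivial cone gives a functional on the quotient.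

Finally the intervals from `B - IA(B)` to `B`, over nbc bases `B`, partition the broken circuit
complex. Hence the `f`-polynomial is `∑ (q + 1)^{|IA(B)|}`, and the coefficient of `(q + 1)^{k+1}`
counts the nbc bases of internal activity `k + 1`. -/

noncomputable section

open scoped Classical

namespace LagrangianMatroid

/-! ### Minkowski weights on a simplicial fan and the degree map they define -/

/-- The combinatorial data of a simplicial fan: the sets of rays which span a cone, and the
space of functions on the rays that come from linear functions. The rays of a cone are linearly
independent. -/
structure FanData (P : Type*) where
  face : Finset P → Prop
  face_mono : ∀ {S T : Finset P}, S ⊆ T → face T → face S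
  lin : Submodule ℝ (P → ℝ)
  indep : ∀ S : Finset P, face S → ∀ p ∈ S, ∃ l ∈ lin, l p = 1 ∧ ∀ q ∈ S, q ≠ p → l q = 0

namespace FanData

variable {P : Type*} (Φ : FanData P)

/-- The coordinate function of the ray `p` on the cone `S`, extended linearly. -/
def dual (S : Finset P) (p : P) : P → ℝ :=
  if h : Φ.face S ∧ p ∈ S then (Φ.indep S h.1 p h.2).choose else 0

variable {Φ}

theorem dual_mem (S : Finset P) (p : P) : Φ.dual S p ∈ Φ.lin := by
  unfold dual
  split_ifs with h
  · exact (Φ.indep S h.1 p h.2).choose_spec.1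
  · exact Φ.lin.zero_mem

theorem dual_self {S : Finset P} {p : P} (hS : Φ.face S) (hp : p ∈ S) : Φ.dual S p p = 1 := by
  have h : Φ.face S ∧ p ∈ S := ⟨hS, hp⟩
  simp only [dual, dif_pos h]
  exact (Φ.indep S h.1 p h.2).choose_spec.2.1

theorem dual_ne {S : Finset P} {p q : P} (hS : Φ.face S) (hp : p ∈ S) (hq : q ∈ S)
    (hqp : q ≠ p) : Φ.dual S p q = 0 := by
  have h : Φ.face S ∧ p ∈ S := ⟨hS, hp⟩
  simp only [dual, dif_pos h]
  exact (Φ.indep S h.1 p h.2).choose_spec.2.2 q hq hqp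

/-- The weight of the cone spanned by `τ` and one more ray `q`. -/
def adj (w : Finset P → ℝ) (τ : Finset P) (q : P) : ℝ := if q ∈ τ then 0 else w (insert q τ)

theorem adj_of_mem {w : Finset P → ℝ} {τ : Finset P} {q : P} (h : q ∈ τ) : adj w τ q = 0 :=
  if_pos h

theorem adj_of_notMem {w : Finset P → ℝ} {τ : Finset P} {q : P} (h : q ∉ τ) :
    adj w τ q = w (insert q τ) := if_neg h

theorem adj_insert_comm (w : Finset P → ℝ) (τ : Finset P) {s t : P} (hs : s ∉ τ) (ht : t ∉ τ) :
    adj w (insert s τ) t = adj w (insert t τ) s := by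
  by_cases h : s = t
  · subst h; rfl
  · rw [adj_of_notMem (by simp [ht, Ne.symm h]), adj_of_notMem (by simp [hs, h]),
      Finset.insert_comm]

variable [Fintype P]

/-- The value of `l` on the weighted sum of the rays adjacent to `τ`. -/
def bal (w : Finset P → ℝ) (τ : Finset P) (l : P → ℝ) : ℝ := ∑ q, adj w τ q * l q

variable (Φ)

/-- A Minkowski weight, of mixed dimension: a balanced function on the cones. -/
structure IsWeight (w : Finset P → ℝ) : Prop where
  supp : ∀ τ, ¬ Φ.face τ → w τ = 0
  bal : ∀ τ, Φ.face τ → ∀ l ∈ Φ.lin, (∀ p ∈ τ, l p = 0) → bal w τ l = 0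

/-- Intersection of a weight with the divisor of the ray `p`. -/
def mulRay (p : P) (w : Finset P → ℝ) : Finset P → ℝ := fun τ =>
  if p ∈ τ then - FanData.bal w τ (Φ.dual τ p) else w (insert p τ)

variable {Φ}

theorem mulRay_of_mem {p : P} {w : Finset P → ℝ} {τ : Finset P} (h : p ∈ τ) :
    Φ.mulRay p w τ = - FanData.bal w τ (Φ.dual τ p) := if_pos h

theorem mulRay_of_notMem {p : P} {w : Finset P → ℝ} {τ : Finset P} (h : p ∉ τ) :
    Φ.mulRay p w τ = w (insert p τ) := if_neg h

/-! ### The ray operators preserve weights and commute -/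

namespace IsWeight

variable {w : Finset P → ℝ} (hw : Φ.IsWeight w)

include hw

theorem adj_eq_zero {τ : Finset P} (h : ¬ Φ.face τ) (q : P) : adj w τ q = 0 := by
  unfold adj
  split_ifs with hq
  · rfl
  · exact hw.supp _ fun h' => h (Φ.face_mono (Finset.subset_insert _ _) h')

theorem bal_eq_zero {τ : Finset P} (h : ¬ Φ.face τ) (l : P → ℝ) : FanData.bal w τ l = 0 :=
  Finset.sum_eq_zero fun q _ => by rw [hw.adj_eq_zero h, zero_mul]

/-- Subtracting from `l` its combination of dual coordinates leaves a linear function vanishing on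
`τ`, to which balancing applies. This extends balancing to all linear functions and makes the choice
of the dual functions harmless. -/
theorem bal_eq (τ : Finset P) {l : P → ℝ} (hl : l ∈ Φ.lin) :
    FanData.bal w τ l = ∑ p ∈ τ, l p * FanData.bal w τ (Φ.dual τ p) := by
  by_cases h : Φ.face τ
  · have h0 := hw.bal τ h (l - ∑ p ∈ τ, l p • Φ.dual τ p)
      (Φ.lin.sub_mem hl (Φ.lin.sum_mem fun p _ => Φ.lin.smul_mem _ (dual_mem τ p)))
      (by
        intro q hq
        rw [Pi.sub_apply, Finset.sum_apply, Finset.sum_eq_single q]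
        · simp [dual_self h hq]
        · intro b hb hbq
          simp [dual_ne h hb hq (Ne.symm hbq)]
        · intro h'; exact absurd hq h')
    have h1 : FanData.bal w τ (l - ∑ p ∈ τ, l p • Φ.dual τ p)
        = FanData.bal w τ l - ∑ p ∈ τ, l p * FanData.bal w τ (Φ.dual τ p) := by
      simp only [FanData.bal, Pi.sub_apply, Finset.sum_apply, Pi.smul_apply, smul_eq_mul,
        Finset.mul_sum]
      rw [Finset.sum_comm, ← Finset.sum_sub_distrib]
      refine Finset.sum_congr rfl fun q _ => ?_
      rw [mul_sub, Finset.mul_sum]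
      congr 1
      exact Finset.sum_congr rfl fun p _ => by ring
    linarith
  · rw [hw.bal_eq_zero h]
    exact (Finset.sum_eq_zero fun p _ => by rw [hw.bal_eq_zero h, mul_zero]).symm

theorem bal_insert {τ : Finset P} {s : P} (hs : s ∉ τ) {l : P → ℝ} (hl : l ∈ Φ.lin)
    (h0 : ∀ p ∈ τ, l p = 0) :
    FanData.bal w (insert s τ) l
      = l s * FanData.bal w (insert s τ) (Φ.dual (insert s τ) s) := by
  rw [hw.bal_eq _ hl, Finset.sum_insert hs, Finset.sum_eq_zero, add_zero]
  intro p hp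
  rw [h0 p hp, zero_mul]

/-- On the rays of the larger cone, the coordinate of `p` chosen for `τ` is the coordinate of `p`
for the larger cone plus a multiple of that of `s`; `bal_eq` turns this into the change of
coordinates. -/
theorem bal_insert_dual {τ : Finset P} {s p : P} (hs : s ∉ τ) (hp : p ∈ τ) :
    FanData.bal w (insert s τ) (Φ.dual (insert s τ) p)
      = FanData.bal w (insert s τ) (Φ.dual τ p)
        - Φ.dual τ p s * FanData.bal w (insert s τ) (Φ.dual (insert s τ) s) := by
  by_cases h : Φ.face (insert s τ)
  · have hτ : Φ.face τ := Φ.face_mono (Finset.subset_insert _ _) h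
    rw [hw.bal_eq (insert s τ) (dual_mem τ p), Finset.sum_insert hs, Finset.sum_eq_single p]
    · rw [dual_self hτ hp]; ring
    · intro b hb hbp
      rw [dual_ne hτ hp hb hbp, zero_mul]
    · intro h'; exact absurd hp h'
  · simp [hw.bal_eq_zero h]

/-- The linear relations of the ring hold for the operators. Rays outside `τ` contribute the
balancing sum of `l`, rays inside contribute minus its expansion by `bal_eq`. The self-intersection
case of `mulRay` is designed for this cancellation. -/
theorem sum_lin_mulRay {l : P → ℝ} (hl : l ∈ Φ.lin) (τ : Finset P) :
    ∑ p, l p * Φ.mulRay p w τ = 0 := by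
  have h1 : ∀ p, l p * Φ.mulRay p w τ
      = adj w τ p * l p - if p ∈ τ then l p * FanData.bal w τ (Φ.dual τ p) else 0 := by
    intro p
    by_cases hp : p ∈ τ
    · rw [mulRay_of_mem hp, adj_of_mem hp, if_pos hp]; ring
    · rw [mulRay_of_notMem hp, adj_of_notMem hp, if_neg hp]; ring
  rw [Finset.sum_congr rfl fun p _ => h1 p, Finset.sum_sub_distrib, ← Finset.sum_filter,
    Finset.filter_mem_eq_inter, Finset.univ_inter, ← hw.bal_eq τ hl]
  exact sub_self _

-- Expanding both sides gives a double sum over rays `s`, `t` outside `τ`, weighted by the cone on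
-- `τ`, `s`, `t`, which is symmetric in `s` and `t`. Both the balancing of `mulRay p w` and the
-- commutation at two rays of `τ` rest on this symmetry.
omit hw in
theorem sum_adj_adj_comm (w : Finset P → ℝ) (τ : Finset P) (l m : P → ℝ) :
    ∑ s, (if s ∈ τ then 0 else l s * FanData.bal w (insert s τ) m)
      = ∑ s, (if s ∈ τ then 0 else m s * FanData.bal w (insert s τ) l) := by
  have h : ∀ l m : P → ℝ, ∑ s, (if s ∈ τ then 0 else l s * FanData.bal w (insert s τ) m)
      = ∑ s, ∑ t, if s ∈ τ ∨ t ∈ τ then 0 else adj w (insert s τ) t * (l s * m t) := by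
    intro l m
    refine Finset.sum_congr rfl fun s _ => ?_
    by_cases hs : s ∈ τ
    · simp [hs]
    · simp only [hs, if_false, false_or, FanData.bal, Finset.mul_sum]
      refine Finset.sum_congr rfl fun t _ => ?_
      by_cases ht : t ∈ τ
      · simp [ht, adj_of_mem (w := w) (Finset.mem_insert_of_mem ht : t ∈ insert s τ)]
      · simp only [ht, if_false]; ring
  rw [h l m, h m l, Finset.sum_comm]
  refine Finset.sum_congr rfl fun s _ => Finset.sum_congr rfl fun t _ => ?_
  by_cases hs : s ∈ τ
  · simp [hs]
  by_cases ht : t ∈ τ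
  · simp [ht]
  simp only [hs, ht, or_self, if_false]
  rw [adj_insert_comm w τ ht hs]
  ring

theorem bal_mulRay_of_mem {τ : Finset P} {p : P} (hp : p ∈ τ) (l : P → ℝ) :
    FanData.bal (Φ.mulRay p w) τ l
      = - ∑ s, (if s ∈ τ then 0 else l s * FanData.bal w (insert s τ) (Φ.dual τ p))
        + ∑ s, (if s ∈ τ then 0 else l s * Φ.dual τ p s *
            FanData.bal w (insert s τ) (Φ.dual (insert s τ) s)) := by
  rw [neg_add_eq_sub, ← Finset.sum_sub_distrib]
  refine Finset.sum_congr rfl fun s _ => ?_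
  by_cases hs : s ∈ τ
  · simp [adj_of_mem hs, hs]
  · rw [adj_of_notMem hs, mulRay_of_mem (Finset.mem_insert_of_mem hp), hw.bal_insert_dual hs hp,
      if_neg hs, if_neg hs]
    ring

omit hw in
theorem bal_mulRay_of_notMem {τ : Finset P} {p : P} (hp : p ∉ τ) (l : P → ℝ) :
    FanData.bal (Φ.mulRay p w) τ l
      = FanData.bal w (insert p τ) l
        - l p * FanData.bal w (insert p τ) (Φ.dual (insert p τ) p) := by
  have h : ∀ s, adj (Φ.mulRay p w) τ s * l s = adj w (insert p τ) s * l s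
      - if s = p then l p * FanData.bal w (insert p τ) (Φ.dual (insert p τ) p) else 0 := by
    intro s
    by_cases hsp : s = p
    · subst hsp
      rw [adj_of_notMem hp, mulRay_of_mem (Finset.mem_insert_self _ _),
        adj_of_mem (Finset.mem_insert_self _ _), if_pos rfl]
      ring
    · rw [if_neg hsp, sub_zero]
      by_cases hs : s ∈ τ
      · rw [adj_of_mem hs, adj_of_mem (Finset.mem_insert_of_mem hs)]
      · rw [adj_of_notMem hs, mulRay_of_notMem (by simp [hp, Ne.symm hsp]),
          adj_of_notMem (by simp [hs, hsp]), Finset.insert_comm]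
  unfold FanData.bal at h ⊢
  rw [Finset.sum_congr rfl fun s _ => h s, Finset.sum_sub_distrib]
  simp

/-- If `p` is a ray of `τ`, swapping the roles of `l` and the coordinate of `p` makes the two terms
of `bal_mulRay_of_mem` cancel. If not, `l` restricted to the cone with `p` added is `l p` times the
coordinate of `p`. -/
theorem mulRay (p : P) : Φ.IsWeight (Φ.mulRay p w) := by
  refine ⟨fun τ hτ => ?_, fun τ hτ l hl h0 => ?_⟩
  · by_cases hp : p ∈ τ
    · rw [mulRay_of_mem hp, hw.bal_eq_zero hτ, neg_zero]
    · rw [mulRay_of_notMem hp]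
      exact hw.supp _ fun h => hτ (Φ.face_mono (Finset.subset_insert _ _) h)
  · by_cases hp : p ∈ τ
    · rw [hw.bal_mulRay_of_mem hp, sum_adj_adj_comm, neg_add_eq_sub, sub_eq_zero]
      refine Finset.sum_congr rfl fun s _ => ?_
      by_cases hs : s ∈ τ
      · simp [hs]
      · rw [if_neg hs, if_neg hs, hw.bal_insert hs hl h0]; ring
    · rw [bal_mulRay_of_notMem hp, hw.bal_insert hp hl h0, sub_self]

theorem mulRay_comm (p q : P) : Φ.mulRay p (Φ.mulRay q w) = Φ.mulRay q (Φ.mulRay p w) := by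
  -- The mixed case, where only one of the two rays is in the cone; it is used in both orders.
  have key : ∀ p q, ∀ τ : Finset P, p ∈ τ → q ∉ τ →
      Φ.mulRay p (Φ.mulRay q w) τ = Φ.mulRay q (Φ.mulRay p w) τ := by
    intro p q τ hp hq
    rw [mulRay_of_mem hp, bal_mulRay_of_notMem hq, mulRay_of_notMem hq,
      mulRay_of_mem (Finset.mem_insert_of_mem hp), hw.bal_insert_dual hq hp]
  funext τ
  by_cases hp : p ∈ τ
  · by_cases hq : q ∈ τ
    · rw [mulRay_of_mem hp, mulRay_of_mem hq, hw.bal_mulRay_of_mem hp, hw.bal_mulRay_of_mem hq,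
        sum_adj_adj_comm]
      congr 2
      exact Finset.sum_congr rfl fun s _ => by rw [mul_comm (Φ.dual τ p s)]
    · exact key p q τ hp hq
  · by_cases hq : q ∈ τ
    · exact (key q p τ hq hp).symm
    · rw [mulRay_of_notMem hp, mulRay_of_notMem hq]
      by_cases hpq : p = q
      · subst hpq; rfl
      · rw [mulRay_of_notMem (by simp [hq, Ne.symm hpq]), mulRay_of_notMem (by simp [hp, hpq]),
          Finset.insert_comm]

end IsWeight

variable (Φ)

/-- The space of Minkowski weights. -/
def weights : Submodule ℝ (Finset P → ℝ) where
  carrier := {w | Φ.IsWeight w}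
  zero_mem' := ⟨fun _ _ => rfl, fun τ _ l _ _ => Finset.sum_eq_zero fun q _ => by simp [adj]⟩
  add_mem' := by
    intro a b ha hb
    refine ⟨fun τ h => by simp [ha.supp τ h, hb.supp τ h], fun τ h l hl h0 => ?_⟩
    have h1 := ha.bal τ h l hl h0
    have h2 := hb.bal τ h l hl h0
    have h3 : FanData.bal (a + b) τ l = FanData.bal a τ l + FanData.bal b τ l := by
      simp only [FanData.bal, ← Finset.sum_add_distrib]
      refine Finset.sum_congr rfl fun q _ => ?_
      by_cases hq : q ∈ τ <;> simp [adj, hq, add_mul]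
    rw [h3, h1, h2, add_zero]
  smul_mem' := by
    intro c a ha
    refine ⟨fun τ h => by simp [ha.supp τ h], fun τ h l hl h0 => ?_⟩
    have h1 := ha.bal τ h l hl h0
    have h3 : FanData.bal (c • a) τ l = c * FanData.bal a τ l := by
      simp only [FanData.bal, Finset.mul_sum]
      refine Finset.sum_congr rfl fun q _ => ?_
      by_cases hq : q ∈ τ <;> simp [adj, hq, mul_assoc]
    rw [h3, h1, mul_zero]

/-- `mulRay` as an endomorphism of the space of weights. -/
def ray (p : P) : Module.End ℝ Φ.weights where
  toFun w := ⟨Φ.mulRay p w.1, w.2.mulRay p⟩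
  map_add' := by
    intro a b
    apply Subtype.ext
    funext τ
    by_cases hp : p ∈ τ
    · simp only [Submodule.coe_add, mulRay_of_mem hp, Pi.add_apply, FanData.bal]
      rw [← neg_add, ← Finset.sum_add_distrib]
      congr 1
      refine Finset.sum_congr rfl fun q _ => ?_
      by_cases hq : q ∈ τ <;> simp [adj, hq, add_mul]
    · simp [mulRay_of_notMem hp]
  map_smul' := by
    intro c a
    apply Subtype.ext
    funext τ
    by_cases hp : p ∈ τ
    · simp only [Submodule.coe_smul, mulRay_of_mem hp, Pi.smul_apply, FanData.bal,
        RingHom.id_apply, smul_eq_mul, mul_neg, Finset.mul_sum]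
      congr 1
      refine Finset.sum_congr rfl fun q _ => ?_
      by_cases hq : q ∈ τ <;> simp [adj, hq, mul_assoc]
    · simp [mulRay_of_notMem hp]

variable {Φ}

theorem ray_apply (p : P) (w : Φ.weights) (τ : Finset P) :
    (Φ.ray p w).1 τ = Φ.mulRay p w.1 τ := rfl

theorem ray_mul_comm (p q : P) : Φ.ray p * Φ.ray q = Φ.ray q * Φ.ray p :=
  LinearMap.ext fun w => Subtype.ext (w.2.mulRay_comm p q)

variable (Φ)

/-- The algebra generated by the operators `ray p`. -/
abbrev rayAlgebra : Subalgebra ℝ (Module.End ℝ Φ.weights) :=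
  Algebra.adjoin ℝ (Set.range Φ.ray)

/-- Evaluation of polynomials needs a commutative target. All endomorphisms do not form one, but the
subalgebra generated by commuting operators does. -/
instance : CommSemiring Φ.rayAlgebra :=
  { Φ.rayAlgebra.toSemiring with
    mul_comm := (Algebra.isMulCommutative_adjoin ℝ (by
      rintro _ ⟨p, rfl⟩ _ ⟨q, rfl⟩
      exact ray_mul_comm p q) : IsMulCommutative Φ.rayAlgebra).is_comm.comm }

/-- The action of the polynomial ring on the weights. -/
def action : MvPolynomial P ℝ →ₐ[ℝ] Φ.rayAlgebra :=
  MvPolynomial.aeval (S₁ := Φ.rayAlgebra)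
    fun p => (⟨Φ.ray p, Algebra.subset_adjoin ⟨p, rfl⟩⟩ : Φ.rayAlgebra)

/-- The functional on polynomials given by acting on the weight `w` and evaluating at the
trivial cone. -/
def functional (w : Φ.weights) : MvPolynomial P ℝ →ₗ[ℝ] ℝ where
  toFun f := ((Φ.action f).1 w).1 ∅
  map_add' f g := by simp
  map_smul' c f := by simp

variable {Φ}

theorem action_X (p : P) : (Φ.action (MvPolynomial.X p)).1 = Φ.ray p := by
  simp [action]

theorem action_mul (f g : MvPolynomial P ℝ) :
    (Φ.action (f * g)).1 = (Φ.action f).1 * (Φ.action g).1 := by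
  rw [map_mul]; rfl

/-- Disjointness and squarefreeness mean that only the easy branch of `mulRay` is ever used, so no
dual function enters. -/
theorem action_prod (w : Φ.weights) (S τ : Finset P) (h : Disjoint S τ) :
    ((Φ.action (∏ p ∈ S, MvPolynomial.X p)).1 w).1 τ = w.1 (S ∪ τ) := by
  induction S using Finset.induction_on generalizing τ with
  | empty => simp
  | insert p S hp ih =>
    rw [Finset.disjoint_insert_left] at h
    rw [Finset.prod_insert hp, action_mul, action_X, Module.End.mul_apply, ray_apply,
      mulRay_of_notMem h.1, ih]
    · rw [Finset.union_insert, Finset.insert_union]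
    · rw [Finset.disjoint_insert_right]
      exact ⟨hp, h.2⟩

theorem functional_prod (w : Φ.weights) (S : Finset P) :
    Φ.functional w (∏ p ∈ S, MvPolynomial.X p) = w.1 S := by
  have := action_prod w S ∅ (by simp)
  simpa [functional] using this

theorem functional_mul (w : Φ.weights) (f g : MvPolynomial P ℝ) :
    Φ.functional w (f * g) = Φ.functional ((Φ.action g).1 w) f := by
  change ((Φ.action (f * g)).1 w).1 ∅ = _
  rw [action_mul]
  rfl

/-- Let `f` act first: the result is again a weight, and weights vanish off the cones. -/
theorem functional_mul_prod_eq_zero (w : Φ.weights) (f : MvPolynomial P ℝ) {S : Finset P}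
    (hS : ¬ Φ.face S) : Φ.functional w (f * ∏ p ∈ S, MvPolynomial.X p) = 0 := by
  rw [mul_comm, functional_mul, functional_prod]
  exact ((Φ.action f).1 w).2.supp S hS

theorem functional_mul_lin_eq_zero (w : Φ.weights) (f : MvPolynomial P ℝ) {l : P → ℝ}
    (hl : l ∈ Φ.lin) : Φ.functional w (f * ∑ p, l p • MvPolynomial.X p) = 0 := by
  rw [mul_comm, functional_mul]
  have h := ((Φ.action f).1 w).2.sum_lin_mulRay hl ∅
  rw [map_sum]
  rw [← h]
  refine Finset.sum_congr rfl fun p _ => ?_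
  rw [map_smul, smul_eq_mul]
  congr 1
  change ((Φ.action (MvPolynomial.X p)).1 _).1 ∅ = _
  rw [action_X]
  rfl

/-! ### Squarefree monomials span -/

/-- Here `u` is the excess of a monomial over its squarefree support. A repeated variable `p ∈ S` is
replaced, using the linear relation of its dual function, by a combination of variables outside `S`.
The support grows by one and the excess drops by one. -/
theorem prod_mul_monomial_mem_span {A : Type*} [CommRing A] [Algebra ℝ A]
    (π : MvPolynomial P ℝ →ₐ[ℝ] A)
    (hI : ∀ S : Finset P, ¬ Φ.face S → π (∏ p ∈ S, MvPolynomial.X p) = 0)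
    (hJ : ∀ l ∈ Φ.lin, π (∑ p, l p • MvPolynomial.X p) = 0) (d k : ℕ) :
    ∀ (S : Finset P) (u : Multiset P), (∀ p ∈ u, p ∈ S) → u.card = k → S.card + k = d →
      π (∏ p ∈ S, MvPolynomial.X p) * (u.map fun p => π (MvPolynomial.X p)).prod ∈
        Submodule.span ℝ {x | ∃ S : Finset P, S.card = d ∧ x = π (∏ p ∈ S, MvPolynomial.X p)} := by
  induction k with
  | zero =>
    intro S u _ hu hS
    rw [Multiset.card_eq_zero] at hu
    subst hu
    exact Submodule.subset_span ⟨S, by simpa using hS, by simp⟩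
  | succ k ih =>
    intro S u hu hk hS
    obtain ⟨p, hp⟩ : ∃ p, p ∈ u := Multiset.card_pos_iff_exists_mem.1 (by omega)
    obtain ⟨v, rfl⟩ := Multiset.exists_cons_of_mem hp
    by_cases hf : Φ.face S
    · have hpS : p ∈ S := hu p hp
      have h := hJ _ (dual_mem S p)
      rw [map_sum, ← Finset.sum_add_sum_compl S, Finset.sum_eq_single_of_mem p hpS
        (fun q hq hqp => by rw [dual_ne hf hpS hq hqp, zero_smul, map_zero]),
        dual_self hf hpS, one_smul] at h
      have h' := eq_neg_of_add_eq_zero_left h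
      rw [Multiset.map_cons, Multiset.prod_cons, h', ← mul_assoc, mul_neg, Finset.mul_sum,
        neg_mul, Finset.sum_mul]
      refine Submodule.neg_mem _ (Submodule.sum_mem _ fun q hq => ?_)
      rw [Finset.mem_compl] at hq
      rw [map_smul, mul_smul_comm, smul_mul_assoc, mul_comm (π _) (π _), ← map_mul,
        ← Finset.prod_insert hq]
      refine Submodule.smul_mem _ _ (ih (insert q S) v (fun x hx => ?_) (by simpa using hk) ?_)
      · exact Finset.mem_insert_of_mem (hu x (Multiset.mem_cons_of_mem hx))
      · rw [Finset.card_insert_of_notMem hq]; omega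
    · rw [hI S hf, zero_mul]
      exact Submodule.zero_mem _

theorem map_homogeneous_le_span {A : Type*} [CommRing A] [Algebra ℝ A]
    (π : MvPolynomial P ℝ →ₐ[ℝ] A)
    (hI : ∀ S : Finset P, ¬ Φ.face S → π (∏ p ∈ S, MvPolynomial.X p) = 0)
    (hJ : ∀ l ∈ Φ.lin, π (∑ p, l p • MvPolynomial.X p) = 0) (d : ℕ) :
    (MvPolynomial.homogeneousSubmodule P ℝ d).map π.toLinearMap ≤
      Submodule.span ℝ {x | ∃ S : Finset P, S.card = d ∧ x = π (∏ p ∈ S, MvPolynomial.X p)} := by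
  rintro _ ⟨f, hf, rfl⟩
  rw [SetLike.mem_coe, MvPolynomial.mem_homogeneousSubmodule] at hf
  rw [MvPolynomial.as_sum f, map_sum]
  refine Submodule.sum_mem _ fun m hm => ?_
  have hd : m.degree = d := by
    have := hf (MvPolynomial.mem_support_iff.1 hm)
    rw [Finsupp.degree_eq_weight_one]; exact this
  have h1 : MvPolynomial.monomial m (f.coeff m)
      = f.coeff m • ∏ p ∈ m.support, MvPolynomial.X p ^ m p := by
    rw [MvPolynomial.monomial_eq, Finsupp.prod, MvPolynomial.smul_eq_C_mul]
  rw [h1, map_smul]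
  refine Submodule.smul_mem _ _ ?_
  -- Each variable of the support is split off once; the remaining `m p - 1` copies form the excess.
  set u : Multiset P := ∑ p ∈ m.support, Multiset.replicate (m p - 1) p with hu
  have h2 : (u.map fun p => π (MvPolynomial.X p)).prod
      = ∏ p ∈ m.support, π (MvPolynomial.X p) ^ (m p - 1) := by
    rw [hu, ← Multiset.coe_mapAddMonoidHom, map_sum, Multiset.prod_sum]
    exact Finset.prod_congr rfl fun p _ => by simp
  have h3 : ∀ p ∈ m.support, 1 ≤ m p := fun p hp =>
    Nat.one_le_iff_ne_zero.2 (Finsupp.mem_support_iff.1 hp)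
  have h4 := prod_mul_monomial_mem_span π hI hJ d u.card m.support u
    (fun p hp => by
      rw [hu, Multiset.mem_sum] at hp
      obtain ⟨q, hq, hp⟩ := hp
      rw [Multiset.eq_of_mem_replicate hp]; exact hq) rfl
    (by
      rw [hu, Multiset.card_sum]
      simp only [Multiset.card_replicate]
      rw [Finset.card_eq_sum_ones, ← Finset.sum_add_distrib, ← hd, Finsupp.degree_apply]
      exact Finset.sum_congr rfl fun p hp => by have := h3 p hp; omega)
  convert h4 using 1
  rw [h2, AlgHom.toLinearMap_apply, map_prod, map_prod, ← Finset.prod_mul_distrib]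
  refine Finset.prod_congr rfl fun p hp => ?_
  rw [map_pow, ← pow_succ', Nat.sub_add_cancel (h3 p hp)]

end FanData

variable {n r : ℕ}

/-! ### Ranks -/

section Rank

variable {M : Matroid (Fin (n + 1))}

/-- The rank of a set in a matroid, as a natural number. -/
def rk (M : Matroid (Fin (n + 1))) (X : Set (Fin (n + 1))) : ℕ := (M.eRk X).toNat

theorem coe_rk (M : Matroid (Fin (n + 1))) (X : Set (Fin (n + 1))) : (rk M X : ℕ∞) = M.eRk X :=
  ENat.natCast_toNat (ne_top_of_le_ne_top (Set.encard_ne_top_iff.2 X.toFinite) (M.eRk_le_encard X))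

theorem rk_mono {X Y : Set (Fin (n + 1))} (h : X ⊆ Y) : rk M X ≤ rk M Y := by
  have := M.eRk_mono h
  rw [← coe_rk, ← coe_rk] at this
  exact_mod_cast this

theorem rk_closure (X : Set (Fin (n + 1))) : rk M (M.closure X) = rk M X := by
  simp [rk]

theorem rk_empty : rk M ∅ = 0 := by simp [rk]

theorem rk_of_indep {I : Set (Fin (n + 1))} (h : M.Indep I) : rk M I = I.ncard := by
  have := h.eRk_eq_encard
  rw [← coe_rk, ← I.toFinite.cast_ncard_eq] at this
  exact_mod_cast this

theorem rk_insert (hE : M.E = Set.univ) {X : Set (Fin (n + 1))} {e : Fin (n + 1)}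
    (h : e ∉ M.closure X) : rk M (insert e X) = rk M X + 1 := by
  have := M.eRk_insert_eq_add_one (e := e) (X := X) ⟨by rw [hE]; trivial, h⟩
  rw [← coe_rk, ← coe_rk] at this
  exact_mod_cast this

theorem rk_lt (hE : M.E = Set.univ) {F X : Set (Fin (n + 1))} (hF : M.IsFlat F) (h : F ⊂ X) :
    rk M F < rk M X := by
  obtain ⟨e, heX, heF⟩ := Set.exists_of_ssubset h
  have h1 := rk_insert hE (X := F) (e := e) (by rwa [hF.closure])
  have h2 : rk M (insert e F) ≤ rk M X := rk_mono (Set.insert_subset heX h.subset)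
  omega

theorem rk_dual (hE : M.E = Set.univ) (X : Set (Fin (n + 1))) :
    rk M✶ X + rk M Set.univ = rk M Xᶜ + X.ncard := by
  have := M.eRk_dual_add_eRank X (by rw [hE]; exact Set.subset_univ X)
  rw [Matroid.eRank_def, hE, ← Set.compl_eq_univ_sdiff, ← coe_rk, ← coe_rk, ← coe_rk,
    ← X.toFinite.cast_ncard_eq] at this
  exact_mod_cast this

theorem flat_eq_closure_insert (hE : M.E = Set.univ) {F F' : Set (Fin (n + 1))}
    (hF : M.IsFlat F) (hF' : M.IsFlat F') (hle : F ⊆ F') (hr : rk M F' ≤ rk M F + 1)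
    {e : Fin (n + 1)} (he : e ∈ F') (he' : e ∉ F) : F' = M.closure (insert e F) := by
  have hsub : M.closure (insert e F) ⊆ F' := by
    rw [← hF'.closure]
    exact M.closure_subset_closure (Set.insert_subset he hle)
  by_contra hne
  have h1 := rk_lt hE (M.isFlat_closure _) (hsub.ssubset_of_ne (Ne.symm hne))
  rw [rk_closure, rk_insert hE (by rwa [hF.closure])] at h1
  omega

/-- The matroid has no loops, no coloops and rank `r + 1`. -/
structure IsGood (M : Matroid (Fin (n + 1))) (r : ℕ) : Prop where
  ground : M.E = Set.univ
  rk_univ : rk M Set.univ = r + 1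
  rk_dual_univ : rk M✶ Set.univ + r = n
  loopless : ∀ e, e ∉ M.closure ∅
  coloopless : ∀ e, e ∉ M✶.closure ∅

namespace IsGood

theorem of_eRank (hE : M.E = Set.univ) (hloop : M.loops = ∅) (hcoloop : M.coloops = ∅)
    (hr : M.eRank = (r : ℕ∞) + 1) : IsGood M r := by
  have h1 : rk M Set.univ = r + 1 := by
    rw [M.eRank_def, hE, ← coe_rk] at hr
    exact_mod_cast hr
  refine ⟨hE, h1, ?_, fun e he => ?_, fun e he => ?_⟩
  · have := rk_dual hE Set.univ
    rw [h1, Set.compl_univ, rk_empty, Set.ncard_univ, Nat.card_eq_fintype_card,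
      Fintype.card_fin] at this
    omega
  · rw [M.closure_empty, hloop] at he
    exact he
  · rw [M✶.closure_empty] at he
    have : M✶.loops = M.coloops := rfl
    rw [this, hcoloop] at he
    exact he

variable (hM : IsGood M r)
include hM

theorem dual_ground : M✶.E = Set.univ := hM.ground

theorem rk_pos {X : Set (Fin (n + 1))} (h : X.Nonempty) : 0 < rk M X := by
  obtain ⟨e, he⟩ := h
  have h1 := rk_insert hM.ground (hM.loopless e)
  have h2 : rk M (insert e ∅) ≤ rk M X := rk_mono (by simpa using he)
  omega

theorem rk_dual_pos {X : Set (Fin (n + 1))} (h : X.Nonempty) : 0 < rk M✶ X := by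
  obtain ⟨e, he⟩ := h
  have h1 := rk_insert hM.dual_ground (hM.coloopless e)
  have h2 : rk M✶ (insert e ∅) ≤ rk M✶ X := rk_mono (by simpa using he)
  omega

theorem r_lt : r < n := by
  have := hM.rk_dual_pos (X := Set.univ) ⟨0, trivial⟩
  have := hM.rk_dual_univ
  omega

theorem dual : IsGood M✶ (n - r - 1) := by
  have h1 := hM.r_lt
  have h2 := hM.rk_dual_univ
  refine ⟨hM.dual_ground, by omega, ?_, hM.coloopless, ?_⟩
  · rw [Matroid.dual_dual, hM.rk_univ]; omega
  · rw [Matroid.dual_dual]; exact hM.loopless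

theorem isFlat_empty : M.IsFlat ∅ := by
  have : M.closure ∅ = ∅ := Set.eq_empty_iff_forall_notMem.2 hM.loopless
  rw [← this]; exact M.isFlat_closure _

theorem isFlat_univ : M.IsFlat Set.univ := by
  rw [← hM.ground]; exact M.ground_isFlat

theorem eq_univ_of_rk {F : Set (Fin (n + 1))} (hF : M.IsFlat F) (h : r + 1 ≤ rk M F) :
    F = Set.univ := by
  by_contra hne
  have := rk_lt hM.ground hF (Set.ssubset_univ_iff.2 hne)
  rw [hM.rk_univ] at this
  omega

theorem rk_le_of_ne_univ {F : Set (Fin (n + 1))} (hF : M.IsFlat F) (h : F ≠ Set.univ) :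
    rk M F ≤ r := by
  have := rk_lt hM.ground hF (Set.ssubset_univ_iff.2 h)
  rw [hM.rk_univ] at this
  omega

end IsGood

end Rank

/-! ### The order on biflats and heights -/

section Order

variable {M : Matroid (Fin (n + 1))}

instance : PartialOrder (Biflat M) where
  le p q := p.F ⊆ q.F ∧ q.G ⊆ p.G
  le_refl p := ⟨subset_rfl, subset_rfl⟩
  le_trans p q s h1 h2 := ⟨h1.1.trans h2.1, h2.2.trans h1.2⟩
  le_antisymm p q h1 h2 :=
    Subtype.ext (Prod.ext (h1.1.antisymm h2.1) (h2.2.antisymm h1.2))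

theorem biflat_le_iff {p q : Biflat M} : p ≤ q ↔ p.F ⊆ q.F ∧ q.G ⊆ p.G := Iff.rfl

theorem biflat_ext {p q : Biflat M} (h1 : p.F = q.F) (h2 : p.G = q.G) : p = q :=
  Subtype.ext (Prod.ext h1 h2)

theorem isBiflag_iff (hE : M.E = Set.univ) {S : Finset (Biflat M)} :
    IsBiflag M S ↔ (∀ p ∈ S, ∀ q ∈ S, p ≤ q ∨ q ≤ p) ∧ ∃ i, ∀ p ∈ S, ¬ (i ∈ p.F ∧ i ∈ p.G) := by
  unfold IsBiflag
  rw [hE, Set.ne_univ_iff_exists_notMem]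
  refine and_congr Iff.rfl (exists_congr fun i => ?_)
  simp only [Set.mem_iUnion, Set.mem_inter_iff, not_exists]

theorem IsBiflag.le_or_le {S : Finset (Biflat M)} (h : IsBiflag M S) {p q : Biflat M}
    (hp : p ∈ S) (hq : q ∈ S) : p ≤ q ∨ q ≤ p := h.1 p hp q hq

theorem IsBiflag.subset {S T : Finset (Biflat M)} (hT : IsBiflag M T) (hE : M.E = Set.univ)
    (h : S ⊆ T) : IsBiflag M S := by
  rw [isBiflag_iff hE] at hT ⊢
  exact ⟨fun p hp q hq => hT.1 p (h hp) q (h hq), hT.2.imp fun i hi p hp => hi p (h hp)⟩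

namespace Biflat

theorem mem_union (hE : M.E = Set.univ) (p : Biflat M) (i : Fin (n + 1)) : i ∈ p.F ∨ i ∈ p.G := by
  have h : p.F ∪ p.G = M.E := p.2.union_eq
  have : i ∈ p.F ∪ p.G := by rw [h, hE]; trivial
  exact this

theorem flatF (p : Biflat M) : M.IsFlat p.F := p.2.flat_left

theorem flatG (p : Biflat M) : M✶.IsFlat p.G := p.2.flat_right

theorem nonemptyF (p : Biflat M) : p.F.Nonempty := p.2.nonempty_left

theorem nonemptyG (p : Biflat M) : p.G.Nonempty := p.2.nonempty_right

theorem not_univ (hE : M.E = Set.univ) (p : Biflat M) : ¬ (p.F = Set.univ ∧ p.G = Set.univ) := by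
  have := p.2.not_both
  rwa [hE] at this

/-- The height `rk F + null (E - G)` of a biflat. -/
def ht (p : Biflat M) : ℤ := rk M p.F + rk M✶ Set.univ - rk M✶ p.G

/-- The height of a biflat, corrected by one above the gap containing `i`. -/
def gapHt (i : Fin (n + 1)) (p : Biflat M) : ℤ := p.ht - if i ∈ p.F then 1 else 0

theorem ht_lt (hE : M.E = Set.univ) {p q : Biflat M} (h : p < q) : p.ht < q.ht := by
  obtain ⟨⟨h1, h2⟩, h3⟩ := lt_iff_le_not_ge.1 h
  have a : rk M p.F ≤ rk M q.F := rk_mono h1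
  have b : rk M✶ q.G ≤ rk M✶ p.G := rk_mono h2
  unfold ht
  by_cases hF : p.F = q.F
  · have hG : q.G ≠ p.G := fun hG => h3 ⟨hF.symm.subset, hG.symm.subset⟩
    have := rk_lt (M := M✶) hE q.flatG (h2.ssubset_of_ne hG)
    omega
  · have := rk_lt hE p.flatF (h1.ssubset_of_ne hF)
    omega

/-- Only a step from `i ∉ p.F` to `i ∈ q.F` needs care, since the correction then costs one. There
`i ∈ p.G` and `i ∉ q.G`, so the flat and the coflat both change and the height rises by at least
two. -/
theorem gapHt_lt (hE : M.E = Set.univ) {p q : Biflat M} (h : p < q) {i : Fin (n + 1)}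
    (hq : ¬ (i ∈ q.F ∧ i ∈ q.G)) : gapHt i p < gapHt i q := by
  have h0 := ht_lt hE h
  obtain ⟨h1, h2⟩ := h.le
  unfold gapHt
  by_cases hiq : i ∈ q.F
  · by_cases hip : i ∈ p.F
    · simp only [hiq, hip, if_true]; omega
    · have a := rk_lt hE p.flatF (h1.ssubset_of_ne fun h => hip (h ▸ hiq))
      have b := rk_lt (M := M✶) hE q.flatG (h2.ssubset_of_ne fun h => hq ⟨hiq, h ▸
        (p.mem_union hE i).resolve_left hip⟩)
      simp only [hiq, hip, if_true, if_false, ht]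
      omega
  · have hip : i ∉ p.F := fun h => hiq (h1 h)
    simp only [hiq, hip, if_false]
    omega

/-- With `gapHt_lt` this is why a biflag has length at most `n - 1`: the corrected heights of its
members are distinct values in an interval of that length. -/
theorem gapHt_mem (hM : IsGood M r) (p : Biflat M) {i : Fin (n + 1)}
    (hp : ¬ (i ∈ p.F ∧ i ∈ p.G)) : 1 ≤ gapHt i p ∧ gapHt i p ≤ n - 1 := by
  have h1 := hM.rk_univ
  have h2 := hM.rk_dual_univ
  have h3 := hM.rk_pos p.nonemptyF
  have h4 := hM.rk_dual_pos p.nonemptyG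
  have h5 : rk M p.F ≤ rk M Set.univ := rk_mono (Set.subset_univ _)
  have h6 : rk M✶ p.G ≤ rk M✶ Set.univ := rk_mono (Set.subset_univ _)
  unfold gapHt ht
  by_cases hi : i ∈ p.F
  · have := rk_lt (M := M✶) hM.ground p.flatG
      (Set.ssubset_univ_iff.2 fun h => hp ⟨hi, by rw [h]; trivial⟩)
    simp only [hi, if_true]; omega
  · have := rk_lt hM.ground p.flatF
      (Set.ssubset_univ_iff.2 fun h => hi (by rw [h]; trivial))
    simp only [hi, if_false]; omega

end Biflat

open Biflat

/-- Bounds on the number of members of a biflag below and above a biflat. -/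
theorem card_below_le (hM : IsGood M r) {S : Finset (Biflat M)} (hS : IsBiflag M S)
    {i : Fin (n + 1)} (hi : ∀ p ∈ S, ¬ (i ∈ p.F ∧ i ∈ p.G)) {q : Biflat M}
    (hq : ¬ (i ∈ q.F ∧ i ∈ q.G)) :
    ((S.filter (· < q)).card : ℤ) ≤ gapHt i q - 1 := by
  have h1 : (S.filter (· < q)).card ≤ (Finset.Icc 1 (gapHt i q - 1)).card := by
    refine Finset.card_le_card_of_injOn (gapHt i) (fun p hp => ?_) (fun p hp p' hp' h => ?_)
    · rw [Finset.mem_coe, Finset.mem_filter] at hp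
      have a := gapHt_mem hM p (hi p hp.1)
      have b := gapHt_lt hM.ground hp.2 hq
      rw [Finset.mem_coe, Finset.mem_Icc]; omega
    · rw [Finset.mem_coe, Finset.mem_filter] at hp hp'
      by_contra hne
      rcases hS.le_or_le hp.1 hp'.1 with h2 | h2
      · exact (gapHt_lt hM.ground (lt_of_le_of_ne h2 hne) (hi p' hp'.1)).ne h
      · exact (gapHt_lt hM.ground (lt_of_le_of_ne h2 (Ne.symm hne)) (hi p hp.1)).ne' h
  rw [Int.card_Icc] at h1
  have := gapHt_mem hM q hq
  omega

theorem card_above_le (hM : IsGood M r) {S : Finset (Biflat M)} (hS : IsBiflag M S)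
    {i : Fin (n + 1)} (hi : ∀ p ∈ S, ¬ (i ∈ p.F ∧ i ∈ p.G)) {q : Biflat M}
    (hq : ¬ (i ∈ q.F ∧ i ∈ q.G)) :
    ((S.filter (q < ·)).card : ℤ) ≤ n - 1 - gapHt i q := by
  have h1 : (S.filter (q < ·)).card ≤ (Finset.Icc (gapHt i q + 1) (n - 1)).card := by
    refine Finset.card_le_card_of_injOn (gapHt i) (fun p hp => ?_) (fun p hp p' hp' h => ?_)
    · rw [Finset.mem_coe, Finset.mem_filter] at hp
      have a := gapHt_mem hM p (hi p hp.1)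
      have b := gapHt_lt hM.ground hp.2 (hi p hp.1)
      rw [Finset.mem_coe, Finset.mem_Icc]; omega
    · rw [Finset.mem_coe, Finset.mem_filter] at hp hp'
      by_contra hne
      rcases hS.le_or_le hp.1 hp'.1 with h2 | h2
      · exact (gapHt_lt hM.ground (lt_of_le_of_ne h2 hne) (hi p' hp'.1)).ne h
      · exact (gapHt_lt hM.ground (lt_of_le_of_ne h2 (Ne.symm hne)) (hi p hp.1)).ne' h
  rw [Int.card_Icc] at h1
  have := gapHt_mem hM q hq
  omega

theorem card_eq_below_add_above {S : Finset (Biflat M)} (hS : IsBiflag M S) {q : Biflat M}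
    (hq : q ∈ S) : S.card = (S.filter (· < q)).card + 1 + (S.filter (q < ·)).card := by
  have h : S = (S.filter (· < q)) ∪ {q} ∪ (S.filter (q < ·)) := by
    ext p
    simp only [Finset.mem_union, Finset.mem_filter, Finset.mem_singleton]
    constructor
    · intro hp
      rcases eq_or_ne p q with rfl | hne
      · simp
      · rcases hS.le_or_le hp hq with h | h
        · exact Or.inl (Or.inl ⟨hp, lt_of_le_of_ne h hne⟩)
        · exact Or.inr ⟨hp, lt_of_le_of_ne h (Ne.symm hne)⟩
    · rintro ((h | rfl) | h)
      · exact h.1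
      · exact hq
      · exact h.1
  conv_lhs => rw [h]
  rw [Finset.card_union_of_disjoint, Finset.card_union_of_disjoint, Finset.card_singleton]
  · rw [Finset.disjoint_singleton_right]; simp
  · rw [Finset.disjoint_left]
    intro p hp hp'
    simp only [Finset.mem_union, Finset.mem_filter, Finset.mem_singleton] at hp hp'
    rcases hp with h | rfl
    · exact lt_asymm h.2 hp'.2
    · exact lt_irrefl _ hp'.2

/-- The upper bounds for the numbers below and above `q` add up to `n - 2`, which is exactly the
number of other members, so both are attained. -/
theorem card_below_eq (hM : IsGood M r) {S : Finset (Biflat M)} (hS : IsBiflag M S)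
    (hc : S.card = n - 1) {i : Fin (n + 1)} (hi : ∀ p ∈ S, ¬ (i ∈ p.F ∧ i ∈ p.G)) {q : Biflat M}
    (hq : q ∈ S) : ((S.filter (· < q)).card : ℤ) = gapHt i q - 1 ∧
      ((S.filter (q < ·)).card : ℤ) = n - 1 - gapHt i q := by
  have h1 := card_below_le hM hS hi (hi q hq)
  have h2 := card_above_le hM hS hi (hi q hq)
  have h3 := card_eq_below_add_above hS hq
  have h4 := hM.r_lt
  omega

end Order

/-! ### Multiplication in the conormal Chow ring -/

section Chow

variable {M : Matroid (Fin (n + 1))}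

theorem xmono_eq_zero {S : Finset (Biflat M)} (h : ¬ IsBiflag M S) : xmono M S = 0 :=
  Ideal.Quotient.eq_zero_iff_mem.2 (Ideal.mem_sup_left (Ideal.subset_span ⟨S, h, rfl⟩))

theorem xmono_insert {S : Finset (Biflat M)} {q : Biflat M} (h : q ∉ S) :
    toChow M (MvPolynomial.X q) * xmono M S = xmono M (insert q S) := by
  unfold xmono mono
  rw [Finset.prod_insert h, map_mul]

theorem sum_mul_xmono (Q : Biflat M → Prop) [DecidablePred Q]
    {S : Finset (Biflat M)} (h : ∀ q ∈ S, ¬ Q q) :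
    toChow M (∑ q : Biflat M with Q q, MvPolynomial.X q) * xmono M S
      = ∑ q ∈ {q : Biflat M | Q q ∧ IsBiflag M (insert q S)}, xmono M (insert q S) := by
  rw [map_sum, Finset.sum_mul]
  have h1 : ∀ q ∈ Finset.univ.filter Q, toChow M (MvPolynomial.X q) * xmono M S
      = if IsBiflag M (insert q S) then xmono M (insert q S) else 0 := by
    intro q hq
    rw [xmono_insert fun hqS => h q hqS (Finset.mem_filter.1 hq).2]
    split_ifs with hb
    · rfl
    · exact xmono_eq_zero hb
  rw [Finset.sum_congr rfl h1, ← Finset.sum_filter, Finset.filter_filter]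

/-- Taking `i` in the gap of `S` excludes every member of `S` from `δ_i`, so no square appears. -/
theorem delta_mul_xmono (hE : M.E = Set.univ) {S : Finset (Biflat M)} {i : Fin (n + 1)}
    (hi : ∀ p ∈ S, ¬ (i ∈ p.F ∧ i ∈ p.G)) :
    delta M * xmono M S = ∑ q : Biflat M with
      (i ∈ q.F ∧ i ∈ q.G) ∧ IsBiflag M (insert q S), xmono M (insert q S) := by
  rw [← toChow_deltaForm M hE i]
  refine (sum_mul_xmono (fun q : Biflat M => i ∈ q.F ∩ q.G) hi).trans ?_
  exact Finset.sum_congr (by ext q; simp) fun _ _ => rfl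

/-- The analogue for `γ`: `i` must avoid all proper flats of `S`. -/
theorem gamma_mul_xmono (hE : M.E = Set.univ) {S : Finset (Biflat M)} {i : Fin (n + 1)}
    (hi : ∀ p ∈ S, i ∈ p.F → p.F = Set.univ) :
    gamma M * xmono M S = ∑ q : Biflat M with
      (i ∈ q.F ∧ q.F ≠ Set.univ) ∧ IsBiflag M (insert q S), xmono M (insert q S) := by
  rw [← toChow_gammaForm M i]
  refine (sum_mul_xmono (fun q : Biflat M => i ∈ q.F ∧ q.F ≠ M.E)
    fun q hq h => h.2 ((hi q hq h.1).trans hE.symm)).trans ?_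
  exact Finset.sum_congr (by ext q; simp [hE]) fun _ _ => rfl

/-- A nonzero product has a nonzero term after each multiplication. The index `i` may be chosen
afresh at each stage from the set built so far; `Q` is an invariant which this strategy of choices
preserves, and `y` holds the factors still to come. -/
theorem exists_survivor_delta (hE : M.E = Set.univ) (Q : Finset (Biflat M) → Prop)
    (hQ : ∀ S, IsBiflag M S → Q S → ∃ i, (∀ p ∈ S, ¬ (i ∈ p.F ∧ i ∈ p.G)) ∧
      ∀ q, i ∈ q.F → i ∈ q.G → q ∉ S → IsBiflag M (insert q S) → Q (insert q S))
    (y : ChowRing M) (m : ℕ) : ∀ S, IsBiflag M S → Q S → xmono M S * delta M ^ m * y ≠ 0 →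
      ∃ S', IsBiflag M S' ∧ Q S' ∧ S'.card = S.card + m ∧ xmono M S' * y ≠ 0 := by
  induction m with
  | zero =>
    intro S hS hQS h
    exact ⟨S, hS, hQS, rfl, by simpa using h⟩
  | succ m ih =>
    intro S hS hQS h
    obtain ⟨i, hi, hstep⟩ := hQ S hS hQS
    have h1 : xmono M S * delta M ^ (m + 1) * y
        = ∑ q : Biflat M with (i ∈ q.F ∧ i ∈ q.G) ∧ IsBiflag M (insert q S),
          xmono M (insert q S) * delta M ^ m * y := by
      rw [pow_succ', ← mul_assoc, mul_comm (xmono M S), delta_mul_xmono hE hi, Finset.sum_mul,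
        Finset.sum_mul]
    rw [h1] at h
    obtain ⟨q, hq, hne⟩ := Finset.exists_ne_zero_of_sum_ne_zero h
    obtain ⟨⟨hF, hG⟩, hb⟩ := (Finset.mem_filter.1 hq).2
    have hqS : q ∉ S := fun hqS => hi q hqS ⟨hF, hG⟩
    obtain ⟨S', h2, h3, h4, h5⟩ := ih (insert q S) hb (hstep q hF hG hqS hb) hne
    exact ⟨S', h2, h3, by rw [h4, Finset.card_insert_of_notMem hqS]; omega, h5⟩

theorem exists_survivor_gamma (hE : M.E = Set.univ) (Q : Finset (Biflat M) → Prop)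
    (hQ : ∀ S, IsBiflag M S → Q S → ∃ i, (∀ p ∈ S, i ∈ p.F → p.F = Set.univ) ∧
      ∀ q, i ∈ q.F → q.F ≠ Set.univ → q ∉ S → IsBiflag M (insert q S) → Q (insert q S))
    (y : ChowRing M) (m : ℕ) : ∀ S, IsBiflag M S → Q S → xmono M S * gamma M ^ m * y ≠ 0 →
      ∃ S', IsBiflag M S' ∧ Q S' ∧ S'.card = S.card + m ∧ xmono M S' * y ≠ 0 := by
  induction m with
  | zero =>
    intro S hS hQS h
    exact ⟨S, hS, hQS, rfl, by simpa using h⟩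
  | succ m ih =>
    intro S hS hQS h
    obtain ⟨i, hi, hstep⟩ := hQ S hS hQS
    have h1 : xmono M S * gamma M ^ (m + 1) * y
        = ∑ q : Biflat M with (i ∈ q.F ∧ q.F ≠ Set.univ) ∧ IsBiflag M (insert q S),
          xmono M (insert q S) * gamma M ^ m * y := by
      rw [pow_succ', ← mul_assoc, mul_comm (xmono M S), gamma_mul_xmono hE hi, Finset.sum_mul,
        Finset.sum_mul]
    rw [h1] at h
    obtain ⟨q, hq, hne⟩ := Finset.exists_ne_zero_of_sum_ne_zero h
    obtain ⟨⟨hF, hG⟩, hb⟩ := (Finset.mem_filter.1 hq).2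
    have hqS : q ∉ S := fun hqS => hG (hi q hqS hF)
    obtain ⟨S', h2, h3, h4, h5⟩ := ih (insert q S) hb (hstep q hF hG hqS hb) hne
    exact ⟨S', h2, h3, by rw [h4, Finset.card_insert_of_notMem hqS]; omega, h5⟩

end Chow

/-! ### The conormal fan -/

section Fan

variable {M : Matroid (Fin (n + 1))}

/-- The sum of the entries of `a` over the set `X`. -/
def sumOn (a : Fin (n + 1) → ℝ) (X : Set (Fin (n + 1))) : ℝ := ∑ i, if i ∈ X then a i else 0

theorem sumOn_empty (a : Fin (n + 1) → ℝ) : sumOn a ∅ = 0 := by simp [sumOn]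

theorem sumOn_univ {a : Fin (n + 1) → ℝ} (ha : ∑ i, a i = 0) : sumOn a Set.univ = 0 := by
  simpa [sumOn] using ha

theorem sumOn_add (a b : Fin (n + 1) → ℝ) (X : Set (Fin (n + 1))) :
    sumOn (a + b) X = sumOn a X + sumOn b X := by
  simp only [sumOn, ← Finset.sum_add_distrib]
  exact Finset.sum_congr rfl fun i _ => by split_ifs <;> simp

theorem sumOn_smul (c : ℝ) (a : Fin (n + 1) → ℝ) (X : Set (Fin (n + 1))) :
    sumOn (c • a) X = c * sumOn a X := by
  simp only [sumOn, Finset.mul_sum]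
  exact Finset.sum_congr rfl fun i _ => by split_ifs <;> simp

/-- The difference of two unit vectors. -/
def unitSub (x y : Fin (n + 1)) : Fin (n + 1) → ℝ := Pi.single x 1 - Pi.single y 1

theorem sum_unitSub (x y : Fin (n + 1)) : ∑ i, unitSub x y i = 0 := by
  simp [unitSub, Finset.sum_sub_distrib]

theorem sumOn_unitSub (x y : Fin (n + 1)) (X : Set (Fin (n + 1))) :
    sumOn (unitSub x y) X = (if x ∈ X then 1 else 0) - (if y ∈ X then 1 else 0) := by
  have h : ∀ x : Fin (n + 1), sumOn (Pi.single x 1) X = if x ∈ X then 1 else 0 := by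
    intro x
    unfold sumOn
    rw [Finset.sum_eq_single x]
    · simp
    · intro b _ hb; simp [hb]
    · simp
  have h2 : unitSub x y = Pi.single x 1 + (-1 : ℝ) • Pi.single y 1 := by
    simp [unitSub, sub_eq_add_neg]
  rw [h2, sumOn_add, sumOn_smul, h, h]; ring

/-- The functions on the biflats given by linear functions on `ℝ^E/1 ⊕ ℝ^E/1`, where the
biflat `F|G` corresponds to the vector `e_F + f_G`. -/
def linForms (M : Matroid (Fin (n + 1))) : Submodule ℝ (Biflat M → ℝ) where
  carrier := {l | ∃ a b : Fin (n + 1) → ℝ, ∑ i, a i = 0 ∧ ∑ i, b i = 0 ∧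
    ∀ p, l p = sumOn a p.F + sumOn b p.G}
  zero_mem' := ⟨0, 0, by simp, by simp, fun p => by simp [sumOn]⟩
  add_mem' := by
    rintro l m ⟨a, b, ha, hb, h⟩ ⟨a', b', ha', hb', h'⟩
    refine ⟨a + a', b + b', ?_, ?_, fun p => ?_⟩
    · simp [Finset.sum_add_distrib, ha, ha']
    · simp [Finset.sum_add_distrib, hb, hb']
    · rw [Pi.add_apply, h, h', sumOn_add, sumOn_add]; ring
  smul_mem' := by
    rintro c l ⟨a, b, ha, hb, h⟩
    refine ⟨c • a, c • b, ?_, ?_, fun p => ?_⟩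
    · simp [← Finset.mul_sum, ha]
    · simp [← Finset.mul_sum, hb]
    · rw [Pi.smul_apply, h, sumOn_smul, sumOn_smul, smul_eq_mul]; ring

theorem unitSub_F_mem (x y : Fin (n + 1)) :
    (fun p : Biflat M => (if x ∈ p.F then (1 : ℝ) else 0) - if y ∈ p.F then 1 else 0) ∈
      linForms M :=
  ⟨unitSub x y, 0, sum_unitSub x y, by simp, fun p => by
    rw [sumOn_unitSub]; simp [sumOn]⟩

theorem unitSub_G_mem (x y : Fin (n + 1)) :
    (fun p : Biflat M => (if x ∈ p.G then (1 : ℝ) else 0) - if y ∈ p.G then 1 else 0) ∈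
      linForms M :=
  ⟨0, unitSub x y, by simp, sum_unitSub x y, fun p => by
    rw [sumOn_unitSub]; simp [sumOn]⟩

theorem IsBiflag.exists_maximal_lt {S : Finset (Biflat M)} (hS : IsBiflag M S)
    (Q : Biflat M → Prop) (h : ∃ q ∈ S, Q q) : ∃ m ∈ S, Q m ∧ ∀ q ∈ S, Q q → q ≤ m := by
  obtain ⟨m, hm⟩ := (S.filter Q).exists_maximal (by
    obtain ⟨q, hq⟩ := h; exact ⟨q, Finset.mem_filter.2 hq⟩)
  have hm' := Finset.mem_filter.1 hm.1
  refine ⟨m, hm'.1, hm'.2, fun q hq hQ => ?_⟩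
  rcases hS.le_or_le hq hm'.1 with h | h
  · exact h
  · exact hm.2 (Finset.mem_filter.2 ⟨hq, hQ⟩) h

theorem IsBiflag.exists_minimal_lt {S : Finset (Biflat M)} (hS : IsBiflag M S)
    (Q : Biflat M → Prop) (h : ∃ q ∈ S, Q q) : ∃ m ∈ S, Q m ∧ ∀ q ∈ S, Q q → m ≤ q := by
  obtain ⟨m, hm⟩ := (S.filter Q).exists_minimal (by
    obtain ⟨q, hq⟩ := h; exact ⟨q, Finset.mem_filter.2 hq⟩)
  have hm' := Finset.mem_filter.1 hm.1
  refine ⟨m, hm'.1, hm'.2, fun q hq hQ => ?_⟩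
  rcases hS.le_or_le hm'.1 hq with h | h
  · exact h
  · exact hm.2 (Finset.mem_filter.2 ⟨hq, hQ⟩) h

theorem exists_F_or_G_of_lt {p q : Biflat M} (h : p < q) :
    (∃ x, x ∈ q.F ∧ x ∉ p.F) ∨ ∃ y, y ∈ p.G ∧ y ∉ q.G := by
  by_contra hcon
  rw [not_or, not_exists, not_exists] at hcon
  refine (lt_iff_le_not_ge.1 h).2 ⟨fun x hx => ?_, fun y hy => ?_⟩
  · by_contra hx'; exact hcon.1 x ⟨hx, hx'⟩
  · by_contra hy'; exact hcon.2 y ⟨hy, hy'⟩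

/-- Something changes between `p` and the member just below it: an element `x` enters the flat or an
element `y` leaves the coflat. Comparing that element with the gap element `i` gives `e_x - e_i` or
`f_i - f_y`, which is one exactly from `p` up to the gap. -/
theorem exists_cut_below (hE : M.E = Set.univ) {S : Finset (Biflat M)} (hS : IsBiflag M S)
    {i : Fin (n + 1)} (hi : ∀ p ∈ S, ¬ (i ∈ p.F ∧ i ∈ p.G)) {p : Biflat M} (hp : p ∈ S)
    (hip : i ∉ p.F) :
    ∃ l ∈ linForms M, ∀ q ∈ S, l q = if p ≤ q ∧ i ∉ q.F then 1 else 0 := by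
  have key : (∃ x ∈ p.F, ∀ q ∈ S, q < p → x ∉ q.F) ∨ ∃ y, y ∉ p.G ∧ ∀ q ∈ S, q < p → y ∈ q.G := by
    by_cases h : ∃ q ∈ S, q < p
    · obtain ⟨m, _, hmp, hmax⟩ := hS.exists_maximal_lt (· < p) h
      rcases exists_F_or_G_of_lt hmp with ⟨x, hx, hx'⟩ | ⟨y, hy, hy'⟩
      · exact Or.inl ⟨x, hx, fun q hq hqp hxq => hx' ((hmax q hq hqp).1 hxq)⟩
      · exact Or.inr ⟨y, hy', fun q hq hqp => (hmax q hq hqp).2 hy⟩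
    · obtain ⟨x, hx⟩ := p.nonemptyF
      exact Or.inl ⟨x, hx, fun q hq hqp => absurd ⟨q, hq, hqp⟩ h⟩
  have hiG : ∀ q ∈ S, i ∈ q.G ↔ i ∉ q.F := fun q hq =>
    ⟨fun h h' => hi q hq ⟨h', h⟩, fun h => (q.mem_union hE i).resolve_left h⟩
  have hlt : ∀ q ∈ S, ¬ p ≤ q → q < p := fun q hq h =>
    lt_of_le_not_ge ((hS.le_or_le hp hq).resolve_left h) h
  rcases key with ⟨x, hx, hx'⟩ | ⟨y, hy, hy'⟩
  · refine ⟨_, unitSub_F_mem x i, fun q hq => ?_⟩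
    by_cases hpq : p ≤ q
    · have : x ∈ q.F := hpq.1 hx
      by_cases hiq : i ∈ q.F <;> simp [this, hpq, hiq]
    · have h1 := hlt q hq hpq
      have h2 : i ∉ q.F := fun h => hip (h1.le.1 h)
      simp [hx' q hq h1, hpq, h2]
  · refine ⟨_, unitSub_G_mem i y, fun q hq => ?_⟩
    by_cases hpq : p ≤ q
    · have : y ∉ q.G := fun h => hy (hpq.2 h)
      by_cases hiq : i ∈ q.F <;> simp [this, hpq, hiq, hiG q hq]
    · have h1 := hlt q hq hpq
      have h2 : i ∉ q.F := fun h => hip (h1.le.1 h)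
      simp [hy' q hq h1, hpq, h2, hiG q hq]

theorem exists_cut_above (hE : M.E = Set.univ) {S : Finset (Biflat M)} (hS : IsBiflag M S)
    {i : Fin (n + 1)} (hi : ∀ p ∈ S, ¬ (i ∈ p.F ∧ i ∈ p.G)) {p : Biflat M} (hp : p ∈ S)
    (hip : i ∈ p.F) :
    ∃ l ∈ linForms M, ∀ q ∈ S, l q = if q ≤ p ∧ i ∈ q.F then 1 else 0 := by
  have key : (∃ x ∈ p.G, ∀ q ∈ S, p < q → x ∉ q.G) ∨ ∃ y, y ∉ p.F ∧ ∀ q ∈ S, p < q → y ∈ q.F := by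
    by_cases h : ∃ q ∈ S, p < q
    · obtain ⟨m, _, hmp, hmin⟩ := hS.exists_minimal_lt (p < ·) h
      rcases exists_F_or_G_of_lt hmp with ⟨x, hx, hx'⟩ | ⟨y, hy, hy'⟩
      · exact Or.inr ⟨x, hx', fun q hq hqp => (hmin q hq hqp).1 hx⟩
      · exact Or.inl ⟨y, hy, fun q hq hqp hyq => hy' ((hmin q hq hqp).2 hyq)⟩
    · obtain ⟨x, hx⟩ := p.nonemptyG
      exact Or.inl ⟨x, hx, fun q hq hqp => absurd ⟨q, hq, hqp⟩ h⟩
  have hiG : ∀ q ∈ S, i ∈ q.G ↔ i ∉ q.F := fun q hq =>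
    ⟨fun h h' => hi q hq ⟨h', h⟩, fun h => (q.mem_union hE i).resolve_left h⟩
  have hlt : ∀ q ∈ S, ¬ q ≤ p → p < q := fun q hq h =>
    lt_of_le_not_ge ((hS.le_or_le hq hp).resolve_left h) h
  rcases key with ⟨x, hx, hx'⟩ | ⟨y, hy, hy'⟩
  · refine ⟨_, unitSub_G_mem x i, fun q hq => ?_⟩
    by_cases hpq : q ≤ p
    · have : x ∈ q.G := hpq.2 hx
      by_cases hiq : i ∈ q.F <;> simp [this, hpq, hiq, hiG q hq]
    · have h1 := hlt q hq hpq
      have h2 : i ∈ q.F := h1.le.1 hip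
      simp [hx' q hq h1, hpq, h2, hiG q hq]
  · refine ⟨_, unitSub_F_mem i y, fun q hq => ?_⟩
    by_cases hpq : q ≤ p
    · have : y ∉ q.F := fun h => hy (hpq.1 h)
      by_cases hiq : i ∈ q.F <;> simp [this, hpq, hiq]
    · have h1 := hlt q hq hpq
      have h2 : i ∈ q.F := h1.le.1 hip
      simp [hy' q hq h1, hpq, h2]

/-- The difference of two consecutive cuts isolates one ray. Cuts run towards the gap from below for
rays below it, and from above for rays above it; next to the gap a single cut suffices. -/
theorem exists_dual_form (hE : M.E = Set.univ) {S : Finset (Biflat M)} (hS : IsBiflag M S)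
    {p : Biflat M} (hp : p ∈ S) :
    ∃ l ∈ linForms M, l p = 1 ∧ ∀ q ∈ S, q ≠ p → l q = 0 := by
  obtain ⟨i, hi⟩ := ((isBiflag_iff hE).1 hS).2
  by_cases hip : i ∈ p.F
  · obtain ⟨l, hl, h⟩ := exists_cut_above hE hS hi hp hip
    by_cases hex : ∃ q ∈ S, q < p ∧ i ∈ q.F
    · obtain ⟨m, hm, ⟨hmp, him⟩, hmax⟩ := hS.exists_maximal_lt (fun q => q < p ∧ i ∈ q.F) hex
      obtain ⟨l', hl', h'⟩ := exists_cut_above hE hS hi hm him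
      refine ⟨l - l', Submodule.sub_mem _ hl hl', ?_, fun q hq hqp => ?_⟩
      · rw [Pi.sub_apply, h p hp, h' p hp]
        simp [hip, hmp.not_ge]
      · rw [Pi.sub_apply, h q hq, h' q hq]
        by_cases h1 : q ≤ p ∧ i ∈ q.F
        · rw [if_pos h1, if_pos ⟨hmax q hq ⟨lt_of_le_of_ne h1.1 hqp, h1.2⟩, h1.2⟩, sub_self]
        · rw [if_neg h1, if_neg fun h2 => h1 ⟨h2.1.trans hmp.le, h2.2⟩, sub_self]
    · refine ⟨l, hl, by rw [h p hp]; simp [hip], fun q hq hqp => ?_⟩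
      rw [h q hq, if_neg]
      exact fun h1 => hex ⟨q, hq, lt_of_le_of_ne h1.1 hqp, h1.2⟩
  · obtain ⟨l, hl, h⟩ := exists_cut_below hE hS hi hp hip
    by_cases hex : ∃ q ∈ S, p < q ∧ i ∉ q.F
    · obtain ⟨m, hm, ⟨hmp, him⟩, hmin⟩ := hS.exists_minimal_lt (fun q => p < q ∧ i ∉ q.F) hex
      obtain ⟨l', hl', h'⟩ := exists_cut_below hE hS hi hm him
      refine ⟨l - l', Submodule.sub_mem _ hl hl', ?_, fun q hq hqp => ?_⟩
      · rw [Pi.sub_apply, h p hp, h' p hp]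
        simp [hip, hmp.not_ge]
      · rw [Pi.sub_apply, h q hq, h' q hq]
        by_cases h1 : p ≤ q ∧ i ∉ q.F
        · rw [if_pos h1, if_pos ⟨hmin q hq ⟨lt_of_le_of_ne h1.1 (Ne.symm hqp), h1.2⟩, h1.2⟩,
            sub_self]
        · rw [if_neg h1, if_neg fun h2 => h1 ⟨hmp.le.trans h2.1, h2.2⟩, sub_self]
    · refine ⟨l, hl, by rw [h p hp]; simp [hip], fun q hq hqp => ?_⟩
      rw [h q hq, if_neg]
      exact fun h1 => hex ⟨q, hq, lt_of_le_of_ne h1.1 (Ne.symm hqp), h1.2⟩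

/-- The conormal fan of `M`. -/
def conormalFan (M : Matroid (Fin (n + 1))) (hE : M.E = Set.univ) : FanData (Biflat M) where
  face := IsBiflag M
  face_mono h hT := hT.subset hE h
  lin := linForms M
  indep _ hS _ hp := exists_dual_form hE hS hp

theorem sum_smul_eq_zero {A : Type*} [AddCommGroup A] [Module ℝ A]
    (X : Biflat M → A) (K : Biflat M → Set (Fin (n + 1))) (c : A)
    (hc : ∀ i, ∑ p : Biflat M, (if i ∈ K p then X p else 0) = c)
    {a : Fin (n + 1) → ℝ} (ha : ∑ i, a i = 0) : ∑ p, sumOn a (K p) • X p = 0 := by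
  have h : ∀ p, sumOn a (K p) • X p = ∑ i, a i • if i ∈ K p then X p else 0 := by
    intro p
    rw [sumOn, Finset.sum_smul]
    exact Finset.sum_congr rfl fun i _ => by split_ifs <;> simp
  rw [Finset.sum_congr rfl fun p _ => h p, Finset.sum_comm]
  simp only [← Finset.smul_sum, hc, ← Finset.sum_smul, ha, zero_smul]

/-- The forms `γ_i` omit the biflats with `F = E`, while a linear function sees them. Their
contribution is the same for all `i` and disappears against a vector with entries summing to zero.
-/
theorem sum_ite_mem_eq (hE : M.E = Set.univ) (K : Biflat M → Set (Fin (n + 1)))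
    (i : Fin (n + 1)) : ∑ p : Biflat M, (if i ∈ K p then toChow M (MvPolynomial.X p) else 0)
      = toChow M (∑ p : Biflat M with i ∈ K p ∧ K p ≠ M.E, MvPolynomial.X p)
        + toChow M (∑ p : Biflat M with K p = M.E, MvPolynomial.X p) := by
  rw [map_sum, map_sum, Finset.sum_filter, Finset.sum_filter, ← Finset.sum_add_distrib]
  refine Finset.sum_congr rfl fun p _ => ?_
  by_cases h : K p = M.E
  · have : i ∈ K p := by rw [h, hE]; trivial
    simp [h, hE]
  · simp [h]

theorem toChow_linForm (hE : M.E = Set.univ) {l : Biflat M → ℝ} (hl : l ∈ linForms M) :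
    toChow M (∑ p, l p • MvPolynomial.X p) = 0 := by
  obtain ⟨a, b, ha, hb, h⟩ := hl
  have h1 := sum_smul_eq_zero (fun p : Biflat M => toChow M (MvPolynomial.X p)) Biflat.F _
    (fun i => (sum_ite_mem_eq hE Biflat.F i).trans
      (congrArg (· + _) (toChow_gammaForm M i))) ha
  have h2 := sum_smul_eq_zero (fun p : Biflat M => toChow M (MvPolynomial.X p)) Biflat.G _
    (fun i => (sum_ite_mem_eq hE Biflat.G i).trans
      (congrArg (· + _) (toChow_gammaBarForm M i 0))) hb
  rw [map_sum, ← add_zero (0 : ChowRing M)]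
  nth_rewrite 1 [← h1]
  rw [← h2, ← Finset.sum_add_distrib]
  refine Finset.sum_congr rfl fun p _ => ?_
  rw [map_smul, h, add_smul]

theorem chowPiece_le_span (hE : M.E = Set.univ) (d : ℕ) : chowPiece M d ≤
    Submodule.span ℝ {x | ∃ S : Finset (Biflat M), S.card = d ∧ x = xmono M S} :=
  FanData.map_homogeneous_le_span (Φ := conormalFan M hE) (toChow M)
    (fun _ hS => xmono_eq_zero hS) (fun _ hl => toChow_linForm hE hl) d

theorem degreeMap_unique (hE : M.E = Set.univ) {deg deg' : chowPiece M (n - 1) →ₗ[ℝ] ℝ}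
    (h : IsDegreeMap M deg) (h' : IsDegreeMap M deg') : deg = deg' := by
  have key : ∀ x (hx : x ∈ Submodule.span ℝ {x | ∃ S : Finset (Biflat M), S.card = n - 1 ∧
      x = xmono M S}), ∃ hx' : x ∈ chowPiece M (n - 1), deg ⟨x, hx'⟩ = deg' ⟨x, hx'⟩ := by
    intro x hx
    induction hx using Submodule.span_induction with
    | mem x hx =>
      obtain ⟨S, hS, rfl⟩ := hx
      exact ⟨xmono_mem_chowPiece M S hS, by rw [h S hS, h' S hS]⟩
    | zero =>
      refine ⟨Submodule.zero_mem _, ?_⟩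
      have : (⟨0, Submodule.zero_mem _⟩ : chowPiece M (n - 1)) = 0 := rfl
      rw [this, map_zero, map_zero]
    | add x y _ _ hx hy =>
      obtain ⟨hx, hx'⟩ := hx
      obtain ⟨hy, hy'⟩ := hy
      refine ⟨Submodule.add_mem _ hx hy, ?_⟩
      have : (⟨x + y, Submodule.add_mem _ hx hy⟩ : chowPiece M (n - 1)) = ⟨x, hx⟩ + ⟨y, hy⟩ := rfl
      rw [this, map_add, map_add, hx', hy']
    | smul c x _ hx =>
      obtain ⟨hx, hx'⟩ := hx
      refine ⟨Submodule.smul_mem _ c hx, ?_⟩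
      have : (⟨c • x, Submodule.smul_mem _ c hx⟩ : chowPiece M (n - 1)) = c • ⟨x, hx⟩ := rfl
      rw [this, map_smul, map_smul, hx']
  ext ⟨x, hx⟩
  exact (key x (chowPiece_le_span hE _ hx)).2

/-- The weight which is one on the biflags of length `n - 1`. -/
def topWeight (M : Matroid (Fin (n + 1))) (S : Finset (Biflat M)) : ℝ :=
  if IsBiflag M S ∧ S.card = n - 1 then 1 else 0

/-- The functional of the top weight annihilates both generating ideals, so it descends to the whole
ring and is restricted to degree `n - 1`. -/
theorem exists_degreeMap (hE : M.E = Set.univ)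
    (hw : (conormalFan M hE).IsWeight (topWeight M)) :
    ∃ deg : chowPiece M (n - 1) →ₗ[ℝ] ℝ, IsDegreeMap M deg := by
  let Φ := conormalFan M hE
  let w : Φ.weights := ⟨topWeight M, hw⟩
  have hker : ∀ f ∈ idealI M ⊔ idealJ M, Φ.functional w f = 0 := by
    -- The functional is only `ℝ`-linear. Carrying an arbitrary multiplier `c` through the induction
    -- absorbs multiplication by ring elements.
    have hI : ∀ f ∈ idealI M, ∀ c, Φ.functional w (c * f) = 0 := by
      intro f hf
      induction hf using Submodule.span_induction with
      | mem x hx =>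
        obtain ⟨S, hS, rfl⟩ := hx
        exact fun c => FanData.functional_mul_prod_eq_zero (Φ := Φ) w c hS
      | zero => intro c; rw [mul_zero, map_zero]
      | add x y _ _ hx hy => intro c; rw [mul_add, map_add, hx, hy, add_zero]
      | smul d x _ hx => intro c; rw [smul_eq_mul, ← mul_assoc]; exact hx _
    have hJ : ∀ f ∈ idealJ M, ∀ c, Φ.functional w (c * f) = 0 := by
      intro f hf
      induction hf using Submodule.span_induction with
      | mem x hx =>
        intro c
        obtain ⟨i, j, hx⟩ := hx
        have hdiff : ∀ K : Biflat M → Set (Fin (n + 1)),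
            (∑ p : Biflat M with i ∈ K p ∧ K p ≠ M.E, (MvPolynomial.X p : PolyRing M))
              - ∑ p : Biflat M with j ∈ K p ∧ K p ≠ M.E, MvPolynomial.X p
              = ∑ p, ((if i ∈ K p then (1 : ℝ) else 0) - if j ∈ K p then 1 else 0) •
                MvPolynomial.X p := by
          intro K
          rw [Finset.sum_filter, Finset.sum_filter, ← Finset.sum_sub_distrib]
          refine Finset.sum_congr rfl fun p _ => ?_
          by_cases hK : K p = M.E
          · simp [hK, hE]
          · by_cases h1 : i ∈ K p <;> by_cases h2 : j ∈ K p <;> simp [h1, h2, hK]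
        rcases hx with rfl | rfl
        · have := FanData.functional_mul_lin_eq_zero (Φ := Φ) w c (unitSub_F_mem i j)
          rw [← hdiff Biflat.F] at this
          exact this
        · have := FanData.functional_mul_lin_eq_zero (Φ := Φ) w c (unitSub_G_mem i j)
          rw [← hdiff Biflat.G] at this
          exact this
      | zero => intro c; rw [mul_zero, map_zero]
      | add x y _ _ hx hy => intro c; rw [mul_add, map_add, hx, hy, add_zero]
      | smul d x _ hx => intro c; rw [smul_eq_mul, ← mul_assoc]; exact hx _
    intro f hf
    obtain ⟨g, hg, h, hh, rfl⟩ := Submodule.mem_sup.1 hf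
    have h1 := hI g hg 1
    have h2 := hJ h hh 1
    rw [one_mul] at h1 h2
    rw [map_add, h1, h2, add_zero]
  let D : ChowRing M →ₗ[ℝ] ℝ :=
    Submodule.liftQ ((idealI M ⊔ idealJ M).restrictScalars ℝ) (Φ.functional w)
      fun f hf => LinearMap.mem_ker.2 (hker f hf)
  refine ⟨D.comp (chowPiece M (n - 1)).subtype, fun S hS => ?_⟩
  have h1 : D (xmono M S) = Φ.functional w (mono M S) := rfl
  change D (xmono M S) = _
  rw [h1]
  have h2 := FanData.functional_prod (Φ := Φ) w S
  change Φ.functional w (mono M S) = topWeight M S at h2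
  rw [h2, topWeight]
  simp [hS]

end Fan

/-! ### The conormal fan is balanced -/

section Balance

variable {M : Matroid (Fin (n + 1))}

theorem flat_eq_or_eq (hE : M.E = Set.univ) {F K F' : Set (Fin (n + 1))} (hF : M.IsFlat F)
    (hK : M.IsFlat K) (h1 : F ⊆ K) (h2 : K ⊆ F') (hr : rk M F' ≤ rk M F + 1) :
    K = F ∨ K = F' := by
  by_contra hcon
  rw [not_or] at hcon
  have a := rk_lt hE hF (h1.ssubset_of_ne (Ne.symm hcon.1))
  have b := rk_lt hE hK (h2.ssubset_of_ne hcon.2)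
  omega

theorem eq_of_rk_le (hE : M.E = Set.univ) {F F' : Set (Fin (n + 1))} (hF : M.IsFlat F)
    (h1 : F ⊆ F') (hr : rk M F' ≤ rk M F) : F = F' := by
  by_contra hcon
  have a := rk_lt hE hF (h1.ssubset_of_ne hcon)
  omega

/-- The flats strictly between two flats. -/
def flatsBetween (M : Matroid (Fin (n + 1))) (F F' : Set (Fin (n + 1))) :
    Finset (Set (Fin (n + 1))) := {K | M.IsFlat K ∧ F ⊂ K ∧ K ⊂ F'}

theorem mem_flatsBetween {F F' K : Set (Fin (n + 1))} :
    K ∈ flatsBetween M F F' ↔ M.IsFlat K ∧ F ⊂ K ∧ K ⊂ F' := by simp [flatsBetween]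

/-- The flats between two flats of rank difference two partition `F' \ F`: an element `i` there lies
only in the closure of `F ∪ i`. Elements of `F` are counted once for each intermediate flat. -/
theorem sum_flatsBetween (hE : M.E = Set.univ) {F F' : Set (Fin (n + 1))} (hF : M.IsFlat F)
    (hF' : M.IsFlat F') (hle : F ⊆ F') (hr : rk M F' = rk M F + 2) (a : Fin (n + 1) → ℝ) :
    ∑ K ∈ flatsBetween M F F', sumOn a K
      = sumOn a F' + ((flatsBetween M F F').card - 1) * sumOn a F := by
  unfold sumOn
  rw [Finset.sum_comm, Finset.mul_sum, ← Finset.sum_add_distrib]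
  refine Finset.sum_congr rfl fun i _ => ?_
  by_cases hiF : i ∈ F
  · have h1 : ∀ K ∈ flatsBetween M F F', (if i ∈ K then a i else 0) = a i := fun K hK =>
      if_pos ((mem_flatsBetween.1 hK).2.1.subset hiF)
    rw [Finset.sum_congr rfl h1, if_pos hiF, if_pos (hle hiF), Finset.sum_const, nsmul_eq_mul]
    ring
  · rw [if_neg hiF, mul_zero, add_zero]
    by_cases hiF' : i ∈ F'
    · have hcl : rk M (M.closure (insert i F)) = rk M F + 1 := by
        rw [rk_closure, rk_insert hE (by rwa [hF.closure])]
      have hsub : insert i F ⊆ M.closure (insert i F) :=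
        M.subset_closure _ (by rw [hE]; exact Set.subset_univ _)
      have hi : i ∈ M.closure (insert i F) := hsub (Set.mem_insert _ _)
      rw [if_pos hiF', Finset.sum_eq_single (M.closure (insert i F)), if_pos hi]
      · intro K hK hne
        rw [if_neg]
        intro hiK
        obtain ⟨hK1, hK2, hK3⟩ := mem_flatsBetween.1 hK
        have := rk_lt hE hK1 hK3
        exact hne (flat_eq_closure_insert hE hF hK1 hK2.subset (by omega) hiK hiF)
      · intro hcon
        refine absurd (mem_flatsBetween.2 ⟨M.isFlat_closure _, ?_, ?_⟩) hcon
        · exact ((Set.subset_insert _ _).trans hsub).ssubset_of_ne fun h => hiF (h ▸ hi)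
        · refine LE.le.ssubset_of_ne ?_ fun h => ?_
          · rw [← hF'.closure]
            exact M.closure_subset_closure (Set.insert_subset hiF' hle)
          · rw [h] at hcl; omega
    · rw [if_neg hiF']
      exact Finset.sum_eq_zero fun K hK =>
        if_neg fun hiK => hiF' ((mem_flatsBetween.1 hK).2.2.subset hiK)

/-- Pairs of a flat and a coflat with union `E`: the biflats and three degenerate pairs. -/
@[ext] structure FlatPair (M : Matroid (Fin (n + 1))) where
  F : Set (Fin (n + 1))
  G : Set (Fin (n + 1))
  flatF : M.IsFlat F
  flatG : M✶.IsFlat G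
  mem_or : ∀ i, i ∈ F ∨ i ∈ G

namespace FlatPair

instance : PartialOrder (FlatPair M) where
  le p q := p.F ⊆ q.F ∧ q.G ⊆ p.G
  le_refl p := ⟨subset_rfl, subset_rfl⟩
  le_trans p q s h1 h2 := ⟨h1.1.trans h2.1, h2.2.trans h1.2⟩
  le_antisymm p q h1 h2 := FlatPair.ext (h1.1.antisymm h2.1) (h2.2.antisymm h1.2)

/-- A biflat as a pair. -/
def ofBiflat (hE : M.E = Set.univ) (p : Biflat M) : FlatPair M :=
  ⟨p.F, p.G, p.flatF, p.flatG, p.mem_union hE⟩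

theorem ofBiflat_le {hE : M.E = Set.univ} {p q : Biflat M} :
    ofBiflat hE p ≤ ofBiflat hE q ↔ p ≤ q := Iff.rfl

theorem ofBiflat_injective (hE : M.E = Set.univ) : Function.Injective (ofBiflat (M := M) hE) :=
  fun _ _ h => biflat_ext (congrArg FlatPair.F h) (congrArg FlatPair.G h)

/-- The height of a pair. -/
def ht (p : FlatPair M) : ℤ := rk M p.F + rk M✶ Set.univ - rk M✶ p.G

theorem ht_lt (hE : M.E = Set.univ) {p q : FlatPair M} (h : p < q) : p.ht < q.ht := by
  obtain ⟨⟨h1, h2⟩, h3⟩ := lt_iff_le_not_ge.1 h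
  have a : rk M p.F ≤ rk M q.F := rk_mono h1
  have b : rk M✶ q.G ≤ rk M✶ p.G := rk_mono h2
  unfold ht
  by_cases hF : p.F = q.F
  · have hG : q.G ≠ p.G := fun hG => h3 ⟨hF.symm.subset, hG.symm.subset⟩
    have := rk_lt (M := M✶) hE q.flatG (h2.ssubset_of_ne hG)
    omega
  · have := rk_lt hE p.flatF (h1.ssubset_of_ne hF)
    omega

/-- The linear function given by `a` and `b`. -/
def val (a b : Fin (n + 1) → ℝ) (p : FlatPair M) : ℝ := sumOn a p.F + sumOn b p.G

/-- There is a gap between two pairs. -/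
def Gap (x y : FlatPair M) : Prop := ∃ i, i ∉ x.F ∧ i ∉ y.G

/-- The biflats strictly between two pairs. -/
def between (hE : M.E = Set.univ) (x y : FlatPair M) : Finset (Biflat M) :=
  {q | x < ofBiflat hE q ∧ ofBiflat hE q < y}

theorem mem_between {hE : M.E = Set.univ} {x y : FlatPair M} {q : Biflat M} :
    q ∈ between hE x y ↔ x < ofBiflat hE q ∧ ofBiflat hE q < y := by simp [between]

theorem mem_between' {hE : M.E = Set.univ} {x y : FlatPair M} {q : Biflat M} :
    q ∈ between hE x y ↔ ((x.F ⊆ q.F ∧ q.G ⊆ x.G) ∧ (q.F ⊆ y.F ∧ y.G ⊆ q.G)) ∧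
      ¬ (q.F = x.F ∧ q.G = x.G) ∧ ¬ (q.F = y.F ∧ q.G = y.G) := by
  rw [mem_between, lt_iff_le_and_ne, lt_iff_le_and_ne]
  have h1 : x ≠ ofBiflat hE q ↔ ¬ (q.F = x.F ∧ q.G = x.G) := by
    rw [Ne, FlatPair.ext_iff]; simp only [ofBiflat]; tauto
  have h2 : ofBiflat hE q ≠ y ↔ ¬ (q.F = y.F ∧ q.G = y.G) := by
    rw [Ne, FlatPair.ext_iff]; simp only [ofBiflat]
  have h3 : x ≤ ofBiflat hE q ↔ x.F ⊆ q.F ∧ q.G ⊆ x.G := Iff.rfl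
  have h4 : ofBiflat hE q ≤ y ↔ q.F ⊆ y.F ∧ y.G ⊆ q.G := Iff.rfl
  rw [h1, h2, h3, h4]
  tauto

variable (hM : IsGood M r)
include hM

/-- Constructor for biflats in terms of a matroid without loops and coloops. -/
def mkBiflat {F G : Set (Fin (n + 1))} (hF : M.IsFlat F) (hG : M✶.IsFlat G)
    (hu : ∀ i, i ∈ F ∨ i ∈ G) (h1 : F.Nonempty) (h2 : G.Nonempty)
    (h3 : F ≠ Set.univ ∨ G ≠ Set.univ) : Biflat M :=
  ⟨(F, G), ⟨hF, hG, h1, h2, by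
    rw [hM.ground, not_and_or]; exact h3, by
    rw [hM.ground]; exact Set.eq_univ_of_forall hu⟩⟩

variable {a b : Fin (n + 1) → ℝ} (ha : ∑ i, a i = 0) (hb : ∑ i, b i = 0)

theorem sum_between_F (x y : FlatPair M) (hle : x ≤ y) (hG : x.G = y.G)
    (hF : rk M y.F = rk M x.F + 2) (hx : x.val a b = 0) (hy : y.val a b = 0) :
    ∑ q ∈ between hM.ground x y, (sumOn a q.F + sumOn b q.G) = 0 := by
  have h := sum_flatsBetween hM.ground x.flatF y.flatF hle.1 hF a
  have h1 : ∑ q ∈ between hM.ground x y, (sumOn a q.F + sumOn b q.G)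
      = ∑ K ∈ flatsBetween M x.F y.F, (sumOn a K + sumOn b x.G) := by
    refine Finset.sum_nbij Biflat.F (fun q hq => ?_) (fun q hq q' hq' hqq => ?_)
      (fun K hK => ?_) (fun q hq => ?_)
    · rw [mem_between'] at hq
      have hqG : q.G = x.G := hq.1.1.2.antisymm (hG.subset.trans hq.1.2.2)
      refine mem_flatsBetween.2 ⟨q.flatF, hq.1.1.1.ssubset_of_ne fun h => hq.2.1 ⟨h.symm, hqG⟩,
        hq.1.2.1.ssubset_of_ne fun h => hq.2.2 ⟨h, hqG.trans hG⟩⟩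
    · rw [Finset.mem_coe, mem_between'] at hq hq'
      have hqG : q.G = x.G := hq.1.1.2.antisymm (hG.subset.trans hq.1.2.2)
      have hqG' : q'.G = x.G := hq'.1.1.2.antisymm (hG.subset.trans hq'.1.2.2)
      exact biflat_ext hqq (hqG.trans hqG'.symm)
    · obtain ⟨hK1, hK2, hK3⟩ := mem_flatsBetween.1 hK
      refine ⟨mkBiflat hM hK1 x.flatG (fun i => (x.mem_or i).imp_left fun h => hK2.subset h)
        (Set.nonempty_of_ssubset' hK2) ?_ (Or.inl ?_), ?_, rfl⟩
      · obtain ⟨i, hi, hi'⟩ := Set.exists_of_ssubset hK2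
        exact ⟨i, (x.mem_or i).resolve_left hi'⟩
      · exact fun h => hK3.not_subset (h ▸ Set.subset_univ _)
      · rw [Finset.mem_coe, mem_between']
        exact ⟨⟨⟨hK2.subset, subset_rfl⟩, hK3.subset, hG.symm.subset⟩,
          fun h => hK2.ne h.1.symm, fun h => hK3.ne h.1⟩
    · rw [mem_between'] at hq
      have hqG : q.G = x.G := hq.1.1.2.antisymm (hG.subset.trans hq.1.2.2)
      rw [hqG]
  rw [h1, Finset.sum_add_distrib, h, Finset.sum_const, nsmul_eq_mul]
  unfold val at hx hy
  rw [← hG] at hy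
  linear_combination hy + ((flatsBetween M x.F y.F).card - 1 : ℝ) * hx

theorem sum_between_G (x y : FlatPair M) (hle : x ≤ y) (hF : x.F = y.F)
    (hG : rk M✶ x.G = rk M✶ y.G + 2) (hx : x.val a b = 0) (hy : y.val a b = 0) :
    ∑ q ∈ between hM.ground x y, (sumOn a q.F + sumOn b q.G) = 0 := by
  have h := sum_flatsBetween (M := M✶) hM.ground y.flatG x.flatG hle.2 hG b
  have h1 : ∑ q ∈ between hM.ground x y, (sumOn a q.F + sumOn b q.G)
      = ∑ K ∈ flatsBetween M✶ y.G x.G, (sumOn a x.F + sumOn b K) := by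
    refine Finset.sum_nbij Biflat.G (fun q hq => ?_) (fun q hq q' hq' hqq => ?_)
      (fun K hK => ?_) (fun q hq => ?_)
    · rw [mem_between'] at hq
      have hqF : q.F = x.F := (hq.1.2.1.trans hF.symm.subset).antisymm hq.1.1.1
      refine mem_flatsBetween.2 ⟨q.flatG, hq.1.2.2.ssubset_of_ne fun h => hq.2.2 ⟨hqF.trans hF,
        h.symm⟩, hq.1.1.2.ssubset_of_ne fun h => hq.2.1 ⟨hqF, h⟩⟩
    · rw [Finset.mem_coe, mem_between'] at hq hq'
      have hqF : q.F = x.F := (hq.1.2.1.trans hF.symm.subset).antisymm hq.1.1.1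
      have hqF' : q'.F = x.F := (hq'.1.2.1.trans hF.symm.subset).antisymm hq'.1.1.1
      exact biflat_ext (hqF.trans hqF'.symm) hqq
    · obtain ⟨hK1, hK2, hK3⟩ := mem_flatsBetween.1 hK
      refine ⟨mkBiflat hM x.flatF hK1 (fun i => ?_) ?_ (Set.nonempty_of_ssubset' hK2)
        (Or.inr ?_), ?_, rfl⟩
      · rw [hF]; exact (y.mem_or i).imp_right fun h => hK2.subset h
      · obtain ⟨i, hi, hi'⟩ := Set.exists_of_ssubset hK2
        rw [hF]; exact ⟨i, (y.mem_or i).resolve_right hi'⟩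
      · exact fun h => hK3.not_subset (h ▸ Set.subset_univ _)
      · rw [Finset.mem_coe, mem_between']
        exact ⟨⟨⟨subset_rfl, hK3.subset⟩, hF.subset, hK2.subset⟩,
          fun h => hK3.ne h.2, fun h => hK2.ne h.2.symm⟩
    · rw [mem_between'] at hq
      have hqF : q.F = x.F := (hq.1.2.1.trans hF.symm.subset).antisymm hq.1.1.1
      rw [hqF]
  rw [h1, Finset.sum_add_distrib, h, Finset.sum_const, nsmul_eq_mul]
  unfold val at hx hy
  rw [← hF] at hy
  linear_combination hx + ((flatsBetween M✶ y.G x.G).card - 1 : ℝ) * hy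

include ha hb

/-- Only two corners are possible. The pair `x.F|y.G` covers `E` exactly when there is no gap; the
pair `y.F|x.G` always covers `E`. -/
theorem sum_between_FG (x y : FlatPair M) (hle : x ≤ y) (hF : rk M y.F = rk M x.F + 1)
    (hG : rk M✶ x.G = rk M✶ y.G + 1) :
    ∑ q ∈ between hM.ground x y, (sumOn a q.F + sumOn b q.G)
      = (if Gap x y then 0 else sumOn a x.F + sumOn b y.G) + (sumOn a y.F + sumOn b x.G) := by
  have hF' : x.F ⊂ y.F := hle.1.ssubset_of_ne fun h => by rw [h] at hF; omega
  have hG' : y.G ⊂ x.G := hle.2.ssubset_of_ne fun h => by rw [h] at hG; omega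
  have hcase : ∀ q ∈ between hM.ground x y, (q.F = x.F ∧ q.G = y.G) ∨ (q.F = y.F ∧ q.G = x.G) := by
    intro q hq
    rw [mem_between'] at hq
    have h1 := flat_eq_or_eq hM.ground x.flatF q.flatF hq.1.1.1 hq.1.2.1 hF.le
    have h2 := flat_eq_or_eq (M := M✶) hM.ground y.flatG q.flatG hq.1.2.2 hq.1.1.2 hG.le
    tauto
  have hsplit : ∑ q ∈ between hM.ground x y, (sumOn a q.F + sumOn b q.G)
      = ∑ q ∈ between hM.ground x y with q.F = x.F, (sumOn a q.F + sumOn b q.G)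
        + ∑ q ∈ between hM.ground x y with ¬ q.F = x.F, (sumOn a q.F + sumOn b q.G) :=
    (Finset.sum_filter_add_sum_filter_not _ _ _).symm
  rw [hsplit]
  congr 1
  · split_ifs with hgap
    · refine Finset.sum_eq_zero fun q hq => ?_
      exfalso
      obtain ⟨hq, hqF⟩ := Finset.mem_filter.1 hq
      obtain ⟨i, hi, hi'⟩ := hgap
      rcases hcase q hq with h | h
      · rcases q.mem_union hM.ground i with h1 | h1
        · exact hi (h.1 ▸ h1)
        · exact hi' (h.2 ▸ h1)
      · exact hF'.ne (hqF.symm.trans h.1)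
    · have hu : ∀ i, i ∈ x.F ∨ i ∈ y.G := fun i => by
        by_contra h; rw [not_or] at h; exact hgap ⟨i, h⟩
      have hne : x.F ≠ Set.univ := fun h => hF'.not_subset (h ▸ Set.subset_univ _)
      let q0 : Biflat M := mkBiflat hM x.flatF y.flatG hu (by
        rw [Set.nonempty_iff_ne_empty]
        intro h
        refine hG'.not_subset fun i _ => (hu i).resolve_left (h ▸ Set.notMem_empty i)) (by
        rw [Set.nonempty_iff_ne_empty]
        intro h
        refine hF'.not_subset fun i _ => (hu i).resolve_right (h ▸ Set.notMem_empty i))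
        (Or.inl hne)
      rw [Finset.sum_eq_single q0]
      · rfl
      · intro q hq hne
        obtain ⟨hq, hqF⟩ := Finset.mem_filter.1 hq
        rcases hcase q hq with h | h
        · exact absurd (biflat_ext h.1 h.2) hne
        · exact absurd (hqF.symm.trans h.1) hF'.ne
      · intro h
        exact (h (Finset.mem_filter.2 ⟨(mem_between' (q := q0)).2 ⟨⟨⟨subset_rfl, hG'.subset⟩,
          hF'.subset, subset_rfl⟩, fun h => hG'.ne h.2, fun h => hF'.ne h.1⟩, rfl⟩)).elim
  -- The corner `E|E` is not a biflat, but its vector is zero modulo the all-one vectors, so leaving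
  -- it out does not change the sum.
  · by_cases huniv : y.F = Set.univ ∧ x.G = Set.univ
    · rw [huniv.1, huniv.2, sumOn_univ ha, sumOn_univ hb, add_zero]
      refine Finset.sum_eq_zero fun q hq => ?_
      obtain ⟨hq, hqF⟩ := Finset.mem_filter.1 hq
      rcases hcase q hq with h | h
      · exact absurd h.1 hqF
      · exact absurd ⟨h.1.trans huniv.1, h.2.trans huniv.2⟩ (q.not_univ hM.ground)
    · let q0 : Biflat M := mkBiflat hM y.flatF x.flatG
        (fun i => (x.mem_or i).imp_left fun h => hF'.subset h) (Set.nonempty_of_ssubset' hF')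
        (Set.nonempty_of_ssubset' hG') (not_and_or.1 huniv)
      rw [Finset.sum_eq_single q0]
      · rfl
      · intro q hq hne
        obtain ⟨hq, hqF⟩ := Finset.mem_filter.1 hq
        rcases hcase q hq with h | h
        · exact absurd h.1 hqF
        · exact absurd (biflat_ext h.1 h.2) hne
      · intro h
        exact (h (Finset.mem_filter.2 ⟨(mem_between' (q := q0)).2 ⟨⟨⟨hF'.subset, subset_rfl⟩,
          subset_rfl, hG'.subset⟩, fun h => hF'.ne h.1.symm, fun h => hG'.ne h.2.symm⟩,
          fun h => hF'.ne h.symm⟩)).elim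

/-- The sum over a step of height two. -/
theorem sum_between_of_ht (x y : FlatPair M) (hle : x ≤ y) (hht : y.ht = x.ht + 2)
    (hx : x.val a b = 0) (hy : y.val a b = 0) :
    ∑ q ∈ between hM.ground x y, (sumOn a q.F + sumOn b q.G)
      = if Gap x y then sumOn a y.F - sumOn a x.F else 0 := by
  have h1 : rk M x.F ≤ rk M y.F := rk_mono hle.1
  have h2 : rk M✶ y.G ≤ rk M✶ x.G := rk_mono hle.2
  have hgap : Gap x y → rk M x.F < rk M y.F ∧ rk M✶ y.G < rk M✶ x.G := by
    rintro ⟨i, hi, hi'⟩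
    exact ⟨rk_lt hM.ground x.flatF (hle.1.ssubset_of_ne fun h => hi (h ▸
      (y.mem_or i).resolve_right hi')), rk_lt (M := M✶) hM.ground y.flatG
      (hle.2.ssubset_of_ne fun h => hi' (h ▸ (x.mem_or i).resolve_left hi))⟩
  unfold ht at hht
  by_cases hF : rk M y.F = rk M x.F + 1
  · rw [sum_between_FG hM ha hb x y hle hF (by omega)]
    unfold val at hx hy
    split_ifs <;> linarith
  · have hg : ¬ Gap x y := fun h => by have := hgap h; omega
    rw [if_neg hg]
    by_cases hF0 : rk M y.F = rk M x.F
    · exact sum_between_G hM x y hle (eq_of_rk_le hM.ground x.flatF hle.1 hF0.le) (by omega) hx hy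
    · exact sum_between_F hM x y hle (eq_of_rk_le (M := M✶) hM.ground y.flatG hle.2
        (by omega)).symm (by omega) hx hy

end FlatPair

end Balance

/-! ### Balancing across a gap of height three -/

section Balance

variable {M : Matroid (Fin (n + 1))}

namespace FlatPair

/-- The biflats strictly between two pairs which do not close the gap. -/
def gapBetween (hE : M.E = Set.univ) (x y : FlatPair M) : Finset (Biflat M) :=
  {q ∈ between hE x y | ∃ i, (i ∉ x.F ∧ i ∉ y.G) ∧ ¬ (i ∈ q.F ∧ i ∈ q.G)}

theorem mem_gapBetween {hE : M.E = Set.univ} {x y : FlatPair M} {q : Biflat M} :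
    q ∈ gapBetween hE x y ↔ q ∈ between hE x y ∧
      ∃ i, (i ∉ x.F ∧ i ∉ y.G) ∧ ¬ (i ∈ q.F ∧ i ∈ q.G) := by simp [gapBetween]

/-- None of the four corners is allowed: two are the ends themselves, `x.F|y.G` misses the gap, and
`y.F|x.G` closes it completely. -/
theorem gapBetween_ssubset {hE : M.E = Set.univ} {x y : FlatPair M} {q : Biflat M}
    (hq : q ∈ gapBetween hE x y) (h : (q.F = x.F ∨ q.F = y.F) ∧ (q.G = x.G ∨ q.G = y.G)) :
    False := by
  obtain ⟨hq, i, ⟨hi1, hi2⟩, hi⟩ := mem_gapBetween.1 hq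
  rw [mem_between'] at hq
  rcases h with ⟨h1 | h1, h2 | h2⟩
  · exact hq.2.1 ⟨h1, h2⟩
  · rcases q.mem_union hE i with h | h
    · exact hi1 (h1 ▸ h)
    · exact hi2 (h2 ▸ h)
  · exact hi ⟨h1 ▸ (y.mem_or i).resolve_right hi2, h2 ▸ (x.mem_or i).resolve_left hi1⟩
  · exact hq.2.2 ⟨h1, h2⟩

variable (hM : IsGood M r) {a b : Fin (n + 1) → ℝ}
include hM

/-- Each intermediate flat `K` occurs with exactly one coflat: with `y.G` if `K ∪ y.G = E`, and
otherwise with `x.G`, where an element outside `K ∪ y.G` keeps the gap open. The sum therefore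
reduces to the sum over the intermediate flats. -/
theorem sum_gapBetween_F (x y : FlatPair M) (hle : x ≤ y) (hgap : Gap x y)
    (hF : rk M y.F = rk M x.F + 2) (hG : rk M✶ x.G = rk M✶ y.G + 1)
    (hxF : sumOn a x.F = 0) (hyF : sumOn a y.F = 0) (hxG : sumOn b x.G = 0)
    (hyG : sumOn b y.G = 0) :
    ∑ q ∈ gapBetween hM.ground x y, (sumOn a q.F + sumOn b q.G) = 0 := by
  have hsum := sum_flatsBetween hM.ground x.flatF y.flatF hle.1 hF a
  rw [hxF, hyF, mul_zero, add_zero] at hsum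
  have hcase : ∀ q ∈ gapBetween hM.ground x y, q.G = y.G ∨ q.G = x.G := by
    intro q hq
    have := mem_between'.1 (mem_gapBetween.1 hq).1
    exact flat_eq_or_eq (M := M✶) hM.ground y.flatG q.flatG this.1.2.2 this.1.1.2 hG.le
  have hdet : ∀ q ∈ gapBetween hM.ground x y, q.G = y.G ↔ ∀ i, i ∈ q.F ∨ i ∈ y.G := by
    intro q hq
    refine ⟨fun h i => h ▸ q.mem_union hM.ground i, fun h =>
      (hcase q hq).resolve_right fun h' => ?_⟩
    obtain ⟨-, i, ⟨hi1, hi2⟩, hi⟩ := mem_gapBetween.1 hq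
    exact hi ⟨(h i).resolve_right hi2, h' ▸ (x.mem_or i).resolve_left hi1⟩
  rw [← hsum]
  refine Finset.sum_nbij Biflat.F (fun q hq => ?_) (fun q hq q' hq' hqq => ?_)
    (fun K hK => ?_) (fun q hq => ?_)
  · have h := mem_between'.1 (mem_gapBetween.1 hq).1
    refine mem_flatsBetween.2 ⟨q.flatF, h.1.1.1.ssubset_of_ne fun h' => ?_,
      h.1.2.1.ssubset_of_ne fun h' => ?_⟩
    · exact gapBetween_ssubset hq ⟨Or.inl h'.symm, (hcase q hq).symm⟩
    · exact gapBetween_ssubset hq ⟨Or.inr h', (hcase q hq).symm⟩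
  · rw [Finset.mem_coe] at hq hq'
    refine biflat_ext hqq ?_
    have h1 := hdet q hq
    have h2 := hdet q' hq'
    rw [← hqq, ← h1] at h2
    rcases hcase q hq with h | h <;> rcases hcase q' hq' with h' | h'
    · rw [h, h']
    · rw [h, h2.2 h]
    · rw [h', h2.1 h']
    · rw [h, h']
  · obtain ⟨hK1, hK2, hK3⟩ := mem_flatsBetween.1 hK
    have hKu : K ≠ Set.univ := fun h => hK3.not_subset (h ▸ Set.subset_univ _)
    by_cases hu : ∀ i, i ∈ K ∨ i ∈ y.G
    · let q0 : Biflat M := mkBiflat hM hK1 y.flatG hu (Set.nonempty_of_ssubset' hK2) (by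
        rw [Set.nonempty_iff_ne_empty]
        intro h
        exact hKu (Set.eq_univ_of_forall fun i => (hu i).resolve_right (h ▸ Set.notMem_empty i)))
        (Or.inl hKu)
      refine ⟨q0, ?_, rfl⟩
      obtain ⟨i, hi⟩ := hgap
      rw [Finset.mem_coe, mem_gapBetween, mem_between' (q := q0)]
      exact ⟨⟨⟨⟨hK2.subset, hle.2⟩, hK3.subset, subset_rfl⟩,
        fun h => hK2.ne h.1.symm, fun h => hK3.ne h.1⟩, i, hi, fun h => hi.2 h.2⟩
    · obtain ⟨i, hi⟩ := not_forall.1 hu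
      rw [not_or] at hi
      let q0 : Biflat M := mkBiflat hM hK1 x.flatG
        (fun j => (x.mem_or j).imp_left fun h => hK2.subset h)
        (Set.nonempty_of_ssubset' hK2)
        ⟨i, (x.mem_or i).resolve_left fun h => hi.1 (hK2.subset h)⟩ (Or.inl hKu)
      refine ⟨q0, ?_, rfl⟩
      rw [Finset.mem_coe, mem_gapBetween, mem_between' (q := q0)]
      exact ⟨⟨⟨⟨hK2.subset, subset_rfl⟩, hK3.subset, hle.2⟩,
        fun h => hK2.ne h.1.symm, fun h => hK3.ne h.1⟩, i, ⟨fun h => hi.1 (hK2.subset h), hi.2⟩,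
        fun h => hi.1 h.1⟩
  · rcases hcase q hq with h | h
    · rw [h, hyG, add_zero]
    · rw [h, hxG, add_zero]

theorem sum_gapBetween_G (x y : FlatPair M) (hle : x ≤ y) (hgap : Gap x y)
    (hF : rk M y.F = rk M x.F + 1) (hG : rk M✶ x.G = rk M✶ y.G + 2)
    (hxF : sumOn a x.F = 0) (hyF : sumOn a y.F = 0) (hxG : sumOn b x.G = 0)
    (hyG : sumOn b y.G = 0) :
    ∑ q ∈ gapBetween hM.ground x y, (sumOn a q.F + sumOn b q.G) = 0 := by
  have hsum := sum_flatsBetween (M := M✶) hM.ground y.flatG x.flatG hle.2 hG b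
  rw [hxG, hyG, mul_zero, add_zero] at hsum
  have hcase : ∀ q ∈ gapBetween hM.ground x y, q.F = x.F ∨ q.F = y.F := by
    intro q hq
    have := mem_between'.1 (mem_gapBetween.1 hq).1
    exact flat_eq_or_eq hM.ground x.flatF q.flatF this.1.1.1 this.1.2.1 hF.le
  have hdet : ∀ q ∈ gapBetween hM.ground x y, q.F = x.F ↔ ∀ i, i ∈ x.F ∨ i ∈ q.G := by
    intro q hq
    refine ⟨fun h i => h ▸ q.mem_union hM.ground i, fun h =>
      (hcase q hq).resolve_right fun h' => ?_⟩
    obtain ⟨-, i, ⟨hi1, hi2⟩, hi⟩ := mem_gapBetween.1 hq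
    exact hi ⟨h' ▸ (y.mem_or i).resolve_right hi2, (h i).resolve_left hi1⟩
  rw [← hsum]
  refine Finset.sum_nbij Biflat.G (fun q hq => ?_) (fun q hq q' hq' hqq => ?_)
    (fun K hK => ?_) (fun q hq => ?_)
  · have h := mem_between'.1 (mem_gapBetween.1 hq).1
    refine mem_flatsBetween.2 ⟨q.flatG, h.1.2.2.ssubset_of_ne fun h' => ?_,
      h.1.1.2.ssubset_of_ne fun h' => ?_⟩
    · exact gapBetween_ssubset hq ⟨hcase q hq, Or.inr h'.symm⟩
    · exact gapBetween_ssubset hq ⟨hcase q hq, Or.inl h'⟩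
  · rw [Finset.mem_coe] at hq hq'
    refine biflat_ext ?_ hqq
    have h1 := hdet q hq
    have h2 := hdet q' hq'
    rw [← hqq, ← h1] at h2
    rcases hcase q hq with h | h <;> rcases hcase q' hq' with h' | h'
    · rw [h, h']
    · rw [h, h2.2 h]
    · rw [h', h2.1 h']
    · rw [h, h']
  · obtain ⟨hK1, hK2, hK3⟩ := mem_flatsBetween.1 hK
    have hKu : K ≠ Set.univ := fun h => hK3.not_subset (h ▸ Set.subset_univ _)
    by_cases hu : ∀ i, i ∈ x.F ∨ i ∈ K
    · let q0 : Biflat M := mkBiflat hM x.flatF hK1 hu (by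
        rw [Set.nonempty_iff_ne_empty]
        intro h
        exact hKu (Set.eq_univ_of_forall fun i => (hu i).resolve_left (h ▸ Set.notMem_empty i)))
        (Set.nonempty_of_ssubset' hK2) (Or.inr hKu)
      refine ⟨q0, ?_, rfl⟩
      obtain ⟨i, hi⟩ := hgap
      rw [Finset.mem_coe, mem_gapBetween, mem_between' (q := q0)]
      exact ⟨⟨⟨⟨subset_rfl, hK3.subset⟩, hle.1, hK2.subset⟩,
        fun h => hK3.ne h.2, fun h => hK2.ne h.2.symm⟩, i, hi, fun h => hi.1 h.1⟩
    · obtain ⟨i, hi⟩ := not_forall.1 hu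
      rw [not_or] at hi
      let q0 : Biflat M := mkBiflat hM y.flatF hK1
        (fun j => (y.mem_or j).imp_right fun h => hK2.subset h)
        ⟨i, (y.mem_or i).resolve_right fun h => hi.2 (hK2.subset h)⟩
        (Set.nonempty_of_ssubset' hK2) (Or.inr hKu)
      refine ⟨q0, ?_, rfl⟩
      rw [Finset.mem_coe, mem_gapBetween, mem_between' (q := q0)]
      exact ⟨⟨⟨⟨hle.1, hK3.subset⟩, subset_rfl, hK2.subset⟩,
        fun h => hK3.ne h.2, fun h => hK2.ne h.2.symm⟩, i, ⟨hi.1, fun h => hi.2 (hK2.subset h)⟩,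
        fun h => hi.2 h.2⟩
  · rcases hcase q hq with h | h
    · rw [h, hxF, zero_add]
    · rw [h, hyF, zero_add]

/-- The sum over a gap step of height three. -/
theorem sum_gapBetween_of_ht (x y : FlatPair M) (hle : x ≤ y) (hgap : Gap x y)
    (hht : y.ht = x.ht + 3)
    (hxF : sumOn a x.F = 0) (hyF : sumOn a y.F = 0) (hxG : sumOn b x.G = 0)
    (hyG : sumOn b y.G = 0) :
    ∑ q ∈ gapBetween hM.ground x y, (sumOn a q.F + sumOn b q.G) = 0 := by
  have h3 : rk M x.F < rk M y.F ∧ rk M✶ y.G < rk M✶ x.G := by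
    obtain ⟨i, hi, hi'⟩ := hgap
    exact ⟨rk_lt hM.ground x.flatF (hle.1.ssubset_of_ne fun h => hi (h ▸
      (y.mem_or i).resolve_right hi')), rk_lt (M := M✶) hM.ground y.flatG
      (hle.2.ssubset_of_ne fun h => hi' (h ▸ (x.mem_or i).resolve_left hi))⟩
  unfold ht at hht
  by_cases hF : rk M y.F = rk M x.F + 1
  · exact sum_gapBetween_G hM x y hle hgap hF (by omega) hxF hyF hxG hyG
  · exact sum_gapBetween_F hM x y hle hgap (by omega) (by omega) hxF hyF hxG hyG

end FlatPair

end Balance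

/-! ### Saturated chains and balancing at a codimension one cone -/

section Balance

variable {M : Matroid (Fin (n + 1))}

namespace FlatPair

section Chain

variable {C : Finset (FlatPair M)} (hE : M.E = Set.univ)
  (hC : ∀ x ∈ C, ∀ y ∈ C, x ≤ y ∨ y ≤ x)

include hE

theorem ht_mono {x y : FlatPair M} (h : x ≤ y) : x.ht ≤ y.ht := by
  rcases h.eq_or_lt with rfl | h
  · exact le_rfl
  · exact (ht_lt hE h).le

theorem F_or_G_eq_of_ht {p q : FlatPair M} (h : p ≤ q) (hht : q.ht = p.ht + 1) :
    p.F = q.F ∨ p.G = q.G := by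
  have h1 : rk M p.F ≤ rk M q.F := rk_mono h.1
  have h2 : rk M✶ q.G ≤ rk M✶ p.G := rk_mono h.2
  unfold ht at hht
  by_cases hF : rk M q.F ≤ rk M p.F
  · exact Or.inl (eq_of_rk_le hE p.flatF h.1 hF)
  · exact Or.inr (eq_of_rk_le (M := M✶) hE q.flatG h.2 (by omega)).symm

theorem notMem_F_of_step {p q : FlatPair M} (h : p ≤ q) (hht : q.ht = p.ht + 1)
    {i : Fin (n + 1)} (hq : ¬ (i ∈ q.F ∧ i ∈ q.G)) (hp : i ∉ p.F) : i ∉ q.F := by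
  rcases F_or_G_eq_of_ht hE h hht with h' | h'
  · rwa [← h']
  · exact fun hi => hq ⟨hi, h' ▸ (p.mem_or i).resolve_left hp⟩

/-- A step of height one changes only one of the two sides. If the flat is fixed the claim is clear;
if the coflat is fixed, both values being zero forces the flat parts to agree. -/
theorem sumOn_F_of_step {a b : Fin (n + 1) → ℝ} {p q : FlatPair M} (h : p ≤ q)
    (hht : q.ht = p.ht + 1) (hp : p.val a b = 0) (hq : q.val a b = 0) :
    sumOn a q.F = sumOn a p.F := by
  unfold val at hp hq
  rcases F_or_G_eq_of_ht hE h hht with h' | h'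
  · rw [h']
  · rw [h'] at hp
    linarith

include hC

theorem le_of_ht_lt {x y : FlatPair M} (hx : x ∈ C) (hy : y ∈ C) (h : x.ht < y.ht) : x ≤ y :=
  (hC x hx y hy).resolve_right fun h' => absurd (ht_mono hE h') (not_le.2 h)

theorem eq_of_ht_eq {x y : FlatPair M} (hx : x ∈ C) (hy : y ∈ C) (h : x.ht = y.ht) : x = y := by
  by_contra hne
  rcases hC x hx y hy with h' | h'
  · exact (ht_lt hE (lt_of_le_of_ne h' hne)).ne h
  · exact (ht_lt hE (lt_of_le_of_ne h' (Ne.symm hne))).ne' h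

/-- Where the chain has a member at every height, any property preserved by steps of height one
propagates. -/
theorem walk (R : FlatPair M → Prop)
    (hR : ∀ p ∈ C, ∀ q ∈ C, p ≤ q → q.ht = p.ht + 1 → R p → R q) (k : ℕ) :
    ∀ p ∈ C, ∀ q ∈ C, q.ht = p.ht + k →
      (∀ c, p.ht ≤ c → c ≤ q.ht → ∃ z ∈ C, z.ht = c) → R p → R q := by
  induction k with
  | zero =>
    intro p hp q hq h _ hRp
    rwa [eq_of_ht_eq hE hC hq hp (by simpa using h)]
  | succ k ih =>
    intro p hp q hq h hex hRp
    push_cast at h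
    obtain ⟨z, hz, hzht⟩ := hex (p.ht + k) (by omega) (by omega)
    refine hR z hz q hq (le_of_ht_lt hE hC hz hq (by omega)) (by omega) ?_
    exact ih p hp z hz hzht (fun c h1 h2 => hex c h1 (by omega)) hRp

theorem walk' (R : FlatPair M → Prop)
    (hR : ∀ p ∈ C, ∀ q ∈ C, p ≤ q → q.ht = p.ht + 1 → R p → R q) {p q : FlatPair M}
    (hp : p ∈ C) (hq : q ∈ C) (hle : p.ht ≤ q.ht)
    (hex : ∀ c, p.ht ≤ c → c ≤ q.ht → ∃ z ∈ C, z.ht = c) (h : R p) : R q :=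
  walk hE hC R hR (q.ht - p.ht).toNat p hp q hq (by omega) hex h

end Chain

/-- The pair `∅|E`. -/
def bot (hM : IsGood M r) : FlatPair M :=
  ⟨∅, Set.univ, hM.isFlat_empty, hM.dual.isFlat_univ, fun _ => Or.inr trivial⟩

/-- The pair `E|∅`. -/
def top (hM : IsGood M r) : FlatPair M :=
  ⟨Set.univ, ∅, hM.isFlat_univ, hM.dual.isFlat_empty, fun _ => Or.inl trivial⟩

/-- A biflag together with the two trivial pairs. -/
def chainOf (hM : IsGood M r) (τ : Finset (Biflat M)) : Finset (FlatPair M) :=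
  insert (bot hM) (insert (top hM) (τ.image (ofBiflat hM.ground)))

section Main

variable (hM : IsGood M r) {τ : Finset (Biflat M)}

theorem mem_chainOf {x : FlatPair M} : x ∈ chainOf hM τ ↔
    x = bot hM ∨ x = top hM ∨ ∃ p ∈ τ, ofBiflat hM.ground p = x := by
  simp [chainOf]

theorem bot_mem : bot hM ∈ chainOf hM τ := (mem_chainOf hM).2 (Or.inl rfl)

theorem top_mem : top hM ∈ chainOf hM τ := (mem_chainOf hM).2 (Or.inr (Or.inl rfl))

theorem ofBiflat_mem {p : Biflat M} (hp : p ∈ τ) : ofBiflat hM.ground p ∈ chainOf hM τ :=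
  (mem_chainOf hM).2 (Or.inr (Or.inr ⟨p, hp, rfl⟩))

theorem bot_le (x : FlatPair M) : bot hM ≤ x := ⟨Set.empty_subset _, Set.subset_univ _⟩

theorem le_top (x : FlatPair M) : x ≤ top hM := ⟨Set.subset_univ _, Set.empty_subset _⟩

theorem bot_lt (p : Biflat M) : bot hM < ofBiflat hM.ground p :=
  lt_of_le_of_ne (bot_le hM _) fun h => p.nonemptyF.ne_empty (congrArg FlatPair.F h).symm

theorem lt_top (p : Biflat M) : ofBiflat hM.ground p < top hM :=
  lt_of_le_of_ne (le_top hM _) fun h => p.nonemptyG.ne_empty (congrArg FlatPair.G h)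

theorem ht_bot : (bot hM).ht = 0 := by
  simp [ht, bot, rk_empty]

theorem ht_top : (top hM).ht = n + 1 := by
  have h1 := hM.rk_univ
  have h2 := hM.rk_dual_univ
  simp only [ht, top, rk_empty]
  omega

theorem chainOf_chain (hτ : IsBiflag M τ) :
    ∀ x ∈ chainOf hM τ, ∀ y ∈ chainOf hM τ, x ≤ y ∨ y ≤ x := by
  intro x hx y hy
  rcases (mem_chainOf hM).1 hx with rfl | rfl | ⟨p, hp, rfl⟩
  · exact Or.inl (bot_le hM _)
  · exact Or.inr (le_top hM _)
  rcases (mem_chainOf hM).1 hy with rfl | rfl | ⟨q, hq, rfl⟩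
  · exact Or.inr (bot_le hM _)
  · exact Or.inl (le_top hM _)
  exact hτ.le_or_le hp hq

theorem chainOf_gap {i : Fin (n + 1)} (hi : ∀ p ∈ τ, ¬ (i ∈ p.F ∧ i ∈ p.G)) :
    ∀ x ∈ chainOf hM τ, ¬ (i ∈ x.F ∧ i ∈ x.G) := by
  intro x hx
  rcases (mem_chainOf hM).1 hx with rfl | rfl | ⟨p, hp, rfl⟩
  · exact fun h => h.1
  · exact fun h => h.2
  · exact hi p hp

theorem card_chainOf : (chainOf hM τ).card = τ.card + 2 := by
  have hne : bot hM ≠ top hM := fun h => by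
    have : (∅ : Set (Fin (n + 1))) = Set.univ := congrArg FlatPair.F h
    exact Set.empty_ne_univ this
  rw [chainOf, Finset.card_insert_of_notMem, Finset.card_insert_of_notMem,
    Finset.card_image_of_injective _ (ofBiflat_injective hM.ground)]
  · intro h
    obtain ⟨p, -, hp⟩ := Finset.mem_image.1 h
    exact (lt_top hM p).ne hp
  · intro h
    rcases Finset.mem_insert.1 h with h | h
    · exact hne h
    · obtain ⟨p, -, hp⟩ := Finset.mem_image.1 h
      exact (bot_lt hM p).ne' hp

/-- Together with the two trivial pairs the chain has `n` members with distinct heights among the `n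
+ 2` values from `0` to `n + 1`, so two heights are missing; neither is an end, since the trivial
pairs occupy those. -/
theorem exists_missing (hτ : IsBiflag M τ) (hc : τ.card + 2 = n) :
    ∃ c₁ c₂ : ℤ, c₁ < c₂ ∧ 1 ≤ c₁ ∧ c₂ ≤ n ∧
      (∀ x ∈ chainOf hM τ, x.ht ≠ c₁ ∧ x.ht ≠ c₂) ∧
      ∀ c : ℤ, 0 ≤ c → c ≤ n + 1 → c ≠ c₁ → c ≠ c₂ → ∃ x ∈ chainOf hM τ, x.ht = c := by
  have hch := chainOf_chain hM hτ
  have himg : ((chainOf hM τ).image FlatPair.ht) ⊆ Finset.Icc (0 : ℤ) (n + 1) := by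
    intro c hc
    obtain ⟨x, -, rfl⟩ := Finset.mem_image.1 hc
    have h1 := ht_mono hM.ground (bot_le hM x)
    have h2 := ht_mono hM.ground (le_top hM x)
    rw [ht_bot] at h1
    rw [ht_top] at h2
    exact Finset.mem_Icc.2 ⟨h1, h2⟩
  have hcard : (Finset.Icc (0 : ℤ) (n + 1) \ (chainOf hM τ).image FlatPair.ht).card = 2 := by
    rw [Finset.card_sdiff_of_subset himg, Finset.card_image_of_injOn, card_chainOf, Int.card_Icc]
    · omega
    · exact fun x hx y hy h => eq_of_ht_eq hM.ground hch hx hy h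
  obtain ⟨c, d, hne, hcd⟩ := Finset.card_eq_two.1 hcard
  have hmem : ∀ e, e ∈ Finset.Icc (0 : ℤ) (n + 1) \ (chainOf hM τ).image FlatPair.ht ↔
      e = c ∨ e = d := fun e => by rw [hcd]; simp
  have key : ∀ c d : ℤ, c < d →
      (∀ e, e ∈ Finset.Icc (0 : ℤ) (n + 1) \ (chainOf hM τ).image FlatPair.ht ↔ e = c ∨ e = d) →
      ∃ c₁ c₂ : ℤ, c₁ < c₂ ∧ 1 ≤ c₁ ∧ c₂ ≤ n ∧
      (∀ x ∈ chainOf hM τ, x.ht ≠ c₁ ∧ x.ht ≠ c₂) ∧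
      ∀ c : ℤ, 0 ≤ c → c ≤ n + 1 → c ≠ c₁ → c ≠ c₂ → ∃ x ∈ chainOf hM τ, x.ht = c := by
    intro c d hlt hmem
    have hc := (hmem c).2 (Or.inl rfl)
    have hd := (hmem d).2 (Or.inr rfl)
    rw [Finset.mem_sdiff, Finset.mem_Icc] at hc hd
    have hx : ∀ x ∈ chainOf hM τ, x.ht ≠ c ∧ x.ht ≠ d := fun x hx =>
      ⟨fun h => hc.2 (Finset.mem_image.2 ⟨x, hx, h⟩), fun h => hd.2 (Finset.mem_image.2 ⟨x, hx, h⟩)⟩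
    have h0 := (hx _ (bot_mem hM)).1
    have h1 := (hx _ (top_mem hM)).2
    rw [ht_bot] at h0
    rw [ht_top] at h1
    refine ⟨c, d, hlt, by omega, by omega, hx, fun e h2 h3 h4 h5 => ?_⟩
    by_contra hcon
    have := (hmem e).1 (Finset.mem_sdiff.2 ⟨Finset.mem_Icc.2 ⟨h2, h3⟩, fun h => hcon
      (Finset.mem_image.1 h)⟩)
    exact this.elim h4 h5
  rcases lt_or_gt_of_ne hne with h | h
  · exact key c d h hmem
  · exact key d c h fun e => (hmem e).trans or_comm

theorem ht_eq_missing {c₁ c₂ : ℤ}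
    (hex : ∀ c : ℤ, 0 ≤ c → c ≤ n + 1 → c ≠ c₁ → c ≠ c₂ → ∃ x ∈ chainOf hM τ, x.ht = c)
    {q : Biflat M} (hq : q ∉ τ) (hb : IsBiflag M (insert q τ)) :
    (ofBiflat hM.ground q).ht = c₁ ∨ (ofBiflat hM.ground q).ht = c₂ := by
  by_contra hcon
  rw [not_or] at hcon
  have h1 := ht_lt hM.ground (bot_lt hM q)
  have h2 := ht_lt hM.ground (lt_top hM q)
  rw [ht_bot] at h1
  rw [ht_top] at h2
  obtain ⟨x, hx, hxq⟩ := hex _ h1.le h2.le hcon.1 hcon.2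
  have hx' : x ∈ chainOf hM (insert q τ) := by
    rcases (mem_chainOf hM).1 hx with rfl | rfl | ⟨p, hp, rfl⟩
    · exact bot_mem hM
    · exact top_mem hM
    · exact ofBiflat_mem hM (Finset.mem_insert_of_mem hp)
  have := eq_of_ht_eq hM.ground (chainOf_chain hM hb) hx'
    (ofBiflat_mem hM (Finset.mem_insert_self q τ)) hxq
  subst this
  rcases (mem_chainOf hM).1 hx with h | h | ⟨p, hp, h⟩
  · exact (bot_lt hM q).ne' h
  · exact (lt_top hM q).ne h
  · exact hq (ofBiflat_injective hM.ground h ▸ hp)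

theorem mem_chainOf_insert {q : Biflat M} {x : FlatPair M} (h : x ∈ chainOf hM τ) :
    x ∈ chainOf hM (insert q τ) := by
  rcases (mem_chainOf hM).1 h with rfl | rfl | ⟨p, hp, rfl⟩
  · exact bot_mem hM
  · exact top_mem hM
  · exact ofBiflat_mem hM (Finset.mem_insert_of_mem hp)

theorem lt_iff_ht_lt {S : Finset (Biflat M)} (hS : IsBiflag M S) {x y : FlatPair M}
    (hx : x ∈ chainOf hM S) (hy : y ∈ chainOf hM S) (h : x.ht < y.ht) : x < y :=
  lt_of_le_of_ne (le_of_ht_lt hM.ground (chainOf_chain hM hS) hx hy h) fun h' => by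
    rw [h'] at h; exact lt_irrefl _ h

theorem isBiflag_insert_of_between (hτ : IsBiflag M τ) {x y : FlatPair M}
    (hx : x ∈ chainOf hM τ) (hy : y ∈ chainOf hM τ)
    (hcons : ∀ z ∈ chainOf hM τ, z.ht ≤ x.ht ∨ y.ht ≤ z.ht) {q : Biflat M}
    (hq : q ∈ between hM.ground x y) {i : Fin (n + 1)}
    (hi : ∀ p ∈ τ, ¬ (i ∈ p.F ∧ i ∈ p.G)) (hiq : ¬ (i ∈ q.F ∧ i ∈ q.G)) :
    q ∉ τ ∧ IsBiflag M (insert q τ) := by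
  obtain ⟨h1, h2⟩ := mem_between.1 hq
  have hch := chainOf_chain hM hτ
  refine ⟨fun h => ?_, (isBiflag_iff hM.ground).2 ⟨?_, i, ?_⟩⟩
  · rcases hcons _ (ofBiflat_mem hM h) with h' | h'
    · exact absurd (ht_lt hM.ground h1) (not_lt.2 h')
    · exact absurd (ht_lt hM.ground h2) (not_lt.2 h')
  · have hcomp : ∀ p ∈ τ, p ≤ q ∨ q ≤ p := by
      intro p hp
      rcases hcons _ (ofBiflat_mem hM hp) with h' | h'
      · left
        have : ofBiflat hM.ground p ≤ x := by
          rcases hch _ (ofBiflat_mem hM hp) x hx with h | h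
          · exact h
          · rw [eq_of_ht_eq hM.ground hch (ofBiflat_mem hM hp) hx
              (le_antisymm h' (ht_mono hM.ground h))]
        exact ofBiflat_le.1 (this.trans h1.le)
      · right
        have : y ≤ ofBiflat hM.ground p := by
          rcases hch y hy _ (ofBiflat_mem hM hp) with h | h
          · exact h
          · rw [eq_of_ht_eq hM.ground hch (ofBiflat_mem hM hp) hy
              (le_antisymm (ht_mono hM.ground h) h')]
        exact ofBiflat_le.1 (h2.le.trans this)
    intro p hp p' hp'
    rcases Finset.mem_insert.1 hp with h | hp <;> rcases Finset.mem_insert.1 hp' with h' | hp'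
    · rw [h, h']; exact Or.inl le_rfl
    · rw [h]; exact (hcomp p' hp').symm
    · rw [h']; exact hcomp p hp
    · exact hτ.le_or_le hp hp'
  · intro p hp
    rcases Finset.mem_insert.1 hp with rfl | hp
    · exact hiq
    · exact hi p hp

/-- Members at or below `x` have their flat inside `x.F`, and members at or above `y` have their
coflat inside `y.G`. -/
theorem gap_of_notMem (hτ : IsBiflag M τ) {x y : FlatPair M} (hx : x ∈ chainOf hM τ)
    (hy : y ∈ chainOf hM τ) (hcons : ∀ z ∈ chainOf hM τ, z.ht ≤ x.ht ∨ y.ht ≤ z.ht)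
    {i : Fin (n + 1)} (h1 : i ∉ x.F) (h2 : i ∉ y.G) : ∀ p ∈ τ, ¬ (i ∈ p.F ∧ i ∈ p.G) := by
  have hch := chainOf_chain hM hτ
  intro p hp h
  rcases hcons _ (ofBiflat_mem hM hp) with h' | h'
  · have : ofBiflat hM.ground p ≤ x := by
      rcases hch _ (ofBiflat_mem hM hp) x hx with h | h
      · exact h
      · rw [eq_of_ht_eq hM.ground hch (ofBiflat_mem hM hp) hx
          (le_antisymm h' (ht_mono hM.ground h))]
    exact h1 (this.1 h.1)
  · have : y ≤ ofBiflat hM.ground p := by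
      rcases hch y hy _ (ofBiflat_mem hM hp) with h | h
      · exact h
      · rw [eq_of_ht_eq hM.ground hch (ofBiflat_mem hM hp) hy
          (le_antisymm (ht_mono hM.ground h) h')]
    exact h2 (this.2 h.2)

-- A new biflat must have one of the two missing heights. Outside the places where heights are
-- missing the chain is saturated, so the value of `a` on the flats is zero from the bottom up to
-- `x₁` and from `y₂` to the top, and every gap element enters the flats somewhere between them.
include hM in
theorem sum_fill_eq_zero (hτ : IsBiflag M τ) (hc : τ.card + 2 = n) {a b : Fin (n + 1) → ℝ}
    (ha : ∑ i, a i = 0) (hb : ∑ i, b i = 0)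
    (h0 : ∀ p ∈ τ, sumOn a p.F + sumOn b p.G = 0) :
    ∑ q : Biflat M with q ∉ τ ∧ IsBiflag M (insert q τ), (sumOn a q.F + sumOn b q.G) = 0 := by
  have hE := hM.ground
  obtain ⟨c₁, c₂, hlt, hc1, hc2, hne, hex⟩ := exists_missing hM hτ hc
  have hch := chainOf_chain hM hτ
  have hval : ∀ x ∈ chainOf hM τ, x.val a b = 0 := by
    intro x hx
    rcases (mem_chainOf hM).1 hx with rfl | rfl | ⟨p, hp, rfl⟩
    · simp [val, bot, sumOn_empty, sumOn_univ hb]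
    · simp [val, top, sumOn_empty, sumOn_univ ha]
    · exact h0 p hp
  have hwalk : ∀ x ∈ chainOf hM τ, ∀ y ∈ chainOf hM τ, x.ht ≤ y.ht →
      (∀ c, x.ht ≤ c → c ≤ y.ht → c ≠ c₁ ∧ c ≠ c₂) → sumOn a y.F = sumOn a x.F := by
    intro x hx y hy hxy hm
    have hbx := ht_mono hE (bot_le hM x)
    have hty := ht_mono hE (le_top hM y)
    rw [ht_bot] at hbx
    rw [ht_top] at hty
    refine walk' hE hch (fun z => sumOn a z.F = sumOn a x.F) (fun p hp q hq hpq hht h => ?_)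
      hx hy hxy (fun c h1 h2 => hex c (by omega) (by omega) (hm c h1 h2).1 (hm c h1 h2).2) rfl
    rw [sumOn_F_of_step hE hpq hht (hval p hp) (hval q hq), h]
  have hwalkgap : ∀ i, (∀ p ∈ τ, ¬ (i ∈ p.F ∧ i ∈ p.G)) → ∀ x ∈ chainOf hM τ,
      ∀ y ∈ chainOf hM τ, x.ht ≤ y.ht →
      (∀ c, x.ht ≤ c → c ≤ y.ht → c ≠ c₁ ∧ c ≠ c₂) → i ∉ x.F → i ∉ y.F := by
    intro i hi x hx y hy hxy hm
    have hbx := ht_mono hE (bot_le hM x)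
    have hty := ht_mono hE (le_top hM y)
    rw [ht_bot] at hbx
    rw [ht_top] at hty
    exact walk' hE hch (fun z => i ∉ z.F) (fun p hp q hq hpq hht h =>
      notMem_F_of_step hE hpq hht (chainOf_gap hM hi q hq) h)
      hx hy hxy (fun c h1 h2 => hex c (by omega) (by omega) (hm c h1 h2).1 (hm c h1 h2).2)
  obtain ⟨x₁, hx₁, hx₁h⟩ := hex (c₁ - 1) (by omega) (by omega) (by omega) (by omega)
  obtain ⟨y₂, hy₂, hy₂h⟩ := hex (c₂ + 1) (by omega) (by omega) (by omega) (by omega)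
  have hx₁0 : sumOn a x₁.F = 0 := by
    rw [hwalk _ (bot_mem hM) x₁ hx₁ (by rw [ht_bot]; omega)
      (fun c h1 h2 => ⟨by omega, by omega⟩)]
    exact sumOn_empty a
  have hy₂0 : sumOn a y₂.F = 0 := by
    rw [← hwalk y₂ hy₂ _ (top_mem hM) (by rw [ht_top]; omega)
      (fun c h1 h2 => ⟨by omega, by omega⟩)]
    exact sumOn_univ ha
  have hx₁i : ∀ i, (∀ p ∈ τ, ¬ (i ∈ p.F ∧ i ∈ p.G)) → i ∉ x₁.F := fun i hi =>
    hwalkgap i hi _ (bot_mem hM) x₁ hx₁ (by rw [ht_bot]; omega)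
      (fun c h1 h2 => ⟨by omega, by omega⟩) (Set.notMem_empty i)
  have hy₂i : ∀ i, (∀ p ∈ τ, ¬ (i ∈ p.F ∧ i ∈ p.G)) → i ∈ y₂.F := fun i hi => by
    by_contra hcon
    exact hwalkgap i hi y₂ hy₂ _ (top_mem hM) (by rw [ht_top]; omega)
      (fun c h1 h2 => ⟨by omega, by omega⟩) hcon (Set.mem_univ i)
  have hsub : ∀ {q : Biflat M} {i}, (∀ p ∈ insert q τ, ¬ (i ∈ p.F ∧ i ∈ p.G)) →
      ∀ p ∈ τ, ¬ (i ∈ p.F ∧ i ∈ p.G) := fun h p hp => h p (Finset.mem_insert_of_mem hp)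
  -- Adjacent missing heights form a single step of height three, and the gap must lie in that step.
  by_cases hcc : c₂ = c₁ + 1
  · have hcons : ∀ z ∈ chainOf hM τ, z.ht ≤ x₁.ht ∨ y₂.ht ≤ z.ht := fun z hz => by
      have := hne z hz; omega
    have hset : (Finset.univ.filter fun q : Biflat M => q ∉ τ ∧ IsBiflag M (insert q τ))
        = gapBetween hE x₁ y₂ := by
      ext q
      rw [Finset.mem_filter, mem_gapBetween]
      constructor
      · rintro ⟨-, hq, hbq⟩
        have hht := ht_eq_missing hM hex hq hbq
        have hqm := ofBiflat_mem hM (Finset.mem_insert_self q τ)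
        refine ⟨mem_between.2 ⟨lt_iff_ht_lt hM hbq (mem_chainOf_insert hM hx₁) hqm (by omega),
          lt_iff_ht_lt hM hbq hqm (mem_chainOf_insert hM hy₂) (by omega)⟩, ?_⟩
        obtain ⟨i, hi⟩ := ((isBiflag_iff hE).1 hbq).2
        exact ⟨i, ⟨hx₁i i (hsub hi), fun h => chainOf_gap hM (hsub hi) y₂ hy₂
          ⟨hy₂i i (hsub hi), h⟩⟩, hi q (Finset.mem_insert_self q τ)⟩
      · rintro ⟨hq, i, ⟨h1, h2⟩, h3⟩
        exact ⟨Finset.mem_univ _, isBiflag_insert_of_between hM hτ hx₁ hy₂ hcons hq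
          (gap_of_notMem hM hτ hx₁ hy₂ hcons h1 h2) h3⟩
    rw [hset]
    obtain ⟨i, hi⟩ := ((isBiflag_iff hE).1 hτ).2
    have v1 := hval x₁ hx₁
    have v2 := hval y₂ hy₂
    unfold val at v1 v2
    exact sum_gapBetween_of_ht hM x₁ y₂ (le_of_ht_lt hE hch hx₁ hy₂ (by omega))
      ⟨i, hx₁i i hi, fun h => chainOf_gap hM hi y₂ hy₂ ⟨hy₂i i hi, h⟩⟩ (by omega) hx₁0 hy₂0
      (by linarith) (by linarith)
  · obtain ⟨y₁, hy₁, hy₁h⟩ := hex (c₁ + 1) (by omega) (by omega) (by omega) (by omega)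
    obtain ⟨x₂, hx₂, hx₂h⟩ := hex (c₂ - 1) (by omega) (by omega) (by omega) (by omega)
    have hcons₁ : ∀ z ∈ chainOf hM τ, z.ht ≤ x₁.ht ∨ y₁.ht ≤ z.ht := fun z hz => by
      have := hne z hz; omega
    have hcons₂ : ∀ z ∈ chainOf hM τ, z.ht ≤ x₂.ht ∨ y₂.ht ≤ z.ht := fun z hz => by
      have := hne z hz; omega
    have hmid : sumOn a x₂.F = sumOn a y₁.F :=
      hwalk y₁ hy₁ x₂ hx₂ (by omega) fun c h1 h2 => ⟨by omega, by omega⟩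
    -- Here there are two separate steps of height two. Filling one of them leaves a saturated part
    -- there, so the gap of the enlarged biflag must lie in the other.
    have hset : (Finset.univ.filter fun q : Biflat M => q ∉ τ ∧ IsBiflag M (insert q τ))
        = (if Gap x₂ y₂ then between hE x₁ y₁ else ∅) ∪
          (if Gap x₁ y₁ then between hE x₂ y₂ else ∅) := by
      ext q
      rw [Finset.mem_filter, Finset.mem_union]
      constructor
      · rintro ⟨-, hq, hbq⟩
        have hht := ht_eq_missing hM hex hq hbq
        have hqm := ofBiflat_mem hM (Finset.mem_insert_self q τ)
        obtain ⟨i, hi⟩ := ((isBiflag_iff hE).1 hbq).2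
        have hiq : ¬ (i ∈ (ofBiflat hE q).F ∧ i ∈ (ofBiflat hE q).G) :=
          hi q (Finset.mem_insert_self q τ)
        have hi' := hsub hi
        rcases hht with hht | hht
        · left
          have l1 := lt_iff_ht_lt hM hbq (mem_chainOf_insert hM hx₁) hqm (by omega)
          have l2 := lt_iff_ht_lt hM hbq hqm (mem_chainOf_insert hM hy₁) (by omega)
          have hgap : Gap x₂ y₂ := by
            have g1 := notMem_F_of_step hE l1.le (by omega) hiq (hx₁i i hi')
            have g2 := notMem_F_of_step hE l2.le (by omega) (chainOf_gap hM hi' y₁ hy₁) g1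
            exact ⟨i, hwalkgap i hi' y₁ hy₁ x₂ hx₂ (by omega)
              (fun c h1 h2 => ⟨by omega, by omega⟩) g2,
              fun h => chainOf_gap hM hi' y₂ hy₂ ⟨hy₂i i hi', h⟩⟩
          rw [if_pos hgap]
          exact mem_between.2 ⟨l1, l2⟩
        · right
          have l1 := lt_iff_ht_lt hM hbq (mem_chainOf_insert hM hx₂) hqm (by omega)
          have l2 := lt_iff_ht_lt hM hbq hqm (mem_chainOf_insert hM hy₂) (by omega)
          have hgap : Gap x₁ y₁ := by
            refine ⟨i, hx₁i i hi', fun h => ?_⟩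
            have g0 : i ∉ y₁.F := fun h' => chainOf_gap hM hi' y₁ hy₁ ⟨h', h⟩
            have g1 := hwalkgap i hi' y₁ hy₁ x₂ hx₂ (by omega)
              (fun c h1 h2 => ⟨by omega, by omega⟩) g0
            have g2 := notMem_F_of_step hE l1.le (by omega) hiq g1
            exact notMem_F_of_step hE l2.le (by omega) (chainOf_gap hM hi' y₂ hy₂) g2
              (hy₂i i hi')
          rw [if_pos hgap]
          exact mem_between.2 ⟨l1, l2⟩
      · have hy₁x₂ : y₁ ≤ x₂ := by
          rcases eq_or_lt_of_le (show y₁.ht ≤ x₂.ht by omega) with h | h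
          · rw [eq_of_ht_eq hE hch hy₁ hx₂ h]
          · exact le_of_ht_lt hE hch hy₁ hx₂ h
        rintro (hq | hq)
        · split_ifs at hq with hgap
          · obtain ⟨i, h1, h2⟩ := hgap
            exact ⟨Finset.mem_univ _, isBiflag_insert_of_between hM hτ hx₁ hy₁ hcons₁ hq
              (gap_of_notMem hM hτ hx₂ hy₂ hcons₂ h1 h2)
              fun h => h1 (((mem_between.1 hq).2.le.trans hy₁x₂).1 h.1)⟩
          · exact absurd hq (Finset.notMem_empty _)
        · split_ifs at hq with hgap
          · obtain ⟨i, h1, h2⟩ := hgap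
            exact ⟨Finset.mem_univ _, isBiflag_insert_of_between hM hτ hx₂ hy₂ hcons₂ hq
              (gap_of_notMem hM hτ hx₁ hy₁ hcons₁ h1 h2)
              fun h => h2 ((hy₁x₂.trans (mem_between.1 hq).1.le).2 h.2)⟩
          · exact absurd hq (Finset.notMem_empty _)
    have hdisj : Disjoint (if Gap x₂ y₂ then between hE x₁ y₁ else ∅)
        (if Gap x₁ y₁ then between hE x₂ y₂ else ∅) := by
      rw [Finset.disjoint_left]
      intro q hq hq'
      split_ifs at hq hq'
      · have h1 := ht_lt hE (mem_between.1 hq).2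
        have h2 := ht_lt hE (mem_between.1 hq').1
        omega
      all_goals simp_all
    rw [hset, Finset.sum_union hdisj]
    have s1 := sum_between_of_ht hM ha hb x₁ y₁ (le_of_ht_lt hE hch hx₁ hy₁ (by omega)) (by omega)
      (hval _ hx₁) (hval _ hy₁)
    have s2 := sum_between_of_ht hM ha hb x₂ y₂ (le_of_ht_lt hE hch hx₂ hy₂ (by omega)) (by omega)
      (hval _ hx₂) (hval _ hy₂)
    -- With two gaps the sums over the two steps cancel, because `a` is zero on `x₁.F` and `y₂.F`
    -- and agrees on `y₁.F` and `x₂.F`. With one gap only the other step is filled, and its sum is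
    -- zero.
    by_cases g1 : Gap x₁ y₁ <;> by_cases g2 : Gap x₂ y₂
    · rw [if_pos g1] at s1
      rw [if_pos g2] at s2
      rw [if_pos g1, if_pos g2, s1, s2]
      linarith
    · rw [if_neg g2] at s2
      rw [if_pos g1, if_neg g2, s2, Finset.sum_empty, add_zero]
    · rw [if_neg g1] at s1
      rw [if_neg g1, if_pos g2, s1, Finset.sum_empty, add_zero]
    · rw [if_neg g1, if_neg g2, Finset.sum_empty, add_zero]

end Main

end FlatPair

/-- Only a cone with `n - 2` rays has adjacent cones of nonzero weight. -/
theorem isWeight_topWeight (hM : IsGood M r) :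
    (conormalFan M hM.ground).IsWeight (topWeight M) := by
  refine ⟨fun τ h => if_neg fun h' => h h'.1, fun τ hτ l hl h0 => ?_⟩
  obtain ⟨a, b, ha, hb, hl⟩ := hl
  unfold FanData.bal
  by_cases hc : τ.card + 2 = n
  · have h1 : ∀ q, FanData.adj (topWeight M) τ q * l q
        = if q ∉ τ ∧ IsBiflag M (insert q τ) then sumOn a q.F + sumOn b q.G else 0 := by
      intro q
      by_cases hq : q ∈ τ
      · rw [FanData.adj_of_mem hq, if_neg fun h => h.1 hq, zero_mul]
      · rw [FanData.adj_of_notMem hq, topWeight, Finset.card_insert_of_notMem hq, hl]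
        have : τ.card + 1 = n - 1 := by omega
        by_cases hb : IsBiflag M (insert q τ) <;> simp [hq, hb, this]
    rw [Finset.sum_congr rfl fun q _ => h1 q, ← Finset.sum_filter]
    exact FlatPair.sum_fill_eq_zero hM hτ hc ha hb fun p hp => by rw [← hl]; exact h0 p hp
  · refine Finset.sum_eq_zero fun q _ => ?_
    by_cases hq : q ∈ τ
    · rw [FanData.adj_of_mem hq, zero_mul]
    · rw [FanData.adj_of_notMem hq, topWeight, if_neg, zero_mul]
      rw [Finset.card_insert_of_notMem hq]
      omega

/-- The degree map exists and is unique. -/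
theorem existsUnique_degreeMap (hM : IsGood M r) :
    ∃! deg : chowPiece M (n - 1) →ₗ[ℝ] ℝ, IsDegreeMap M deg := by
  obtain ⟨deg, h⟩ := exists_degreeMap hM.ground (isWeight_topWeight hM)
  exact ⟨deg, h, fun deg' h' => degreeMap_unique hM.ground h' h⟩

end Balance

/-! ### Fundamental circuits and the intervals of the broken circuit complex -/

section BrokenCircuit

variable {M : Matroid (Fin (n + 1))}

theorem mem_fundCircuit_iff {B : Set (Fin (n + 1))} (hE : M.E = Set.univ) (hB : M.IsBase B)
    {e f : Fin (n + 1)} (he : e ∉ B) (hf : f ∈ B) :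
    f ∈ M.fundCircuit e B ↔ e ∉ M.closure (B \ {f}) := by
  have hne : f ≠ e := fun h => he (h ▸ hf)
  rw [hB.indep.mem_fundCircuit_iff (by rw [hB.closure_eq, hE]; trivial) he,
    (hB.indep.sdiff {f}).notMem_closure_iff_of_notMem (fun h => he h.1) (by rw [hE]; trivial),
    Set.insert_sdiff_singleton_comm hne.symm]

theorem fundCocircuit_eq {B : Set (Fin (n + 1))} (hE : M.E = Set.univ) (hB : M.IsBase B)
    {f : Fin (n + 1)} (hf : f ∈ B) : M.fundCocircuit f B = (M.closure (B \ {f}))ᶜ := by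
  ext e
  rw [Set.mem_compl_iff]
  by_cases he : e ∈ B
  · by_cases hef : e = f
    · subst hef
      exact iff_of_true (M.mem_fundCocircuit _ _) (hB.indep.notMem_closure_sdiff_of_mem hf)
    · refine iff_of_false (fun h => ?_) (not_not.2 (M.mem_closure_of_mem' ⟨he, hef⟩
        (by rw [hE]; trivial)))
      have : e ∈ M.fundCocircuit f B ∩ B := ⟨h, he⟩
      rw [M.fundCocircuit_inter_eq hf] at this
      exact hef this
  · rw [hB.mem_fundCocircuit_iff_mem_fundCircuit, mem_fundCircuit_iff hE hB he hf]

theorem fundCircuit_eq {B : Set (Fin (n + 1))} (hE : M.E = Set.univ) (hB : M.IsBase B)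
    {e : Fin (n + 1)} (he : e ∉ B) : M.fundCircuit e B = (M✶.closure (Bᶜ \ {e}))ᶜ := by
  have h := fundCocircuit_eq (M := M✶) (by simpa using hE) hB.compl_isBase_dual
    (f := e) ⟨by rw [hE]; trivial, he⟩
  simpa [Matroid.fundCocircuit, hE, ← Set.compl_eq_univ_sdiff] using h

theorem mem_extActive {B : Finset (Fin (n + 1))} {e : Fin (n + 1)} :
    e ∈ extActive M B ↔ e ∉ B ∧ ∀ f ∈ M.fundCircuit e B, e ≤ f := by
  rw [extActive, Finset.mem_filter_univ]
  exact and_congr_right fun _ => and_iff_right (M.mem_fundCircuit e _)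

theorem mem_intActive (hE : M.E = Set.univ) {B : Finset (Fin (n + 1))}
    (hB : M.IsBase (B : Set (Fin (n + 1)))) {e : Fin (n + 1)} :
    e ∈ intActive M B ↔ e ∈ B ∧ ∀ f ∉ M.closure ((B : Set (Fin (n + 1))) \ {e}), e ≤ f := by
  rw [intActive, Finset.mem_filter_univ]
  refine and_congr_right fun h => (and_iff_right (M.mem_fundCocircuit e _)).trans ?_
  rw [fundCocircuit_eq hE hB h]
  rfl

theorem mem_brokenCircuitComplex {I : Finset (Fin (n + 1))} :
    I ∈ brokenCircuitComplex M ↔ ∀ (C : Set (Fin (n + 1))) (m : Fin (n + 1)), M.IsCircuit C →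
      IsLeast C m → ¬ (C \ {m} ⊆ (I : Set (Fin (n + 1)))) := by
  simp [brokenCircuitComplex]

theorem mem_brokenCircuitComplex_mono {I J : Finset (Fin (n + 1))} (h : I ⊆ J)
    (hJ : J ∈ brokenCircuitComplex M) : I ∈ brokenCircuitComplex M :=
  mem_brokenCircuitComplex.2 fun C m hC hm hs =>
    mem_brokenCircuitComplex.1 hJ C m hC hm (hs.trans (Finset.coe_subset.2 h))

theorem exists_isLeast {C : Set (Fin (n + 1))} (h : C.Nonempty) : ∃ m, IsLeast C m :=
  ⟨_, h.csInf_mem C.toFinite, fun _ hx => csInf_le C.toFinite.bddBelow hx⟩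

theorem indep_of_mem_brokenCircuitComplex (hE : M.E = Set.univ) {I : Finset (Fin (n + 1))}
    (h : I ∈ brokenCircuitComplex M) : M.Indep (I : Set (Fin (n + 1))) := by
  by_contra hI
  obtain ⟨C, hCI, hC⟩ := (Matroid.not_indep_iff (by rw [hE]; exact Set.subset_univ _)).1
    hI |>.exists_isCircuit_subset
  obtain ⟨m, hm⟩ := exists_isLeast hC.nonempty
  exact mem_brokenCircuitComplex.1 h C m hC hm (Set.sdiff_subset.trans hCI)

theorem base_mem_brokenCircuitComplex_iff (hE : M.E = Set.univ) {B : Finset (Fin (n + 1))}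
    (hB : M.IsBase (B : Set (Fin (n + 1)))) :
    B ∈ brokenCircuitComplex M ↔ extActive M B = ∅ := by
  rw [mem_brokenCircuitComplex, Finset.eq_empty_iff_forall_notMem]
  constructor
  · intro h e he
    have he' := mem_extActive.1 he
    refine h _ e (hB.fundCircuit_isCircuit (by rw [hE]; trivial) (by simpa using he'.1))
      ⟨M.mem_fundCircuit _ _, he'.2⟩ ?_
    rintro x ⟨hx, hxe⟩
    exact (M.fundCircuit_subset_insert e B hx).resolve_left hxe
  · intro h C m hC hm hs
    have hCs : C ⊆ insert m (B : Set (Fin (n + 1))) := fun x hx => by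
      by_cases hxm : x = m
      · exact Or.inl hxm
      · exact Or.inr (hs ⟨hx, hxm⟩)
    have hmB : m ∉ B := fun hmB => hC.not_indep (hB.indep.subset
      (hCs.trans (Set.insert_subset (Finset.mem_coe.2 hmB) le_rfl)))
    rw [hC.eq_fundCircuit_of_subset hB.indep hCs] at hm
    exact h m (mem_extActive.2 ⟨hmB, hm.2⟩)

/-- A face `I` of the broken circuit complex lies in the interval of the basis containing `I` whose
elements have the smallest sum. -/
theorem exists_base_interval (hE : M.E = Set.univ) {I : Finset (Fin (n + 1))}
    (hI : I ∈ brokenCircuitComplex M) :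
    ∃ B : Finset (Fin (n + 1)), IsNbcBasis M B ∧ B \ intActive M B ⊆ I ∧ I ⊆ B := by
  have hne : (Finset.univ.filter fun B : Finset (Fin (n + 1)) =>
      M.IsBase (B : Set (Fin (n + 1))) ∧ I ⊆ B).Nonempty := by
    obtain ⟨B, hB, hIB⟩ := (indep_of_mem_brokenCircuitComplex hE hI).exists_isBase_superset
    exact ⟨B.toFinset, Finset.mem_filter.2 ⟨Finset.mem_univ _, by rwa [Set.coe_toFinset],
      by rwa [← Finset.coe_subset, Set.coe_toFinset]⟩⟩
  obtain ⟨B, hB, hmin⟩ := Finset.exists_min_image _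
    (fun B : Finset (Fin (n + 1)) => ∑ i ∈ B, (i : ℕ)) hne
  rw [Finset.mem_filter] at hB
  obtain ⟨-, hB, hIB⟩ := hB
  -- Exchanging `f` for `e` gives another basis containing `I`, so minimality of the sum forbids `e
  -- < f`.
  have key : ∀ e f, e ∉ B → f ∈ B → f ∉ I → e ∉ M.closure ((B : Set (Fin (n + 1))) \ {f}) →
      f < e := by
    intro e f he hf hfI hcl
    have hB' := hB.exchange_base_of_notMem_closure (Finset.mem_coe.2 hf) hcl (by rw [hE]; trivial)
    have h1 := hmin (insert e (B.erase f)) (Finset.mem_filter.2 ⟨Finset.mem_univ _,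
      by simpa using hB', fun x hx => Finset.mem_insert_of_mem (Finset.mem_erase.2
        ⟨fun h => hfI (h ▸ hx), hIB hx⟩)⟩)
    rw [Finset.sum_insert (fun h => he (Finset.mem_of_mem_erase h)), ← Finset.add_sum_erase B _ hf]
      at h1
    have h2 : (f : ℕ) ≤ e := by omega
    exact lt_of_le_of_ne h2 fun h => he (h ▸ hf)
  refine ⟨B, ⟨hB, Finset.eq_empty_of_forall_notMem fun e he => ?_⟩, fun f hf => ?_, hIB⟩
  · obtain ⟨heB, hmin⟩ := mem_extActive.1 he
    have heB' : e ∉ (B : Set (Fin (n + 1))) := by simpa using heB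
    have hC := hB.fundCircuit_isCircuit (by rw [hE]; trivial) heB'
    obtain ⟨f, ⟨hf, hfe⟩, hfI⟩ := Set.not_subset.1 (mem_brokenCircuitComplex.1 hI _ e hC
      ⟨M.mem_fundCircuit _ _, hmin⟩)
    have hfB : f ∈ (B : Set (Fin (n + 1))) :=
      (M.fundCircuit_subset_insert e B hf).resolve_left hfe
    exact absurd (key e f heB hfB hfI ((mem_fundCircuit_iff hE hB heB' hfB).1 hf))
      (not_lt.2 (hmin f hf))
  · by_contra hfI
    rw [Finset.mem_sdiff, mem_intActive hE hB] at hf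
    refine hf.2 ⟨hf.1, fun e he => ?_⟩
    by_cases heB : e ∈ B
    · by_contra hcon
      exact he (M.mem_closure_of_mem' ⟨heB, fun h => hcon (le_of_eq h.symm)⟩ (by rw [hE]; trivial))
    · exact (key e f heB hf.1 hfI he).le

/-- For `f ∈ B' \ B` the fundamental circuit of `f` in `B` has an element `c` outside `B'`. Since `c
∉ I`, it is internally active in `B`, hence `c < f`. So each element of the symmetric difference has
a smaller one, which is impossible for the least. -/
theorem base_interval_unique (hE : M.E = Set.univ) {I B B' : Finset (Fin (n + 1))}
    (hB : M.IsBase (B : Set (Fin (n + 1)))) (hB' : M.IsBase (B' : Set (Fin (n + 1))))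
    (h1 : B \ intActive M B ⊆ I) (h2 : I ⊆ B) (h1' : B' \ intActive M B' ⊆ I) (h2' : I ⊆ B') :
    B = B' := by
  have key : ∀ {B B' : Finset (Fin (n + 1))}, M.IsBase (B : Set (Fin (n + 1))) →
      M.IsBase (B' : Set (Fin (n + 1))) → B \ intActive M B ⊆ I → I ⊆ B' →
      ∀ f ∈ B', f ∉ B → ∃ c, c < f ∧ c ∈ B ∧ c ∉ B' := by
    intro B B' hB hB' h1 h2' f hf' hf
    have hf0 : f ∉ (B : Set (Fin (n + 1))) := by simpa using hf
    have hC := hB.fundCircuit_isCircuit (by rw [hE]; trivial) hf0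
    obtain ⟨c, hc, hcB'⟩ := Set.not_subset.1 fun hs => hC.not_indep (hB'.indep.subset hs)
    have hcf : c ≠ f := fun h => hcB' (h ▸ hf')
    have hcB : c ∈ (B : Set (Fin (n + 1))) := (M.fundCircuit_subset_insert f B hc).resolve_left hcf
    have hcI : c ∈ intActive M B := by
      by_contra hcon
      exact hcB' (h2' (h1 (Finset.mem_sdiff.2 ⟨hcB, hcon⟩)))
    exact ⟨c, lt_of_le_of_ne (((mem_intActive hE hB).1 hcI).2 f
      ((mem_fundCircuit_iff hE hB hf0 hcB).1 hc)) hcf, hcB, hcB'⟩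
  by_contra hne
  have hne' : (symmDiff B B').Nonempty := by
    rw [Finset.nonempty_iff_ne_empty]
    intro h
    exact hne (symmDiff_eq_bot.1 h)
  have hm := Finset.min'_mem _ hne'
  have hmin := fun x hx => Finset.min'_le (symmDiff B B') x hx
  rw [Finset.mem_symmDiff] at hm
  rcases hm with ⟨h, h'⟩ | ⟨h, h'⟩
  · obtain ⟨c, hc, hcB, hcB'⟩ := key hB' hB h1' h2 _ h h'
    exact absurd hc (not_lt.2 (hmin c (Finset.mem_symmDiff.2 (Or.inr ⟨hcB, hcB'⟩))))
  · obtain ⟨c, hc, hcB, hcB'⟩ := key hB hB' h1 h2' _ h h'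
    exact absurd hc (not_lt.2 (hmin c (Finset.mem_symmDiff.2 (Or.inl ⟨hcB, hcB'⟩))))

theorem card_base (hM : IsGood M r) {B : Finset (Fin (n + 1))}
    (hB : M.IsBase (B : Set (Fin (n + 1)))) : B.card = r + 1 := by
  have h := rk_of_indep hB.indep
  rw [← rk_closure, hB.closure_eq, hM.ground, hM.rk_univ, Set.ncard_coe_finset] at h
  exact h.symm

theorem maxFace_brokenCircuitComplex (hM : IsGood M r) :
    maxFace (brokenCircuitComplex M) = r + 1 := by
  have hE := hM.ground
  refine le_antisymm (Finset.sup_le fun I hI => ?_) ?_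
  · have h := rk_of_indep (indep_of_mem_brokenCircuitComplex hE hI)
    rw [Set.ncard_coe_finset] at h
    rw [← h, ← hM.rk_univ]
    exact rk_mono (Set.subset_univ _)
  · have h0 : (∅ : Finset (Fin (n + 1))) ∈ brokenCircuitComplex M := by
      refine mem_brokenCircuitComplex.2 fun C m hC hm hs => ?_
      have hCm : C = {m} := by
        ext x
        refine ⟨fun hx => ?_, fun hx => hx ▸ hm.1⟩
        by_contra hxm
        simpa using hs ⟨hx, hxm⟩
      have := hC.mem_closure_sdiff_singleton_of_mem hm.1
      rw [hCm, Set.sdiff_self] at this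
      exact hM.loopless m this
    obtain ⟨B, ⟨hB, hBn⟩, -, -⟩ := exists_base_interval hE h0
    rw [← card_base hM hB]
    exact Finset.le_sup (f := Finset.card) ((base_mem_brokenCircuitComplex_iff hE hB).2 hBn)

/-- The partition of the complex into intervals, with `J` the set of active elements removed from
`B`. -/
theorem sum_brokenCircuitComplex (hM : IsGood M r) (g : Finset (Fin (n + 1)) → Polynomial ℤ) :
    ∑ I ∈ brokenCircuitComplex M, g I = ∑ B : Finset (Fin (n + 1)) with IsNbcBasis M B,
      ∑ J ∈ (intActive M B).powerset, g (B \ J) := by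
  have hE := hM.ground
  rw [Finset.sum_sigma']
  refine (Finset.sum_bij (fun (x : (_ : Finset (Fin (n + 1))) × Finset (Fin (n + 1))) _ =>
    x.1 \ x.2) ?_ ?_ ?_ fun _ _ => rfl).symm
  all_goals simp only [Finset.mem_sigma, Finset.mem_filter, Finset.mem_univ, true_and,
    Finset.mem_powerset]
  · rintro ⟨B, J⟩ ⟨⟨hB, hBn⟩, hJ⟩
    exact mem_brokenCircuitComplex_mono Finset.sdiff_subset
      ((base_mem_brokenCircuitComplex_iff hE hB).2 hBn)
  · rintro ⟨B, J⟩ ⟨⟨hB, hBn⟩, hJ⟩ ⟨B', J'⟩ ⟨⟨hB', hBn'⟩, hJ'⟩ h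
    simp only at h hJ hJ'
    have hb := base_interval_unique hE hB hB' (Finset.sdiff_subset_sdiff le_rfl hJ)
      Finset.sdiff_subset (h ▸ Finset.sdiff_subset_sdiff le_rfl hJ') (h ▸ Finset.sdiff_subset)
    subst hb
    have hsub : ∀ {J}, J ⊆ intActive M B → J ⊆ B := fun hJ =>
      hJ.trans fun x hx => ((mem_intActive hE hB).1 hx).1
    have : J = J' := by
      rw [← Finset.sdiff_sdiff_eq_self (hsub hJ), h, Finset.sdiff_sdiff_eq_self (hsub hJ')]
    rw [this]
  · intro I hI
    obtain ⟨B, hB, h1, h2⟩ := exists_base_interval hE hI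
    refine ⟨⟨B, B \ I⟩, ⟨hB, fun x hx => ?_⟩, Finset.sdiff_sdiff_eq_self h2⟩
    rw [Finset.mem_sdiff] at hx
    by_contra hcon
    exact hx.2 (h1 (Finset.mem_sdiff.2 ⟨hx.1, hcon⟩))

/-- A face `B \ J` has codimension `|J|`, so the interval of `B` contributes `∑ q^{|J|}` over the
subsets `J` of `IA(B)`. -/
theorem fPoly_brokenCircuitComplex (hM : IsGood M r) :
    fPoly (brokenCircuitComplex M) = ∑ B : Finset (Fin (n + 1)) with IsNbcBasis M B,
      (Polynomial.X + 1) ^ (intActive M B).card := by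
  have hE := hM.ground
  have h1 : fPoly (brokenCircuitComplex M) = ∑ I ∈ brokenCircuitComplex M,
      Polynomial.X ^ (maxFace (brokenCircuitComplex M) - I.card) := by
    unfold fPoly
    rw [← Finset.sum_fiberwise_of_maps_to (s := brokenCircuitComplex M)
      (t := Finset.range (maxFace (brokenCircuitComplex M) + 1)) (g := Finset.card)]
    · refine Finset.sum_congr rfl fun i _ => ?_
      rw [Finset.sum_congr rfl fun I hI => by rw [(Finset.mem_filter.1 hI).2], Finset.sum_const,
        nsmul_eq_mul]
      simp [fVec]
    · exact fun I hI => Finset.mem_range.2 (Nat.lt_succ_of_le (Finset.le_sup (f := Finset.card) hI))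
  rw [h1, sum_brokenCircuitComplex hM, maxFace_brokenCircuitComplex hM]
  refine Finset.sum_congr rfl fun B hB => ?_
  have hB' := (Finset.mem_filter.1 hB).2.1
  rw [← Finset.sum_pow_mul_eq_add_pow]
  refine Finset.sum_congr rfl fun J hJ => ?_
  have hJB : J ⊆ B := (Finset.mem_powerset.1 hJ).trans fun x hx => ((mem_intActive hE hB').1 hx).1
  have := Finset.card_le_card hJB
  rw [Finset.card_sdiff_of_subset hJB, one_pow, mul_one, card_base hM hB'] at *
  congr 1
  omega

theorem hVec_brokenCircuitComplex (hM : IsGood M r) {k : ℕ} (hk : k ≤ r) :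
    hVec (brokenCircuitComplex M) (r - k) = ((nbcBases M (k + 1)).card : ℤ) := by
  unfold hVec
  have h : r + 1 - (r - k) = k + 1 := by omega
  rw [maxFace_brokenCircuitComplex hM, h, fPoly_brokenCircuitComplex hM, Polynomial.sum_comp]
  simp only [Polynomial.pow_comp, Polynomial.add_comp, Polynomial.X_comp, Polynomial.one_comp,
    sub_add_cancel, Polynomial.finsetSum_coeff, Polynomial.coeff_X_pow]
  rw [Finset.sum_boole, Finset.filter_filter]
  simp only [eq_comm (a := k + 1)]
  rfl

end BrokenCircuit

/-! ### The sets `S` and `T` of an nbc basis -/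

section NbcBasis

variable {M : Matroid (Fin (n + 1))}

/-- Both sides say that `e` and `f` can be exchanged: `f` is in the fundamental circuit of `e` if
and only if `e` is in the fundamental cocircuit of `f`. -/
theorem notMem_closure_iff_dual (hE : M.E = Set.univ) {B : Set (Fin (n + 1))} (hB : M.IsBase B)
    {e f : Fin (n + 1)} (he : e ∉ B) (hf : f ∈ B) :
    e ∉ M.closure (B \ {f}) ↔ f ∉ M✶.closure (Bᶜ \ {e}) := by
  rw [← mem_fundCircuit_iff hE hB he hf, fundCircuit_eq hE hB he, Set.mem_compl_iff]

theorem isBase_compl (hE : M.E = Set.univ) {B : Set (Fin (n + 1))} (hB : M.IsBase B) :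
    M✶.IsBase Bᶜ := by
  have := hB.compl_isBase_dual
  rwa [hE, ← Set.compl_eq_univ_sdiff] at this

/-- An element outside a basis lies in the closure of the rest of its fundamental circuit. -/
theorem mem_closure_of_exchange (hE : M.E = Set.univ) {B : Set (Fin (n + 1))} (hB : M.IsBase B)
    {e : Fin (n + 1)} (he : e ∉ B) {Y : Set (Fin (n + 1))}
    (h : ∀ f ∈ B, e ∉ M.closure (B \ {f}) → f ∈ M.closure Y) : e ∈ M.closure Y := by
  have hC := hB.fundCircuit_isCircuit (by rw [hE]; trivial) he
  have := hC.mem_closure_sdiff_singleton_of_mem (M.mem_fundCircuit e B)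
  refine M.closure_subset_closure_of_subset_closure ?_ this
  rintro f ⟨hf, hfe⟩
  have hfB := (M.fundCircuit_subset_insert e B hf).resolve_left hfe
  exact h f hfB ((mem_fundCircuit_iff hE hB he hfB).1 hf)

theorem mem_dual_closure_of_exchange (hE : M.E = Set.univ) {B : Set (Fin (n + 1))}
    (hB : M.IsBase B) {f : Fin (n + 1)} (hf : f ∈ B) {Y : Set (Fin (n + 1))}
    (h : ∀ e ∉ B, e ∉ M.closure (B \ {f}) → e ∈ M✶.closure Y) : f ∈ M✶.closure Y :=
  mem_closure_of_exchange (by simpa using hE) (isBase_compl hE hB) (not_not.2 hf) fun e he hfe =>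
    h e he ((notMem_closure_iff_dual hE hB he hf).2 hfe)

theorem mem_intActive_iff (hE : M.E = Set.univ) {B : Finset (Fin (n + 1))}
    (hB : M.IsBase (B : Set (Fin (n + 1)))) {f : Fin (n + 1)} :
    f ∈ intActive M B ↔ f ∈ B ∧ ∀ e ∉ B, e ∉ M.closure ((B : Set (Fin (n + 1))) \ {f}) → f < e := by
  rw [mem_intActive hE hB]
  refine and_congr_right fun hf => ⟨fun h e he hcl =>
    lt_of_le_of_ne (h e hcl) fun h' => he (h' ▸ hf),
    fun h e hcl => ?_⟩
  by_cases he : e ∈ B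
  · by_contra hcon
    exact hcl (M.mem_closure_of_mem' ⟨he, fun h => hcon (le_of_eq h.symm)⟩ (by rw [hE]; trivial))
  · exact (h e he hcl).le

theorem extActive_eq_empty_iff (hE : M.E = Set.univ) {B : Finset (Fin (n + 1))}
    (hB : M.IsBase (B : Set (Fin (n + 1)))) :
    extActive M B = ∅ ↔
      ∀ e ∉ B, ∃ f ∈ B, e ∉ M.closure ((B : Set (Fin (n + 1))) \ {f}) ∧ f < e := by
  rw [Finset.eq_empty_iff_forall_notMem]
  refine forall_congr' fun e => ?_
  rw [mem_extActive]
  constructor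
  · intro h he
    have he' : e ∉ (B : Set (Fin (n + 1))) := by simpa using he
    by_contra hcon
    refine h ⟨he, fun f hf => ?_⟩
    rcases M.fundCircuit_subset_insert e B hf with rfl | hfB
    · exact le_rfl
    · by_contra hlt
      exact hcon ⟨f, hfB, (mem_fundCircuit_iff hE hB he' hfB).1 hf, not_le.1 hlt⟩
  · rintro h ⟨he, hmin⟩
    have he' : e ∉ (B : Set (Fin (n + 1))) := by simpa using he
    obtain ⟨f, hfB, hf, hlt⟩ := h he
    exact absurd (hmin f ((mem_fundCircuit_iff hE hB he' hfB).2 hf)) (not_le.2 hlt)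

/-- The complement of `cl(L) ∪ cl^⊥(T)`. -/
def gapSet (M : Matroid (Fin (n + 1))) (L T : Finset (Fin (n + 1))) : Set (Fin (n + 1)) :=
  (M.closure (L : Set (Fin (n + 1))) ∪ M✶.closure (T : Set (Fin (n + 1))))ᶜ

theorem mem_gapSet {L T : Finset (Fin (n + 1))} {e : Fin (n + 1)} :
    e ∈ gapSet M L T ↔ e ∉ M.closure (L : Set (Fin (n + 1))) ∧
      e ∉ M✶.closure (T : Set (Fin (n + 1))) := by
  simp [gapSet]

theorem gapSet_anti {L T L' T' : Finset (Fin (n + 1))} (hL : L ⊆ L') (hT : T ⊆ T') :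
    gapSet M L' T' ⊆ gapSet M L T := fun e he => by
  rw [mem_gapSet] at he ⊢
  exact ⟨fun h => he.1 (M.closure_subset_closure (Finset.coe_subset.2 hL) h),
    fun h => he.2 (M✶.closure_subset_closure (Finset.coe_subset.2 hT) h)⟩

/-- The elements of `L` above `e`. -/
def above (L : Finset (Fin (n + 1))) (e : Fin (n + 1)) : Finset (Fin (n + 1)) :=
  L.filter fun x => e < x

theorem mem_above {L : Finset (Fin (n + 1))} {e x : Fin (n + 1)} :
    x ∈ above L e ↔ x ∈ L ∧ e < x := Finset.mem_filter

theorem above_subset (L : Finset (Fin (n + 1))) (e : Fin (n + 1)) : above L e ⊆ L :=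
  Finset.filter_subset _ _

/-- `L` and `T` are disjoint, leave a gap, and each element of `L ∪ T` is the greatest element of
the gap left by the elements above it. -/
structure IsGreedy (M : Matroid (Fin (n + 1))) (L T : Finset (Fin (n + 1))) : Prop where
  disjoint : Disjoint L T
  nonempty : (gapSet M L T).Nonempty
  isGreatest : ∀ e, e ∈ L ∨ e ∈ T → IsGreatest (gapSet M (above L e) (above T e)) e

theorem self_mem_closure (hE : M.E = Set.univ) {X : Finset (Fin (n + 1))} {x : Fin (n + 1)}
    (h : x ∈ X) : x ∈ M.closure (X : Set (Fin (n + 1))) :=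
  M.mem_closure_of_mem' (Finset.mem_coe.2 h) (by rw [hE]; trivial)

theorem IsGreedy.lt_of_mem_gapSet (hE : M.E = Set.univ) {L T : Finset (Fin (n + 1))}
    (h : IsGreedy M L T) {e g : Fin (n + 1)} (he : e ∈ L ∨ e ∈ T) (hg : g ∈ gapSet M L T) :
    g < e := by
  refine lt_of_le_of_ne ((h.isGreatest e he).2
    (gapSet_anti (above_subset _ _) (above_subset _ _) hg))
    ?_
  rintro rfl
  rw [mem_gapSet] at hg
  rcases he with he | he
  · exact hg.1 (self_mem_closure hE he)
  · exact hg.2 (self_mem_closure (by simpa using hE) he)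

variable {B : Finset (Fin (n + 1))}

/-- `z` is the least element outside of `B`. -/
theorem setT_eq {z : Fin (n + 1)} (hz : IsLeast ((B : Set (Fin (n + 1)))ᶜ) z) :
    setT B = Bᶜ.erase z := by
  ext e
  have hzB : z ∉ B := by simpa using hz.1
  simp only [setT, Finset.mem_filter, Finset.mem_compl, Finset.mem_erase]
  constructor
  · rintro ⟨he, m, hm, hlt⟩
    refine ⟨?_, he⟩
    rintro rfl
    exact absurd (hz.2 (by simpa using hm)) (not_le.2 hlt)
  · rintro ⟨hne, he⟩
    exact ⟨he, z, hzB, lt_of_le_of_ne (hz.2 (by simpa using he)) (Ne.symm hne)⟩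

theorem exists_isLeast_compl (hM : IsGood M r) (hB : M.IsBase (B : Set (Fin (n + 1)))) :
    ∃ z, IsLeast ((B : Set (Fin (n + 1)))ᶜ) z := by
  refine exists_isLeast (Set.nonempty_compl.2 fun h => ?_)
  have h1 := card_base hM hB
  have h2 := hM.r_lt
  rw [Finset.coe_eq_univ] at h
  rw [h, Finset.card_univ, Fintype.card_fin] at h1
  omega

/-- An element of `B` below `z` precedes everything outside `B`, so it is internally active. -/
theorem IsNbcBasis.lt_of_mem_setS (hE : M.E = Set.univ) (hB : IsNbcBasis M B) {z e : Fin (n + 1)}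
    (hz : IsLeast ((B : Set (Fin (n + 1)))ᶜ) z) (he : e ∈ setS M B) : z < e := by
  rw [setS, Finset.mem_sdiff, mem_intActive_iff hE hB.1] at he
  by_contra hcon
  refine he.2 ⟨he.1, fun f hf _ => lt_of_lt_of_le (lt_of_le_of_ne (not_lt.1 hcon) ?_)
    (hz.2 (by simpa using hf))⟩
  rintro rfl
  exact hz.1 he.1

theorem setS_subset : setS M B ⊆ B := Finset.sdiff_subset

theorem coe_setT_eq {z : Fin (n + 1)} (hz : IsLeast ((B : Set (Fin (n + 1)))ᶜ) z) :
    (setT B : Set (Fin (n + 1))) = (B : Set (Fin (n + 1)))ᶜ \ {z} := by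
  rw [setT_eq hz]
  simp

/-- An internally active element of `B` lies in `cl^⊥` of the elements of `B^⊥` above it. -/
theorem mem_dual_closure_of_mem_intActive (hE : M.E = Set.univ)
    (hB : M.IsBase (B : Set (Fin (n + 1)))) {g : Fin (n + 1)} (hg : g ∈ intActive M B)
    {Y : Set (Fin (n + 1))} (hY : ∀ f ∉ B, g < f → f ∈ Y) : g ∈ M✶.closure Y := by
  rw [mem_intActive_iff hE hB] at hg
  exact mem_dual_closure_of_exchange hE hB (Finset.mem_coe.2 hg.1) fun f hf hcl =>
    M✶.mem_closure_of_mem' (hY f hf (hg.2 f hf hcl)) (by rw [M.dual_ground, hE]; trivial)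

/-- The fundamental circuit of `z` has a smaller element, and that element is not in `S`, whose
elements exceed `z`; so `z ∉ cl(S)`. An element above `z` is in `S`, in `T`, or internally active,
and in the last case it lies in `cl^⊥(T)`. -/
theorem IsNbcBasis.isGreatest (hE : M.E = Set.univ) (hB : IsNbcBasis M B) {z : Fin (n + 1)}
    (hz : IsLeast ((B : Set (Fin (n + 1)))ᶜ) z) : IsGreatest (gapSet M (setS M B) (setT B)) z := by
  have hzB : z ∉ B := by simpa using hz.1
  constructor
  · rw [mem_gapSet]
    constructor
    · intro h
      obtain ⟨f, hfB, hf, hlt⟩ := (extActive_eq_empty_iff hE hB.1).1 hB.2 z hzB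
      refine hf (M.closure_subset_closure (fun x hx => ?_) h)
      refine ⟨setS_subset hx, ?_⟩
      rintro rfl
      exact absurd hlt (not_lt.2 (hB.lt_of_mem_setS hE hz hx).le)
    · rw [coe_setT_eq hz]
      exact (isBase_compl hE hB.1).indep.notMem_closure_sdiff_of_mem hz.1
  · intro g hg
    by_contra hcon
    rw [not_le] at hcon
    rw [mem_gapSet] at hg
    by_cases hgB : g ∈ B
    · by_cases hgS : g ∈ setS M B
      · exact hg.1 (self_mem_closure hE hgS)
      · have hgI : g ∈ intActive M B := by
          by_contra h
          exact hgS (Finset.mem_sdiff.2 ⟨hgB, h⟩)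
        refine hg.2 (mem_dual_closure_of_mem_intActive hE hB.1 hgI fun f hf hlt => ?_)
        rw [coe_setT_eq hz]
        exact ⟨hf, (hcon.trans hlt).ne'⟩
    · refine hg.2 (self_mem_closure (by simpa using hE) ?_)
      rw [setT_eq hz, Finset.mem_erase, Finset.mem_compl]
      exact ⟨hcon.ne', hgB⟩

/-- At `e ∈ S`, failure of internal activity gives an exchange partner below `e`, so `e` escapes the
dual closure of the part of `T` above it. At `e ∈ T`, failure of external activity does the same for
the closure of the part of `S` above `e`. Elements passed over on the way down are internally
active, hence already dually covered. -/
theorem IsNbcBasis.isGreedy (hM : IsGood M r) (hB : IsNbcBasis M B) :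
    IsGreedy M (setS M B) (setT B) := by
  have hE := hM.ground
  obtain ⟨z, hz⟩ := exists_isLeast_compl hM hB.1
  have hT := setT_eq hz
  refine ⟨?_, ⟨z, (hB.isGreatest hE hz).1⟩, fun e he => ?_⟩
  · rw [Finset.disjoint_left]
    intro x hx hx'
    rw [hT] at hx'
    exact Finset.mem_compl.1 (Finset.mem_of_mem_erase hx') (setS_subset hx)
  have hze : z < e := by
    rcases he with he | he
    · exact hB.lt_of_mem_setS hE hz he
    · rw [hT, Finset.mem_erase] at he
      exact lt_of_le_of_ne (hz.2 (by simpa using he.2)) he.1.symm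
  have hTc : ∀ {x}, x ∉ B → e < x → x ∈ above (setT B) e := fun {x} hx hlt => by
    rw [mem_above, hT, Finset.mem_erase, Finset.mem_compl]
    exact ⟨⟨(hze.trans hlt).ne', hx⟩, hlt⟩
  have hT' : ∀ {x}, x ∈ above (setT B) e → x ∉ B ∧ e < x := fun {x} hx => by
    rw [mem_above, hT, Finset.mem_erase, Finset.mem_compl] at hx
    exact ⟨hx.1.2, hx.2⟩
  constructor
  · rw [mem_gapSet]
    rcases he with he | he
    · have heS := he
      rw [setS, Finset.mem_sdiff, mem_intActive_iff hE hB.1] at he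
      constructor
      · refine fun h => hB.1.indep.notMem_closure_sdiff_of_mem (Finset.mem_coe.2 he.1)
          (M.closure_subset_closure (fun x hx => ?_) h)
        have := mem_above.1 (Finset.mem_coe.1 hx)
        exact ⟨setS_subset this.1, this.2.ne'⟩
      · intro h
        have : ¬ ∀ f ∉ B, f ∉ M.closure ((B : Set (Fin (n + 1))) \ {e}) → e < f :=
          fun h => he.2 ⟨he.1, h⟩
        push Not at this
        obtain ⟨f, hfB, hf, hle⟩ := this
        refine (notMem_closure_iff_dual hE hB.1 (by simpa using hfB) (Finset.mem_coe.2 he.1)).1 hf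
          (M✶.closure_subset_closure (fun x hx => ?_) h)
        have := hT' (Finset.mem_coe.1 hx)
        exact ⟨this.1, (lt_of_le_of_lt hle this.2).ne'⟩
    · have heB : e ∉ B := by
        rw [hT] at he
        exact Finset.mem_compl.1 (Finset.mem_of_mem_erase he)
      constructor
      · intro h
        obtain ⟨f, hfB, hf, hlt⟩ := (extActive_eq_empty_iff hE hB.1).1 hB.2 e heB
        refine hf (M.closure_subset_closure (fun x hx => ?_) h)
        have := mem_above.1 (Finset.mem_coe.1 hx)
        exact ⟨setS_subset this.1, (hlt.trans this.2).ne'⟩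
      · refine fun h => (isBase_compl hE hB.1).indep.notMem_closure_sdiff_of_mem (e := e)
          (by simpa using heB) (M✶.closure_subset_closure (fun x hx => ?_) h)
        have := hT' (Finset.mem_coe.1 hx)
        exact ⟨this.1, this.2.ne'⟩
  · intro g hg
    by_contra hcon
    rw [not_le] at hcon
    rw [mem_gapSet] at hg
    by_cases hgB : g ∈ B
    · by_cases hgS : g ∈ setS M B
      · exact hg.1 (self_mem_closure hE (mem_above.2 ⟨hgS, hcon⟩))
      · have hgI : g ∈ intActive M B := by
          by_contra h
          exact hgS (Finset.mem_sdiff.2 ⟨hgB, h⟩)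
        exact hg.2 (mem_dual_closure_of_mem_intActive hE hB.1 hgI fun f hf hlt =>
          Finset.mem_coe.2 (hTc hf (hcon.trans hlt)))
    · exact hg.2 (self_mem_closure (by simpa using hE) (hTc hgB hcon))

theorem card_setS (hM : IsGood M r) (hB : M.IsBase (B : Set (Fin (n + 1)))) :
    (setS M B).card + (intActive M B).card = r + 1 := by
  rw [setS, Finset.card_sdiff_add_card_eq_card, card_base hM hB]
  exact fun x hx => ((mem_intActive_iff hM.ground hB).1 hx).1

theorem card_setT (hM : IsGood M r) (hB : M.IsBase (B : Set (Fin (n + 1)))) :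
    (setT B).card + r + 1 = n := by
  obtain ⟨z, hz⟩ := exists_isLeast_compl hM hB
  have h1 := card_base hM hB
  have h2 := Finset.card_compl_add_card B
  rw [Fintype.card_fin] at h2
  rw [setT_eq hz, Finset.card_erase_of_mem (by simpa using hz.1)]
  have : 0 < Bᶜ.card := Finset.card_pos.2 ⟨z, by simpa using hz.1⟩
  omega

/-- A greedy pair of the right size comes from an nbc basis. -/
theorem IsGreedy.exists_nbcBasis (hM : IsGood M r) {L T : Finset (Fin (n + 1))}
    (h : IsGreedy M L T) (hT : M✶.Indep (T : Set (Fin (n + 1)))) (hc : T.card + r + 1 = n) :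
    ∃ B, IsNbcBasis M B ∧ setS M B = L ∧ setT B = T := by
  have hE := hM.ground
  have hE' : M✶.E = Set.univ := by simpa using hE
  obtain ⟨z, hz⟩ : ∃ z, IsGreatest (gapSet M L T) z :=
    ⟨_, h.nonempty.csSup_mem (gapSet M L T).toFinite,
      fun _ hx => le_csSup (gapSet M L T).toFinite.bddAbove hx⟩
  have hzg := mem_gapSet.1 hz.1
  have hzT : z ∉ T := fun h => hzg.2 (self_mem_closure hE' h)
  have hzL : z ∉ L := fun h => hzg.1 (self_mem_closure hE h)
  -- All of `T` lies above the gap, so `z` becomes the least element outside `B`, the one that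
  -- `setT` removes.
  set B : Finset (Fin (n + 1)) := (insert z T)ᶜ with hBdef
  have hBc : (B : Set (Fin (n + 1)))ᶜ = insert z (T : Set (Fin (n + 1))) := by
    rw [hBdef, Finset.coe_compl, compl_compl, Finset.coe_insert]
  have hmemB : ∀ {x}, x ∉ B ↔ x = z ∨ x ∈ T := by
    intro x
    rw [hBdef, Finset.mem_compl, not_not, Finset.mem_insert]
  have hLB : ∀ {x}, x ∈ L → x ∈ B := fun {x} hx => by
    by_contra hcon
    rcases hmemB.1 hcon with rfl | h'
    · exact hzL hx
    · exact Finset.disjoint_left.1 h.disjoint hx h'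
  have hind : M✶.Indep (insert z (T : Set (Fin (n + 1)))) :=
    (hT.notMem_closure_iff_of_notMem (by simpa using hzT) (by rw [hE']; trivial)).1 hzg.2
  have hbase' : M✶.IsBase (insert z (T : Set (Fin (n + 1)))) := by
    refine hind.isBase_of_ground_subset_closure ?_
    rw [hE', ← hM.dual.eq_univ_of_rk (M✶.isFlat_closure (insert z (T : Set (Fin (n + 1))))) ?_]
    rw [rk_closure, rk_of_indep hind, ← Finset.coe_insert, Set.ncard_coe_finset,
      Finset.card_insert_of_notMem hzT]
    omega
  have hB : M.IsBase (B : Set (Fin (n + 1))) := by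
    have := isBase_compl hE' hbase'
    rwa [M.dual_dual, ← hBc, compl_compl] at this
  have hzT' : ∀ {x}, x ∈ T → z < x := fun hx => h.lt_of_mem_gapSet hE (Or.inr hx) hz.1
  have hzleast : IsLeast ((B : Set (Fin (n + 1)))ᶜ) z := by
    rw [hBc]
    refine ⟨Set.mem_insert _ _, ?_⟩
    rintro x (rfl | hx)
    · exact le_rfl
    · exact (hzT' hx).le
  have hTc : ∀ {e x}, x ∈ above T e → x ∈ (B : Set (Fin (n + 1)))ᶜ \ {e} := fun {e x} hx => by
    have := mem_above.1 hx
    exact ⟨by simpa using hmemB.2 (Or.inr this.1), this.2.ne'⟩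
  have hcov : ∀ {e f}, (e ∈ L ∨ e ∈ T) → e < f →
      f ∈ M.closure (above L e : Set (Fin (n + 1))) ∨
        f ∈ M✶.closure (above T e : Set (Fin (n + 1))) := fun {e f} he hlt => by
    by_contra hcon
    rw [not_or] at hcon
    exact absurd ((h.isGreatest e he).2 (mem_gapSet.2 hcon)) (not_le.2 hlt)
  have hindL : ∀ {x}, x ∈ B → x ∉ L → x ∉ M.closure (L : Set (Fin (n + 1))) := fun {x} hx hxL hcl =>
    hB.indep.notMem_closure_sdiff_of_mem (Finset.mem_coe.2 hx) (M.closure_subset_closure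
      (Y := (B : Set (Fin (n + 1))) \ {x})
      (fun y hy => ⟨hLB hy, fun hyx : y = x => hxL (hyx ▸ hy)⟩) hcl)
  have hnbc : extActive M B = ∅ := by
    rw [extActive_eq_empty_iff hE hB]
    intro e he
    have he' : e ∉ (B : Set (Fin (n + 1))) := by simpa using he
    by_contra hcon
    push Not at hcon
    -- If `z` were externally active, each element of its circuit in `B` would exceed `z` and avoid
    -- `cl^⊥(T)`. By maximality of `z` in the gap it would lie in `cl(L)`, and then so would `z`.
    rcases hmemB.1 he with rfl | heT
    · refine hzg.1 (mem_closure_of_exchange hE hB he' fun f hf hcl => ?_)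
      have hle := hcon f hf hcl
      by_contra hfL
      have hfT := (notMem_closure_iff_dual hE hB he' hf).1 hcl
      rw [← coe_setT_eq hzleast, setT_eq hzleast] at hfT
      have hTe : Bᶜ.erase e = T := by
        rw [hBdef, compl_compl, Finset.erase_insert hzT]
      rw [hTe] at hfT
      refine absurd (hz.2 (mem_gapSet.2 ⟨hfL, hfT⟩)) (not_le.2 (lt_of_le_of_ne hle ?_))
      rintro rfl
      exact he hf
    · refine (mem_gapSet.1 (h.isGreatest e (Or.inr heT)).1).1
        (mem_closure_of_exchange hE hB he' fun f hf hcl => ?_)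
      have hle := lt_of_le_of_ne (hcon f hf hcl) fun h => he' (h ▸ hf)
      refine (hcov (Or.inr heT) hle).resolve_right fun hfT => ?_
      exact (notMem_closure_iff_dual hE hB he' hf).1 hcl
        (M✶.closure_subset_closure (fun x hx => hTc hx) hfT)
  refine ⟨B, ⟨hB, hnbc⟩, ?_, ?_⟩
  · ext x
    rw [setS, Finset.mem_sdiff]
    constructor
    · rintro ⟨hxB, hxI⟩
      by_contra hxL
      refine hxI ((mem_intActive_iff hE hB).2 ⟨hxB, fun f hf hcl => ?_⟩)
      by_contra hlt
      have hlt : f < x := lt_of_le_of_ne (not_lt.1 hlt) fun h => hf (h ▸ hxB)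
      have hx := (notMem_closure_iff_dual hE hB (by simpa using hf) (Finset.mem_coe.2 hxB)).1 hcl
      rcases hmemB.1 hf with rfl | hfT
      · refine absurd (hz.2 (mem_gapSet.2 ⟨hindL hxB hxL, fun h => hx ?_⟩)) (not_le.2 hlt)
        rwa [hBc, Set.insert_sdiff_self_of_notMem (by simpa using hzT)]
      · rcases hcov (Or.inr hfT) hlt with h' | h'
        · exact hindL hxB hxL (M.closure_subset_closure
            (Finset.coe_subset.2 (above_subset _ _)) h')
        · exact hx (M✶.closure_subset_closure (fun y hy => hTc hy) h')
    · intro hxL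
      refine ⟨hLB hxL, fun hxI => ?_⟩
      rw [mem_intActive_iff hE hB] at hxI
      refine (mem_gapSet.1 (h.isGreatest x (Or.inl hxL)).1).2
        (mem_dual_closure_of_exchange hE hB (Finset.mem_coe.2 hxI.1) fun f hf hcl => ?_)
      refine (hcov (Or.inl hxL) (hxI.2 f hf hcl)).resolve_left fun h' => hcl ?_
      refine M.closure_subset_closure (fun y hy => ?_) h'
      have := mem_above.1 (Finset.mem_coe.1 hy)
      exact ⟨hLB this.1, this.2.ne'⟩
  · rw [setT_eq hzleast, hBdef, compl_compl, Finset.erase_insert hzT]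

theorem IsNbcBasis.eq_of_setT_eq (hM : IsGood M r) {B' : Finset (Fin (n + 1))}
    (hB : IsNbcBasis M B) (hB' : IsNbcBasis M B') (hS : setS M B = setS M B')
    (hT : setT B = setT B') : B = B' := by
  have hE := hM.ground
  obtain ⟨z, hz⟩ := exists_isLeast_compl hM hB.1
  obtain ⟨z', hz'⟩ := exists_isLeast_compl hM hB'.1
  have h1 := hB.isGreatest hE hz
  rw [hS, hT] at h1
  have : z = z' := h1.unique (hB'.isGreatest hE hz')
  subst this
  rw [setT_eq hz, setT_eq hz'] at hT
  have h2 := congrArg (insert z) hT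
  rw [Finset.insert_erase (by simpa using hz.1), Finset.insert_erase (by simpa using hz'.1)] at h2
  exact compl_injective h2

end NbcBasis

/-! ### Duality -/

section Swap

variable {M : Matroid (Fin (n + 1))}

/-- The biflat `G|F` of the dual matroid. -/
def Biflat.swap (p : Biflat M) : Biflat M✶ :=
  ⟨(p.G, p.F), by
    refine ⟨p.2.flat_right, ?_, p.2.nonempty_right, p.2.nonempty_left, ?_, ?_⟩
    · rw [M.dual_dual]; exact p.2.flat_left
    · exact fun h => p.2.not_both ⟨h.2, h.1⟩
    · exact (Set.union_comm _ _).trans p.2.union_eq⟩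

@[simp] theorem Biflat.swap_G (p : Biflat M) : p.swap.G = p.F := rfl

theorem Biflat.swap_injective : Function.Injective (Biflat.swap (M := M)) := fun _ _ h =>
  biflat_ext (congrArg Biflat.G h) (congrArg Biflat.F h)

theorem Biflat.swap_le_swap {p q : Biflat M} : p.swap ≤ q.swap ↔ q ≤ p :=
  ⟨fun h => ⟨h.2, h.1⟩, fun h => ⟨h.2, h.1⟩⟩

theorem Biflat.swap_lt_swap {p q : Biflat M} : p.swap < q.swap ↔ q < p := by
  rw [lt_iff_le_not_ge, lt_iff_le_not_ge, swap_le_swap, swap_le_swap]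

theorem IsBiflag.swap (hE : M.E = Set.univ) {S : Finset (Biflat M)} (h : IsBiflag M S) :
    IsBiflag M✶ (S.image Biflat.swap) := by
  rw [isBiflag_iff hE] at h
  rw [isBiflag_iff (by simpa using hE)]
  refine ⟨?_, h.2.imp fun i hi p hp => ?_⟩
  · intro p hp q hq
    obtain ⟨p, hp', rfl⟩ := Finset.mem_image.1 hp
    obtain ⟨q, hq', rfl⟩ := Finset.mem_image.1 hq
    rw [Biflat.swap_le_swap, Biflat.swap_le_swap]
    exact h.1 q hq' p hp'
  · obtain ⟨p, hp', rfl⟩ := Finset.mem_image.1 hp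
    exact fun h => hi p hp' ⟨h.2, h.1⟩

theorem gapSet_dual (L T : Finset (Fin (n + 1))) : gapSet M✶ T L = gapSet M L T := by
  rw [gapSet, gapSet, M.dual_dual, Set.union_comm]

/-- Greediness is symmetric in `M` and its dual, so statements about `T` and coflats follow from
those about `L` and flats. -/
theorem IsGreedy.dual {L T : Finset (Fin (n + 1))} (h : IsGreedy M L T) : IsGreedy M✶ T L where
  disjoint := h.disjoint.symm
  nonempty := by rw [gapSet_dual]; exact h.nonempty
  isGreatest e he := by rw [gapSet_dual]; exact h.isGreatest e he.symm

end Swap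

/-! ### The biflag of a greedy pair -/

section Greedy

variable {M : Matroid (Fin (n + 1))}

/-- The elements of `L` that are at least `e`. -/
def atLeast (L : Finset (Fin (n + 1))) (e : Fin (n + 1)) : Finset (Fin (n + 1)) :=
  L.filter fun x => e ≤ x

theorem mem_atLeast {L : Finset (Fin (n + 1))} {e x : Fin (n + 1)} :
    x ∈ atLeast L e ↔ x ∈ L ∧ e ≤ x := Finset.mem_filter

/-- The biflats `cl(L_{≥ e})|E` with `e ∈ L` and `E|cl^⊥(T_{≥ e})` with `e ∈ T`. -/
def greedyBiflag (M : Matroid (Fin (n + 1))) (L T : Finset (Fin (n + 1))) : Finset (Biflat M) :=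
  {p | (p.G = Set.univ ∧ ∃ e ∈ L, p.F = M.closure (atLeast L e : Set (Fin (n + 1)))) ∨
    (p.F = Set.univ ∧ ∃ e ∈ T, p.G = M✶.closure (atLeast T e : Set (Fin (n + 1))))}

theorem mem_greedyBiflag {L T : Finset (Fin (n + 1))} {p : Biflat M} : p ∈ greedyBiflag M L T ↔
    (p.G = Set.univ ∧ ∃ e ∈ L, p.F = M.closure (atLeast L e : Set (Fin (n + 1)))) ∨
    (p.F = Set.univ ∧ ∃ e ∈ T, p.G = M✶.closure (atLeast T e : Set (Fin (n + 1)))) :=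
  Finset.mem_filter_univ p

theorem image_swap_greedyBiflag (L T : Finset (Fin (n + 1))) :
    (greedyBiflag M L T).image Biflat.swap = greedyBiflag M✶ T L := by
  ext p
  rw [Finset.mem_image, mem_greedyBiflag]
  constructor
  · rintro ⟨q, hq, rfl⟩
    rw [mem_greedyBiflag] at hq
    rw [M.dual_dual]
    exact hq.symm
  · intro h
    rw [M.dual_dual] at h
    refine ⟨⟨(p.G, p.F), ?_, p.2.flat_left, p.2.nonempty_right, p.2.nonempty_left, ?_, ?_⟩, ?_, rfl⟩
    · have := p.2.flat_right
      rwa [M.dual_dual] at this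
    · exact fun h => p.2.not_both ⟨h.2, h.1⟩
    · exact (Set.union_comm _ _).trans p.2.union_eq
    · exact mem_greedyBiflag.2 h.symm

theorem closure_atLeast_subset (N : Matroid (Fin (n + 1))) (L : Finset (Fin (n + 1)))
    (e : Fin (n + 1)) : N.closure (atLeast L e : Set (Fin (n + 1))) ⊆ N.closure (L : Set _) :=
  N.closure_subset_closure (Finset.coe_subset.2 (Finset.filter_subset _ _))

/-- The least element of a circuit inside `L` would be in the closure of the elements of `L` above
it. -/
theorem IsGreedy.indep (hE : M.E = Set.univ) {L T : Finset (Fin (n + 1))} (h : IsGreedy M L T) :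
    M.Indep (L : Set (Fin (n + 1))) := by
  by_contra hI
  obtain ⟨C, hCL, hC⟩ := (Matroid.not_indep_iff (by rw [hE]; exact Set.subset_univ _)).1
    hI |>.exists_isCircuit_subset
  obtain ⟨m, hm⟩ := exists_isLeast hC.nonempty
  refine (mem_gapSet.1 (h.isGreatest m (Or.inl (hCL hm.1))).1).1 (M.closure_subset_closure ?_
    (hC.mem_closure_sdiff_singleton_of_mem hm.1))
  rintro x ⟨hx, hxm⟩
  exact mem_above.2 ⟨hCL hx, lt_of_le_of_ne (hm.2 hx) (Ne.symm hxm)⟩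

theorem IsGreedy.dual_indep (hE : M.E = Set.univ) {L T : Finset (Fin (n + 1))}
    (h : IsGreedy M L T) : M✶.Indep (T : Set (Fin (n + 1))) :=
  h.dual.indep (by simpa using hE)

theorem IsGreedy.insert_left (hE : M.E = Set.univ) {L T : Finset (Fin (n + 1))}
    (h : IsGreedy M L T) {e : Fin (n + 1)} (he : IsGreatest (gapSet M L T) e)
    (hne : (gapSet M (insert e L) T).Nonempty) : IsGreedy M (insert e L) T where
  disjoint := by
    rw [Finset.disjoint_insert_left]
    exact ⟨fun heT => (mem_gapSet.1 he.1).2 (self_mem_closure (by simpa using hE) heT), h.disjoint⟩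
  nonempty := hne
  isGreatest x hx := by
    have hlt : ∀ y, y ∈ L ∨ y ∈ T → e < y := fun y hy => h.lt_of_mem_gapSet hE hy he.1
    by_cases hxe : x = e
    · subst hxe
      have h1 : above (insert x L) x = L := by
        ext y
        simp only [mem_above, Finset.mem_insert]
        exact ⟨fun h => h.1.resolve_left h.2.ne', fun h => ⟨Or.inr h, hlt y (Or.inl h)⟩⟩
      have h2 : above T x = T := by
        ext y
        simp only [mem_above]
        exact ⟨fun h => h.1, fun h => ⟨h, hlt y (Or.inr h)⟩⟩
      rwa [h1, h2]
    · have hx' : x ∈ L ∨ x ∈ T := by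
        rw [Finset.mem_insert] at hx
        tauto
      have h1 : above (insert e L) x = above L x := by
        ext y
        simp only [mem_above, Finset.mem_insert]
        refine ⟨fun h => ⟨h.1.resolve_left ?_, h.2⟩, fun h => ⟨Or.inr h.1, h.2⟩⟩
        rintro rfl
        exact lt_asymm h.2 (hlt x hx')
      rw [h1]
      exact h.isGreatest x hx'

theorem IsGreedy.insert_right (hE : M.E = Set.univ) {L T : Finset (Fin (n + 1))}
    (h : IsGreedy M L T) {e : Fin (n + 1)} (he : IsGreatest (gapSet M L T) e)
    (hne : (gapSet M L (insert e T)).Nonempty) : IsGreedy M L (insert e T) := by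
  rw [← gapSet_dual] at he hne
  have := (h.dual.insert_left (by simpa using hE) he hne).dual
  rwa [M.dual_dual] at this

theorem IsGreedy.empty (hM : IsGood M r) : IsGreedy M ∅ ∅ where
  disjoint := Finset.disjoint_empty_left _
  nonempty := ⟨0, by
    rw [mem_gapSet, Finset.coe_empty]
    exact ⟨hM.loopless 0, hM.dual.loopless 0⟩⟩
  isGreatest e he := by simp at he

/-- A greedy step on the left adds one biflat. -/
theorem greedyBiflag_insert_left (hE : M.E = Set.univ) {L T : Finset (Fin (n + 1))}
    (h : IsGreedy M L T) {e : Fin (n + 1)} (he : e ∈ gapSet M L T) {q : Biflat M}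
    (hF : q.F = M.closure (insert e L : Finset (Fin (n + 1)))) (hG : q.G = Set.univ) :
    greedyBiflag M (insert e L) T = insert q (greedyBiflag M L T) := by
  have hlt : ∀ y, y ∈ L → e < y := fun y hy => h.lt_of_mem_gapSet hE (Or.inl hy) he
  have h1 : atLeast (insert e L) e = insert e L := by
    ext y
    simp only [mem_atLeast, Finset.mem_insert]
    refine ⟨fun h => h.1, fun h => ⟨h, ?_⟩⟩
    rcases h with rfl | h
    · exact le_rfl
    · exact (hlt y h).le
  have h2 : ∀ x ∈ L, atLeast (insert e L) x = atLeast L x := by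
    intro x hx
    ext y
    simp only [mem_atLeast, Finset.mem_insert]
    refine ⟨fun h => ⟨h.1.resolve_left ?_, h.2⟩, fun h => ⟨Or.inr h.1, h.2⟩⟩
    rintro rfl
    exact absurd (hlt x hx) (not_lt.2 h.2)
  ext p
  rw [Finset.mem_insert, mem_greedyBiflag, mem_greedyBiflag]
  constructor
  · rintro (⟨hpG, x, hx, hpF⟩ | hp)
    · rw [Finset.mem_insert] at hx
      rcases hx with rfl | hx
      · exact Or.inl (biflat_ext (by rw [hpF, hF, h1]) (by rw [hpG, hG]))
      · exact Or.inr (Or.inl ⟨hpG, x, hx, by rw [hpF, h2 x hx]⟩)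
    · exact Or.inr (Or.inr hp)
  · rintro (rfl | ⟨hpG, x, hx, hpF⟩ | hp)
    · exact Or.inl ⟨hG, e, Finset.mem_insert_self _ _, by rw [hF, h1]⟩
    · exact Or.inl ⟨hpG, x, Finset.mem_insert_of_mem hx, by rw [hpF, h2 x hx]⟩
    · exact Or.inr hp

theorem greedyBiflag_insert_right (hE : M.E = Set.univ) {L T : Finset (Fin (n + 1))}
    (h : IsGreedy M L T) {e : Fin (n + 1)} (he : e ∈ gapSet M L T) {q : Biflat M}
    (hF : q.F = Set.univ) (hG : q.G = M✶.closure (insert e T : Finset (Fin (n + 1)))) :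
    greedyBiflag M L (insert e T) = insert q (greedyBiflag M L T) := by
  rw [← gapSet_dual] at he
  have := greedyBiflag_insert_left (by simpa using hE) h.dual he (q := q.swap) hG hF
  rw [← image_swap_greedyBiflag, ← image_swap_greedyBiflag, ← Finset.image_insert] at this
  exact Finset.image_injective Biflat.swap_injective this

theorem notMem_gap_of_mem_greedyBiflag {L T : Finset (Fin (n + 1))} {p : Biflat M}
    (hp : p ∈ greedyBiflag M L T) {e : Fin (n + 1)} (he : e ∈ gapSet M L T) :
    ¬ (e ∈ p.F ∧ e ∈ p.G) := by
  rw [mem_gapSet] at he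
  rintro ⟨h1, h2⟩
  rcases mem_greedyBiflag.1 hp with ⟨-, x, -, h⟩ | ⟨-, x, -, h⟩
  · rw [h] at h1
    exact he.1 (closure_atLeast_subset _ _ _ h1)
  · rw [h] at h2
    exact he.2 (closure_atLeast_subset _ _ _ h2)

theorem isBiflat_univ (hM : IsGood M r) {F : Set (Fin (n + 1))} (hF : M.IsFlat F)
    (h0 : F.Nonempty) (h1 : F ≠ Set.univ) : IsBiflat M F Set.univ :=
  ⟨hF, hM.dual.isFlat_univ, h0, Set.univ_nonempty, fun h => h1 (h.1.trans hM.ground), by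
    rw [Set.union_univ, hM.ground]⟩

theorem IsGreedy.closure_ne_univ {L T : Finset (Fin (n + 1))} (h : IsGreedy M L T) :
    M.closure (L : Set (Fin (n + 1))) ≠ Set.univ := fun h' => by
  obtain ⟨g, hg⟩ := h.nonempty
  refine (mem_gapSet.1 hg).1 ?_
  rw [h']; trivial

theorem IsGreedy.isBiflat (hM : IsGood M r) {L T : Finset (Fin (n + 1))} (h : IsGreedy M L T)
    {e : Fin (n + 1)} (he : e ∈ L) :
    IsBiflat M (M.closure (atLeast L e : Set (Fin (n + 1)))) Set.univ :=
  isBiflat_univ hM (M.isFlat_closure _) ⟨e, self_mem_closure hM.ground (mem_atLeast.2 ⟨he, le_rfl⟩)⟩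
    fun h' => h.closure_ne_univ (Set.univ_subset_iff.1 (h' ▸ closure_atLeast_subset M L e))

theorem exists_biflat_of_flat (hM : IsGood M r) {F : Set (Fin (n + 1))} (hF : M.IsFlat F)
    {x y : Fin (n + 1)} (hx : x ∈ F) (hy : y ∉ F) : ∃ q : Biflat M, q.F = F ∧ q.G = Set.univ :=
  ⟨⟨(_, _), isBiflat_univ hM hF ⟨x, hx⟩ fun h : F = _ => hy (by rw [h]; trivial)⟩, rfl, rfl⟩

theorem exists_biflat_of_coflat (hM : IsGood M r) {G : Set (Fin (n + 1))} (hG : M✶.IsFlat G)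
    {x y : Fin (n + 1)} (hx : x ∈ G) (hy : y ∉ G) : ∃ q : Biflat M, q.F = Set.univ ∧ q.G = G := by
  refine ⟨⟨(Set.univ, G), hM.isFlat_univ, hG, Set.univ_nonempty, ⟨x, hx⟩, fun h => hy ?_, ?_⟩, rfl,
    rfl⟩
  · have h2 : G = M.E := h.2
    rw [h2, hM.ground]; trivial
  · exact (Set.univ_union G).trans hM.ground.symm

/-- The last flat of the biflag is `cl(L)` itself, at the least element of `L`. With its dual this
identifies the gap of the biflag with `gapSet M L T`. -/
theorem IsGreedy.notMem_closure (hM : IsGood M r) (h : IsGreedy M L T) {i : Fin (n + 1)}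
    (hi : ∀ p ∈ greedyBiflag M L T, ¬ (i ∈ p.F ∧ i ∈ p.G)) :
    i ∉ M.closure (L : Set (Fin (n + 1))) := by
  intro hcl
  by_cases hL : L.Nonempty
  · have hmin := L.min'_mem hL
    have hall : atLeast L (L.min' hL) = L :=
      Finset.filter_true_of_mem fun x hx => L.min'_le x hx
    obtain ⟨p, hpF, hpG⟩ : ∃ p : Biflat M, p.F = M.closure (atLeast L (L.min' hL) : Set _) ∧
      p.G = Set.univ := ⟨⟨(_, _), h.isBiflat hM hmin⟩, rfl, rfl⟩
    refine hi p (mem_greedyBiflag.2 (Or.inl ⟨hpG, _, hmin, hpF⟩)) ⟨?_, by rw [hpG]; trivial⟩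
    rwa [hpF, hall]
  · rw [Finset.not_nonempty_iff_eq_empty] at hL
    subst hL
    rw [Finset.coe_empty] at hcl
    exact hM.loopless i hcl

theorem IsGreedy.notMem_dual_closure (hM : IsGood M r) (h : IsGreedy M L T) {i : Fin (n + 1)}
    (hi : ∀ p ∈ greedyBiflag M L T, ¬ (i ∈ p.F ∧ i ∈ p.G)) :
    i ∉ M✶.closure (T : Set (Fin (n + 1))) := by
  refine h.dual.notMem_closure hM.dual fun p hp => ?_
  rw [← image_swap_greedyBiflag] at hp
  obtain ⟨q, hq, rfl⟩ := Finset.mem_image.1 hp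
  exact fun h => hi q hq ⟨h.2, h.1⟩

/-- The lower half of the biflag of a greedy pair. -/
theorem card_filter_greedyBiflag (hM : IsGood M r) {L T : Finset (Fin (n + 1))}
    (h : IsGreedy M L T) :
    ((greedyBiflag M L T).filter fun p => p.G = Set.univ).card = L.card := by
  have hE := hM.ground
  symm
  refine Finset.card_bij (fun e he => (⟨(_, _), h.isBiflat hM he⟩ : Biflat M)) ?_ ?_ ?_
  · intro e he
    exact Finset.mem_filter.2 ⟨mem_greedyBiflag.2 (Or.inl ⟨rfl, e, he, rfl⟩), rfl⟩
  · intro e he e' he' heq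
    have hF : M.closure (atLeast L e : Set (Fin (n + 1))) = M.closure (atLeast L e' : Set _) :=
      congrArg Biflat.F heq
    have key : ∀ {e e'}, e ∈ L → e' ∈ L → e < e' → M.closure (atLeast L e : Set (Fin (n + 1)))
        ≠ M.closure (atLeast L e' : Set (Fin (n + 1))) := by
      intro e e' he he' hlt heq
      refine (h.indep hE).notMem_closure_sdiff_of_mem (Finset.mem_coe.2 he)
        (M.closure_subset_closure (X := atLeast L e') (fun x hx => ?_)
          (heq ▸ self_mem_closure hE (mem_atLeast.2 ⟨he, le_rfl⟩)))
      have := mem_atLeast.1 (Finset.mem_coe.1 hx)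
      exact ⟨this.1, (hlt.trans_le this.2).ne'⟩
    by_contra hne
    rcases lt_or_gt_of_ne hne with hlt | hlt
    · exact key he he' hlt hF
    · exact key he' he hlt hF.symm
  · intro p hp
    obtain ⟨hp, hpG⟩ := Finset.mem_filter.1 hp
    rcases mem_greedyBiflag.1 hp with ⟨-, e, he, hpF⟩ | ⟨hpF, -⟩
    · exact ⟨e, he, biflat_ext hpF.symm hpG.symm⟩
    · exact absurd ⟨hpF, hpG⟩ (p.not_univ hE)

end Greedy

/-! ### Ranks below a biflat in a growing biflag -/

section Below

variable {M : Matroid (Fin (n + 1))}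

/-- The members of `L ∪ U` outside of all proper coflats of `S` at or below `q`. -/
def freeSet (q : Biflat M) (L U : Finset (Fin (n + 1))) (S : Finset (Biflat M)) :
    Set (Fin (n + 1)) :=
  {x | (x ∈ L ∨ x ∈ U) ∧ ∀ p ∈ S, p ≤ q → p.G ≠ Set.univ → x ∉ p.G}

/-- Bookkeeping for a biflag `S` which arises by filling gaps: `U` is the set of the elements
outside of the coflat of `q` that were used to insert biflats below `q`. -/
structure BelowState (q : Biflat M) (L : Finset (Fin (n + 1))) (S : Finset (Biflat M))
    (U : Finset (Fin (n + 1))) : Prop where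
  mem : q ∈ S
  notMem_G : ∀ x ∈ U, x ∉ q.G
  disjoint : Disjoint L U
  card : (S.filter (· < q)).card = L.card + U.card
  covered : ∀ x, x ∈ L ∨ x ∈ U → ∃ p ∈ S, x ∈ p.F ∧ x ∈ p.G
  indep : M.Indep (freeSet q L U S)
  flat : ∃ D, (D = ∅ ∨ ∃ p ∈ S, p.G = Set.univ ∧ p.F = D) ∧ freeSet q L U S ⊆ D

variable {q : Biflat M} {L U : Finset (Fin (n + 1))} {S : Finset (Biflat M)}

/-- Every condition refers only to members at or below `q`, or persists under enlargement. -/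
theorem BelowState.insert_above (h : BelowState q L S U) {p : Biflat M} (hp : q < p) :
    BelowState q L (insert p S) U := by
  have hfree : freeSet q L U (insert p S) = freeSet q L U S := by
    ext x
    simp only [freeSet, Finset.forall_mem_insert, Set.mem_ofPred_eq]
    exact and_congr_right fun _ => and_iff_right fun h => absurd h hp.not_ge
  refine ⟨Finset.mem_insert_of_mem h.mem, h.notMem_G, h.disjoint, ?_, fun x hx => ?_, ?_, ?_⟩
  · rw [Finset.filter_insert, if_neg hp.not_gt, h.card]
  · obtain ⟨s, hs, hx⟩ := h.covered x hx
    exact ⟨s, Finset.mem_insert_of_mem hs, hx⟩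
  · rw [hfree]; exact h.indep
  · rw [hfree]
    obtain ⟨D, hD, hsub⟩ := h.flat
    refine ⟨D, hD.imp id ?_, hsub⟩
    rintro ⟨s, hs, hx⟩
    exact ⟨s, Finset.mem_insert_of_mem hs, hx⟩

/-- The free elements lie in a flat `D` whose partner is `E`, so the gap element `i` is outside `D`
and stays independent of them. If the new coflat is `E`, the new flat takes over the role of `D`; if
it is proper, `i` is not free and `D` still serves. -/
theorem BelowState.insert_below (hM : IsGood M r) (h : BelowState q L S U) {p : Biflat M}
    (hb : IsBiflag M (insert p S)) {i : Fin (n + 1)} (hi : ∀ s ∈ S, ¬ (i ∈ s.F ∧ i ∈ s.G))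
    (hF : i ∈ p.F) (hG : i ∈ p.G) (hiq : i ∉ q.G) :
    BelowState q L (insert p S) (insert i U) := by
  have hE := hM.ground
  have hpS : p ∉ S := fun hp => hi p hp ⟨hF, hG⟩
  have hcomp : ∀ s ∈ S, p ≤ s ∨ s ≤ p := fun s hs =>
    hb.le_or_le (Finset.mem_insert_self _ _) (Finset.mem_insert_of_mem hs)
  have hpq : p < q := by
    refine lt_of_le_of_ne ((hcomp q h.mem).resolve_right fun h => hiq (h.2 hG)) ?_
    rintro rfl
    exact hpS h.mem
  have hiL : i ∉ L := fun hx => by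
    obtain ⟨s, hs, hx⟩ := h.covered i (Or.inl hx)
    exact hi s hs hx
  have hiU : i ∉ U := fun hx => by
    obtain ⟨s, hs, hx⟩ := h.covered i (Or.inr hx)
    exact hi s hs hx
  have hsub1 : freeSet q L (insert i U) (insert p S) ⊆ insert i (freeSet q L U S) := by
    rintro x ⟨hx, hx'⟩
    by_cases hxi : x = i
    · exact Or.inl hxi
    · refine Or.inr ⟨?_, fun s hs => hx' s (Finset.mem_insert_of_mem hs)⟩
      rw [Finset.mem_insert] at hx
      tauto
  obtain ⟨D, hD, hsub⟩ := h.flat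
  have hiD : i ∉ D := by
    rcases hD with rfl | ⟨s, hs, hsG, rfl⟩
    · exact Set.notMem_empty i
    · exact fun hx => hi s hs ⟨hx, by rw [hsG]; trivial⟩
  have hDflat : M.IsFlat D := by
    rcases hD with rfl | ⟨s, hs, hsG, rfl⟩
    · exact hM.isFlat_empty
    · exact s.flatF
  have hicl : i ∉ M.closure (freeSet q L U S) := fun hx => hiD (by
    rw [← hDflat.closure]
    exact M.closure_subset_closure hsub hx)
  refine ⟨Finset.mem_insert_of_mem h.mem, ?_, ?_, ?_, fun x hx => ?_, ?_, ?_⟩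
  · intro x hx
    rcases Finset.mem_insert.1 hx with rfl | hx
    · exact hiq
    · exact h.notMem_G x hx
  · rw [Finset.disjoint_insert_right]
    exact ⟨hiL, h.disjoint⟩
  · rw [Finset.filter_insert, if_pos hpq, Finset.card_insert_of_notMem
      (fun hx => hpS (Finset.mem_filter.1 hx).1), h.card, Finset.card_insert_of_notMem hiU]
    ring
  · by_cases hxi : x = i
    · subst hxi
      exact ⟨p, Finset.mem_insert_self _ _, hF, hG⟩
    · obtain ⟨s, hs, hx⟩ := h.covered x (by rw [Finset.mem_insert] at hx; tauto)
      exact ⟨s, Finset.mem_insert_of_mem hs, hx⟩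
  · refine Matroid.Indep.subset ?_ hsub1
    by_cases hif : i ∈ freeSet q L U S
    · rw [Set.insert_eq_of_mem hif]; exact h.indep
    · exact (h.indep.notMem_closure_iff_of_notMem hif (by rw [hE]; trivial)).1 hicl
  · by_cases hpG : p.G = Set.univ
    · refine ⟨p.F, Or.inr ⟨p, Finset.mem_insert_self _ _, hpG, rfl⟩, fun x hx => ?_⟩
      rcases hsub1 hx with rfl | hx
      · exact hF
      · have hxD := hsub hx
        rcases hD with rfl | ⟨s, hs, hsG, rfl⟩
        · exact absurd hxD (Set.notMem_empty x)
        · exact ((hcomp s hs).resolve_left fun hle => hi s hs ⟨hle.1 hF,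
          by rw [hsG]; trivial⟩).1 hxD
    · refine ⟨D, hD.imp id ?_, fun x hx => ?_⟩
      · rintro ⟨s, hs, hx⟩
        exact ⟨s, Finset.mem_insert_of_mem hs, hx⟩
      · rcases hsub1 hx with rfl | hx'
        · exact absurd hG (hx.2 p (Finset.mem_insert_self _ _) hpq.le hpG)
        · exact hsub hx'

/-- Take `p` to be the lowest member with a proper coflat. The elements of `U` and of `L` outside
`q.G` either avoid `p.G`, and are then free and bounded by the rank of its complement, or lie in
`p.G \ q.G`. The rank formula of the dual removes the cardinality of `p.G`. -/
theorem BelowState.card_le (hM : IsGood M r) (h : BelowState q L S U) (hS : IsBiflag M S)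
    (hq : q.G ≠ Set.univ) : ∃ p ∈ S, p ≤ q ∧ p.G ≠ Set.univ ∧
      U.card + (L.filter (· ∉ q.G)).card + rk M✶ Set.univ ≤ rk M✶ p.G + q.Gᶜ.ncard := by
  have hE := hM.ground
  obtain ⟨p, hp, ⟨hpq, hpG⟩, hmin⟩ := hS.exists_minimal_lt (fun p => p ≤ q ∧ p.G ≠ Set.univ)
    ⟨q, h.mem, le_rfl, hq⟩
  refine ⟨p, hp, hpq, hpG, ?_⟩
  have h1 : (freeSet q L U S).ncard ≤ rk M p.Gᶜ := by
    rw [← rk_of_indep h.indep]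
    exact rk_mono fun x hx => hx.2 p hp hpq hpG
  have h2 : ((U ∪ L.filter (· ∉ q.G) : Finset (Fin (n + 1))) : Set (Fin (n + 1)))
      ⊆ freeSet q L U S ∪ (p.G \ q.G) := by
    intro x hx
    rw [Finset.mem_coe, Finset.mem_union, Finset.mem_filter] at hx
    have hxq : x ∉ q.G := hx.elim (h.notMem_G x) fun h => h.2
    by_cases hxp : x ∈ p.G
    · exact Or.inr ⟨hxp, hxq⟩
    · exact Or.inl ⟨by tauto, fun s hs hsq hsG hxs => hxp ((hmin s hs ⟨hsq, hsG⟩).2 hxs)⟩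
  have h3 := (Set.ncard_le_ncard h2 (Set.toFinite _)).trans (Set.ncard_union_le _ _)
  rw [Set.ncard_coe_finset, Finset.card_union_of_disjoint (h.disjoint.symm.mono_right
    (Finset.filter_subset _ _))] at h3
  have h4 := Set.ncard_sdiff_add_ncard_of_subset hpq.2 (Set.toFinite _)
  have h5 := rk_dual hE p.G
  have h6 := hM.rk_univ
  have h7 := hM.rk_dual_univ
  have h8 := Set.ncard_add_ncard_compl q.G
  rw [Nat.card_eq_fintype_card, Fintype.card_fin] at h8
  omega

/-- No member of the greedy biflag contains `e` on both sides, so compatibility places the members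
with coflat `E` below `q` and all others above. This is the start of the bookkeeping, with nothing
inserted yet. -/
theorem BelowState.of_greedy (hM : IsGood M r) {T : Finset (Fin (n + 1))} (h : IsGreedy M L T)
    (hb : IsBiflag M (insert q (greedyBiflag M L T))) {e : Fin (n + 1)} (he : e ∈ gapSet M L T)
    (hF : e ∈ q.F) (hG : e ∈ q.G) : BelowState q L (insert q (greedyBiflag M L T)) ∅ := by
  have hE := hM.ground
  have hcomp : ∀ s ∈ greedyBiflag M L T, q ≤ s ∨ s ≤ q := fun s hs =>
    hb.le_or_le (Finset.mem_insert_self _ _) (Finset.mem_insert_of_mem hs)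
  have hfree : freeSet q L ∅ (insert q (greedyBiflag M L T)) ⊆ L := by
    rintro x ⟨hx, -⟩
    simpa using hx
  refine ⟨Finset.mem_insert_self _ _, by simp, Finset.disjoint_empty_right _, ?_, fun x hx => ?_,
    (h.indep hE).subset hfree, ?_⟩
  · rw [Finset.filter_insert, if_neg (lt_irrefl q), Finset.card_empty, add_zero,
      ← card_filter_greedyBiflag hM h]
    congr 1
    refine Finset.filter_congr fun p hp => ?_
    have hpe := notMem_gap_of_mem_greedyBiflag hp he
    have hpq : p ≠ q := by
      rintro rfl
      exact hpe ⟨hF, hG⟩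
    constructor
    · intro hlt
      rcases mem_greedyBiflag.1 hp with ⟨h, -⟩ | ⟨h, -⟩
      · exact h
      · exact absurd ⟨by rw [h]; trivial, hlt.le.2 hG⟩ hpe
    · intro hpG
      exact lt_of_le_of_ne ((hcomp p hp).resolve_left fun h => hpe
        ⟨h.1 hF, by rw [hpG]; trivial⟩) hpq
  · have hxL : x ∈ L := by simpa using hx
    exact ⟨⟨(_, _), h.isBiflat hM hxL⟩, Finset.mem_insert_of_mem (mem_greedyBiflag.2
      (Or.inl ⟨rfl, x, hxL, rfl⟩)), self_mem_closure hE (mem_atLeast.2 ⟨hxL, le_rfl⟩), trivial⟩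
  · by_cases hL : L.Nonempty
    · have hmin := L.min'_mem hL
      have hall : atLeast L (L.min' hL) = L :=
        Finset.filter_true_of_mem fun x hx => L.min'_le x hx
      refine ⟨M.closure L, Or.inr ⟨⟨(_, _), h.isBiflat hM hmin⟩, Finset.mem_insert_of_mem
        (mem_greedyBiflag.2 (Or.inl ⟨rfl, _, hmin, rfl⟩)), rfl, ?_⟩,
        fun x hx => self_mem_closure hE (hfree hx)⟩
      change M.closure (atLeast L (L.min' hL) : Set (Fin (n + 1))) = _
      rw [hall]
    · rw [Finset.not_nonempty_iff_eq_empty] at hL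
      subst hL
      exact ⟨∅, Or.inl rfl, by simpa using hfree⟩

end Below

/-! ### Vanishing of monomials with a biflat that is proper on both sides -/

section Kill

variable {M : Matroid (Fin (n + 1))}

/-- Choosing `i` outside the largest proper flat forces each new biflat above all members with
proper flats, with a flat of strictly larger rank. After `k` factors the rank has risen by `k` and
is still at most `r`. -/
theorem exists_gamma_survivor (hM : IsGood M r) {S₁ : Finset (Biflat M)} (hS₁ : IsBiflag M S₁)
    {k : ℕ} (hne : xmono M S₁ * gamma M ^ k ≠ 0) :
    ∃ S, IsBiflag M S ∧ S₁ ⊆ S ∧ S.card = S₁.card + k ∧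
      (∀ q ∈ S, q ∉ S₁ → q.F ≠ Set.univ ∧ ∀ p ∈ S₁, p.F ≠ Set.univ → p < q) ∧
      ∀ p ∈ S₁, p.F ≠ Set.univ → rk M p.F + k ≤ r := by
  have hE := hM.ground
  let Q : Finset (Biflat M) → Prop := fun S => S₁ ⊆ S ∧
    (∀ q ∈ S, q ∉ S₁ → q.F ≠ Set.univ ∧ ∀ p ∈ S₁, p.F ≠ Set.univ → p < q) ∧
    ∀ p₁ ∈ S₁, p₁.F ≠ Set.univ → ∃ p ∈ S, p.F ≠ Set.univ ∧
      rk M p₁.F + S.card ≤ rk M p.F + S₁.card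
  have hQ : ∀ S, IsBiflag M S → Q S → ∃ i, (∀ p ∈ S, i ∈ p.F → p.F = Set.univ) ∧
      ∀ q, i ∈ q.F → q.F ≠ Set.univ → q ∉ S → IsBiflag M (insert q S) → Q (insert q S) := by
    rintro S hS ⟨h1, h2, h3⟩
    obtain ⟨i, hi⟩ : ∃ i, ∀ p ∈ S, p.F ≠ Set.univ → i ∉ p.F := by
      by_cases hex : ∃ p ∈ S, p.F ≠ Set.univ
      · obtain ⟨m, hm, hmF, hmax⟩ := hS.exists_maximal_lt (fun p => p.F ≠ Set.univ) hex
        obtain ⟨i, hi⟩ := (Set.ne_univ_iff_exists_notMem _).1 hmF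
        exact ⟨i, fun p hp hpF hip => hi ((hmax p hp hpF).1 hip)⟩
      · exact ⟨0, fun p hp hpF => absurd ⟨p, hp, hpF⟩ hex⟩
    refine ⟨i, fun p hp hip => ?_, fun q hiq hqF hqS hb => ?_⟩
    · by_contra hpF
      exact hi p hp hpF hip
    · have hlt : ∀ p ∈ S, p.F ≠ Set.univ → p < q ∧ rk M p.F < rk M q.F := by
        intro p hp hpF
        have hip : i ∉ p.F := hi p hp hpF
        have hle : p ≤ q := (hb.le_or_le (Finset.mem_insert_of_mem hp)
          (Finset.mem_insert_self _ _)).resolve_right fun h => hip (h.1 hiq)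
        exact ⟨lt_of_le_of_ne hle fun h => hqS (h ▸ hp),
          rk_lt hE p.flatF (hle.1.ssubset_of_ne fun h => hip (h ▸ hiq))⟩
      refine ⟨h1.trans (Finset.subset_insert _ _), fun s hs hs1 => ?_, fun p hp hpF => ?_⟩
      · rcases Finset.mem_insert.1 hs with rfl | hs
        · exact ⟨hqF, fun p hp hpF => (hlt p (h1 hp) hpF).1⟩
        · exact h2 s hs hs1
      · obtain ⟨s, hs, hsF, hle⟩ := h3 p hp hpF
        refine ⟨q, Finset.mem_insert_self _ _, hqF, ?_⟩
        have := (hlt s hs hsF).2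
        rw [Finset.card_insert_of_notMem hqS]
        omega
  obtain ⟨S, hS, ⟨h1, h2, h3⟩, h4, -⟩ := exists_survivor_gamma hE Q hQ 1 k S₁ hS₁
    ⟨subset_rfl, fun q hq hq' => absurd hq hq', fun p hp hpF => ⟨p, hp, hpF, le_rfl⟩⟩
    (by rwa [mul_one])
  refine ⟨S, hS, h1, h4, h2, fun p hp hpF => ?_⟩
  obtain ⟨s, -, hsF, hle⟩ := h3 p hp hpF
  have := hM.rk_le_of_ne_univ s.flatF hsF
  omega

/-- All insertions so far were below `q`, unless the part of the gap outside of the coflat of `q`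
is used up. -/
def FillState (q : Biflat M) (L : Finset (Fin (n + 1))) (c : ℕ) (S : Finset (Biflat M)) : Prop :=
  ∃ U, BelowState q L S U ∧
    (S.card = c + U.card ∨ ∀ i, i ∉ q.G → ∃ p ∈ S, i ∈ p.F ∧ i ∈ p.G)

/-- While the gap has an element outside `q.G`, use such an `i`: a biflat with `i` in its coflat
cannot lie above `q`. Once these elements are all covered, any gap element is outside `q.F`, and
insertions go above `q`. -/
theorem FillState.exists_step (hM : IsGood M r) {q : Biflat M} {L : Finset (Fin (n + 1))} {c : ℕ}
    {S : Finset (Biflat M)} (hS : IsBiflag M S) (h : FillState q L c S) :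
    ∃ i, (∀ p ∈ S, ¬ (i ∈ p.F ∧ i ∈ p.G)) ∧
      ∀ p, i ∈ p.F → i ∈ p.G → p ∉ S → IsBiflag M (insert p S) → FillState q L c (insert p S) := by
  obtain ⟨U, hU, hc⟩ := h
  by_cases hex : ∃ i, i ∉ q.G ∧ ∀ p ∈ S, ¬ (i ∈ p.F ∧ i ∈ p.G)
  · obtain ⟨i, hiq, hi⟩ := hex
    refine ⟨i, hi, fun p hF hG hpS hb => ⟨_, hU.insert_below hM hb hi hF hG hiq, Or.inl ?_⟩⟩
    have hiU : i ∉ U := fun hx => by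
      obtain ⟨s, hs, hx⟩ := hU.covered i (Or.inr hx)
      exact hi s hs hx
    have hc' := hc.resolve_right fun h => by
      obtain ⟨s, hs, hx⟩ := h i hiq
      exact hi s hs hx
    rw [Finset.card_insert_of_notMem hpS, Finset.card_insert_of_notMem hiU, hc', add_assoc]
  · have hcov : ∀ i, i ∉ q.G → ∃ p ∈ S, i ∈ p.F ∧ i ∈ p.G := by
      intro i hi
      by_contra hcon
      exact hex ⟨i, hi, fun p hp h => hcon ⟨p, hp, h⟩⟩
    obtain ⟨i, hi⟩ := ((isBiflag_iff hM.ground).1 hS).2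
    refine ⟨i, hi, fun p hF hG hpS hb => ⟨U, hU.insert_above ?_, Or.inr fun j hj => ?_⟩⟩
    · have hiG : i ∈ q.G := by
        by_contra hiG
        obtain ⟨s, hs, hx⟩ := hcov i hiG
        exact hi s hs hx
      refine lt_of_le_of_ne ((hb.le_or_le (Finset.mem_insert_of_mem hU.mem)
        (Finset.mem_insert_self _ _)).resolve_right fun h => hi q hU.mem ⟨h.1 hF, hiG⟩) ?_
      rintro rfl
      exact hpS hU.mem
    · obtain ⟨s, hs, hx⟩ := hcov j hj
      exact ⟨s, Finset.mem_insert_of_mem hs, hx⟩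

theorem FillState.exists_step_dual (hM : IsGood M r) {q : Biflat M} {T : Finset (Fin (n + 1))}
    {c : ℕ} {S : Finset (Biflat M)} (hS : IsBiflag M S)
    (h : FillState q.swap T c (S.image Biflat.swap)) :
    ∃ i, (∀ p ∈ S, ¬ (i ∈ p.F ∧ i ∈ p.G)) ∧
      ∀ p, i ∈ p.F → i ∈ p.G → p ∉ S → IsBiflag M (insert p S) →
        FillState q.swap T c ((insert p S).image Biflat.swap) := by
  obtain ⟨i, hi, hstep⟩ := h.exists_step hM.dual (hS.swap hM.ground)
  refine ⟨i, fun p hp h => hi p.swap (Finset.mem_image_of_mem _ hp) ⟨h.2, h.1⟩,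
    fun p hF hG hpS hb => ?_⟩
  have hb' := hb.swap hM.ground
  rw [Finset.image_insert] at hb' ⊢
  exact hstep p.swap hG hF (fun h => hpS (by
    obtain ⟨s, hs, hsp⟩ := Finset.mem_image.1 h
    exact Biflat.swap_injective hsp ▸ hs)) hb'

theorem card_filter_lt_swap {S : Finset (Biflat M)} {q : Biflat M} :
    ((S.image Biflat.swap).filter (· < q.swap)).card = (S.filter (q < ·)).card := by
  rw [Finset.filter_image, Finset.card_image_of_injective _ Biflat.swap_injective]
  simp only [Biflat.swap_lt_swap]

theorem filter_lt_eq_of_subset {S S₁ : Finset (Biflat M)} (h : S₁ ⊆ S) {q : Biflat M}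
    (hnew : ∀ p ∈ S, p ∉ S₁ → q < p) : S.filter (· < q) = S₁.filter (· < q) := by
  ext p
  rw [Finset.mem_filter, Finset.mem_filter]
  refine ⟨fun hp => ⟨?_, hp.2⟩, fun hp => ⟨h hp.1, hp.2⟩⟩
  by_contra hcon
  exact lt_asymm hp.2 (hnew p hp.1 hcon)

/-! ### Bounds for one biflat inserted into a greedy biflag -/

section Greedy

variable {q : Biflat M} {L T : Finset (Fin (n + 1))} {e : Fin (n + 1)}

/-- A flat of the greedy biflag omits `e`, so by compatibility it must lie inside `q.F`. -/
theorem IsGreedy.subset_F (hM : IsGood M r) (h : IsGreedy M L T)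
    (hb : IsBiflag M (insert q (greedyBiflag M L T))) (he : e ∈ gapSet M L T) (hF : e ∈ q.F) :
    M.closure (L : Set (Fin (n + 1))) ⊆ q.F := by
  rw [← q.flatF.closure]
  refine M.closure_subset_closure fun x hx => ?_
  have hmem := self_mem_closure hM.ground (mem_atLeast.2 ⟨hx, le_rfl⟩ : x ∈ atLeast L x)
  obtain ⟨p, hpF, hpG⟩ : ∃ p : Biflat M, p.F = M.closure (atLeast L x : Set (Fin (n + 1))) ∧
      p.G = Set.univ := ⟨⟨(_, _), h.isBiflat hM hx⟩, rfl, rfl⟩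
  rw [← hpF] at hmem
  refine ((hb.le_or_le (Finset.mem_insert_of_mem (mem_greedyBiflag.2
    (Or.inl ⟨hpG, x, hx, hpF⟩))) (Finset.mem_insert_self _ _)).resolve_right fun hle => ?_).1 hmem
  have := hle.1 hF
  rw [hpF] at this
  exact (mem_gapSet.1 he).1 (closure_atLeast_subset _ _ _ this)

theorem IsGreedy.card_lt_rk (hM : IsGood M r) (h : IsGreedy M L T)
    (hb : IsBiflag M (insert q (greedyBiflag M L T))) (he : e ∈ gapSet M L T) (hF : e ∈ q.F) :
    L.card < rk M q.F := by
  have h1 := rk_of_indep (h.indep hM.ground)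
  rw [Set.ncard_coe_finset, ← rk_closure] at h1
  rw [← h1]
  exact rk_lt hM.ground (M.isFlat_closure _) ((h.subset_F hM hb he hF).ssubset_of_ne fun h' =>
    (mem_gapSet.1 he).1 (by rwa [h']))

theorem swap_greedy (hM : IsGood M r) (hb : IsBiflag M (insert q (greedyBiflag M L T))) :
    IsBiflag M✶ (insert q.swap (greedyBiflag M✶ T L)) := by
  have := hb.swap hM.ground
  rwa [Finset.image_insert, image_swap_greedyBiflag] at this

theorem IsGreedy.card_lt_rk_dual (hM : IsGood M r) (h : IsGreedy M L T)
    (hb : IsBiflag M (insert q (greedyBiflag M L T))) (he : e ∈ gapSet M L T) (hG : e ∈ q.G) :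
    T.card < rk M✶ q.G :=
  h.dual.card_lt_rk (q := q.swap) hM.dual (swap_greedy hM hb) (by rwa [gapSet_dual]) hG

theorem IsGreedy.subset_G (hM : IsGood M r) (h : IsGreedy M L T)
    (hb : IsBiflag M (insert q (greedyBiflag M L T))) (he : e ∈ gapSet M L T) (hG : e ∈ q.G) :
    M✶.closure (T : Set (Fin (n + 1))) ⊆ q.G :=
  h.dual.subset_F (q := q.swap) hM.dual (swap_greedy hM hb) (by rwa [gapSet_dual]) hG

theorem IsGreedy.dual_belowState (hM : IsGood M r) (h : IsGreedy M L T)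
    (hb : IsBiflag M (insert q (greedyBiflag M L T))) (he : e ∈ gapSet M L T) (hF : e ∈ q.F)
    (hG : e ∈ q.G) :
    BelowState q.swap T ((insert q (greedyBiflag M L T)).image Biflat.swap) ∅ := by
  rw [Finset.image_insert, image_swap_greedyBiflag]
  exact BelowState.of_greedy hM.dual h.dual (swap_greedy hM hb) (by rwa [gapSet_dual]) hG hF

theorem IsGreedy.card_insert (hM : IsGood M r) (h : IsGreedy M L T)
    (hb : IsBiflag M (insert q (greedyBiflag M L T))) (he : e ∈ gapSet M L T) (hF : e ∈ q.F)
    (hG : e ∈ q.G) : (insert q (greedyBiflag M L T)).card = L.card + T.card + 1 := by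
  have h1 := (BelowState.of_greedy hM h hb he hF hG).card
  have h2 := (h.dual_belowState hM hb he hF hG).card
  rw [card_filter_lt_swap] at h2
  have h3 := card_eq_below_add_above hb (Finset.mem_insert_self _ _)
  rw [Finset.card_empty] at h1 h2
  omega

variable {m k : ℕ}

/-- In a surviving maximal biflag the corrected height of `q` is one more than the number `|L| +
|U|` of members below it, as the `γ`-factors insert only above `q`. If the final gap element is in
`q.G`, `BelowState.card_le` bounds `|U|`. Otherwise all `m` insertions by `δ` were below `q`, too
many for the height allowed by the `k` flats still to fit above `q.F`. -/
theorem IsGreedy.ht_add_le (hM : IsGood M r) (h : IsGreedy M L T)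
    (hb : IsBiflag M (insert q (greedyBiflag M L T))) (he : e ∈ gapSet M L T) (hF : e ∈ q.F)
    (hG : e ∈ q.G) (hqF : q.F ≠ Set.univ) (hqG : q.G ≠ Set.univ)
    (hc : L.card + T.card + 1 + m + k = n - 1)
    (hne : xmono M (insert q (greedyBiflag M L T)) * delta M ^ m * gamma M ^ k ≠ 0) :
    q.ht + (L.filter (· ∉ q.G)).card ≤ L.card + q.Gᶜ.ncard := by
  have hE := hM.ground
  have hc0 := h.card_insert hM hb he hF hG
  obtain ⟨S₁, hS₁, ⟨U, hU, hUc⟩, hc₁, hne₁⟩ := exists_survivor_delta hE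
    (FillState q L (insert q (greedyBiflag M L T)).card) (fun S hS h => h.exists_step hM hS) _ m _
    hb ⟨∅, BelowState.of_greedy hM h hb he hF hG, Or.inl rfl⟩ hne
  obtain ⟨S, hS, hsub, hcS, hnew, hrk⟩ := exists_gamma_survivor hM hS₁ hne₁
  obtain ⟨i, hi⟩ := ((isBiflag_iff hE).1 hS).2
  have hbelow := (card_below_eq hM hS (by omega) hi (hsub hU.mem)).1
  rw [filter_lt_eq_of_subset hsub fun p hp hp' => (hnew p hp hp').2 q hU.mem hqF, hU.card] at hbelow
  have hr := hM.r_lt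
  have h1 := hM.rk_dual_univ
  by_cases hiG : i ∈ q.G
  · have hiF : i ∉ q.F := fun h => hi q (hsub hU.mem) ⟨h, hiG⟩
    rw [Biflat.gapHt, if_neg hiF] at hbelow
    obtain ⟨p, -, -, hpG, hle⟩ := hU.card_le hM hS₁ hqG
    have := rk_lt (M := M✶) hE p.flatG (Set.ssubset_univ_iff.2 hpG)
    omega
  · exfalso
    have hiF : i ∈ q.F := (q.mem_union hE i).resolve_right hiG
    rw [Biflat.gapHt, if_pos hiF, Biflat.ht] at hbelow
    have hUm := hUc.resolve_right fun h => by
      obtain ⟨s, hs, hx⟩ := h i hiG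
      exact hi s (hsub hs) hx
    have h2 := hrk q hU.mem hqF
    have h3 := h.card_lt_rk_dual hM hb he hG
    omega

/-- The strategy dual to that of `IsGreedy.ht_add_le` fills the gap outside `q.F` first. The roles
are not quite symmetric, because the insertions by `γ` still lie above `q`; the room they need is
accounted for by the rank bound on the flat given by `BelowState.card_le`. -/
theorem IsGreedy.le_ht_add (hM : IsGood M r) (h : IsGreedy M L T)
    (hb : IsBiflag M (insert q (greedyBiflag M L T))) (he : e ∈ gapSet M L T) (hF : e ∈ q.F)
    (hG : e ∈ q.G) (hqF : q.F ≠ Set.univ) (hqG : q.G ≠ Set.univ)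
    (hc : L.card + T.card + 1 + m + k = n - 1)
    (hne : xmono M (insert q (greedyBiflag M L T)) * delta M ^ m * gamma M ^ k ≠ 0) :
    n + 1 + (T.filter (· ∉ q.F)).card ≤ q.ht + T.card + q.Fᶜ.ncard := by
  have hE := hM.ground
  have hc0 := h.card_insert hM hb he hF hG
  have hcim : ((insert q (greedyBiflag M L T)).image Biflat.swap).card
      = (insert q (greedyBiflag M L T)).card :=
    Finset.card_image_of_injective _ Biflat.swap_injective
  obtain ⟨S₁, hS₁, ⟨U, hU, hUc⟩, hc₁, hne₁⟩ := exists_survivor_delta hE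
    (fun S => FillState q.swap T (insert q (greedyBiflag M L T)).card (S.image Biflat.swap))
    (fun S hS h => FillState.exists_step_dual hM hS h) _ m _ hb
    ⟨∅, h.dual_belowState hM hb he hF hG, Or.inl hcim⟩ hne
  have hqS₁ : q ∈ S₁ := by
    obtain ⟨s, hs, hsq⟩ := Finset.mem_image.1 hU.mem
    exact Biflat.swap_injective hsq ▸ hs
  rw [Finset.card_image_of_injective _ Biflat.swap_injective] at hUc
  obtain ⟨S, hS, hsub, hcS, hnew, hrk⟩ := exists_gamma_survivor hM hS₁ hne₁
  obtain ⟨i, hi⟩ := ((isBiflag_iff hE).1 hS).2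
  have hbelow := (card_below_eq hM hS (by omega) hi (hsub hqS₁)).1
  rw [filter_lt_eq_of_subset hsub fun p hp hp' => (hnew p hp hp').2 q hqS₁ hqF] at hbelow
  have habove := hU.card
  rw [card_filter_lt_swap] at habove
  have hsum := card_eq_below_add_above hS₁ hqS₁
  have hr := hM.r_lt
  have h1 := hM.rk_dual_univ
  by_cases hiF : i ∈ q.F
  · rw [Biflat.gapHt, if_pos hiF] at hbelow
    obtain ⟨p, hp, -, hpG, hle⟩ := hU.card_le hM.dual (hS₁.swap hE) hqF
    obtain ⟨s, hs, rfl⟩ := Finset.mem_image.1 hp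
    have h2 := hrk s hs hpG
    rw [M.dual_dual, hM.rk_univ] at hle
    change U.card + (T.filter (· ∉ q.F)).card + (r + 1) ≤ rk M s.F + q.Fᶜ.ncard at hle
    omega
  · exfalso
    rw [Biflat.gapHt, if_neg hiF, Biflat.ht] at hbelow
    have hUm := hUc.resolve_right fun h => by
      obtain ⟨s, hs, hx⟩ := h i hiF
      obtain ⟨t, ht, rfl⟩ := Finset.mem_image.1 hs
      exact hi t (hsub ht) ⟨hx.2, hx.1⟩
    have h2 := rk_lt (M := M✶) hE q.flatG (Set.ssubset_univ_iff.2 hqG)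
    have h3 := h.card_lt_rk hM hb he hF
    omega

/-- Nothing lies outside `q.G = E`, so `U` is empty and exactly `|L|` members stay below `q`. The
exact count then gives the rank of `q.F`. -/
theorem IsGreedy.rk_F_le (hM : IsGood M r) (h : IsGreedy M L T)
    (hb : IsBiflag M (insert q (greedyBiflag M L T))) (he : e ∈ gapSet M L T) (hF : e ∈ q.F)
    (hqG : q.G = Set.univ) (hc : L.card + T.card + 1 + m + k = n - 1)
    (hne : xmono M (insert q (greedyBiflag M L T)) * delta M ^ m * gamma M ^ k ≠ 0) :
    rk M q.F ≤ L.card + 1 := by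
  have hE := hM.ground
  have hG : e ∈ q.G := by rw [hqG]; trivial
  have hqF : q.F ≠ Set.univ := fun h => q.not_univ hE ⟨h, hqG⟩
  have hc0 := h.card_insert hM hb he hF hG
  obtain ⟨S₁, hS₁, ⟨U, hU, -⟩, hc₁, hne₁⟩ := exists_survivor_delta hE
    (FillState q L (insert q (greedyBiflag M L T)).card) (fun S hS h => h.exists_step hM hS) _ m _
    hb ⟨∅, BelowState.of_greedy hM h hb he hF hG, Or.inl rfl⟩ hne
  obtain ⟨S, hS, hsub, hcS, hnew, -⟩ := exists_gamma_survivor hM hS₁ hne₁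
  obtain ⟨i, hi⟩ := ((isBiflag_iff hE).1 hS).2
  have hbelow := (card_below_eq hM hS (by omega) hi (hsub hU.mem)).1
  rw [filter_lt_eq_of_subset hsub fun p hp hp' => (hnew p hp hp').2 q hU.mem hqF, hU.card] at hbelow
  have hU0 : U = ∅ := Finset.eq_empty_of_forall_notMem fun x hx => hU.notMem_G x hx (by
    rw [hqG]; trivial)
  have hiF : i ∉ q.F := fun h => hi q (hsub hU.mem) ⟨h, by rw [hqG]; trivial⟩
  rw [Biflat.gapHt, if_neg hiF, Biflat.ht, hqG, hU0, Finset.card_empty] at hbelow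
  omega

theorem IsGreedy.rk_G_le (hM : IsGood M r) (h : IsGreedy M L T)
    (hb : IsBiflag M (insert q (greedyBiflag M L T))) (he : e ∈ gapSet M L T) (hG : e ∈ q.G)
    (hqF : q.F = Set.univ) (hc : L.card + T.card + 1 + m + k = n - 1)
    (hne : xmono M (insert q (greedyBiflag M L T)) * delta M ^ m * gamma M ^ k ≠ 0) :
    rk M✶ q.G ≤ T.card + 1 := by
  have hE := hM.ground
  have hF : e ∈ q.F := by rw [hqF]; trivial
  have hc0 := h.card_insert hM hb he hF hG
  have hcim : ((insert q (greedyBiflag M L T)).image Biflat.swap).card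
      = (insert q (greedyBiflag M L T)).card :=
    Finset.card_image_of_injective _ Biflat.swap_injective
  obtain ⟨S₁, hS₁, ⟨U, hU, -⟩, hc₁, hne₁⟩ := exists_survivor_delta hE
    (fun S => FillState q.swap T (insert q (greedyBiflag M L T)).card (S.image Biflat.swap))
    (fun S hS h => FillState.exists_step_dual hM hS h) _ m _ hb
    ⟨∅, h.dual_belowState hM hb he hF hG, Or.inl hcim⟩ hne
  have hqS₁ : q ∈ S₁ := by
    obtain ⟨s, hs, hsq⟩ := Finset.mem_image.1 hU.mem
    exact Biflat.swap_injective hsq ▸ hs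
  obtain ⟨S, hS, hsub, hcS, hnew, -⟩ := exists_gamma_survivor hM hS₁ hne₁
  obtain ⟨i, hi⟩ := ((isBiflag_iff hE).1 hS).2
  have habove := (card_below_eq hM hS (by omega) hi (hsub hqS₁)).2
  have hfil : S.filter (q < ·) = S₁.filter (q < ·) := by
    ext p
    rw [Finset.mem_filter, Finset.mem_filter]
    refine ⟨fun hp => ⟨?_, hp.2⟩, fun hp => ⟨hsub hp.1, hp.2⟩⟩
    by_contra hcon
    refine (hnew p hp.1 hcon).1 (Set.univ_subset_iff.1 ?_)
    rw [← hqF]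
    exact hp.2.le.1
  have hcard := hU.card
  rw [card_filter_lt_swap, ← hfil] at hcard
  have hU0 : U = ∅ := Finset.eq_empty_of_forall_notMem fun x hx => hU.notMem_G x hx (by
    rw [Biflat.swap_G, hqF]; trivial)
  rw [hU0, Finset.card_empty] at hcard
  have hiF : i ∈ q.F := by rw [hqF]; trivial
  rw [Biflat.gapHt, if_pos hiF, Biflat.ht, hqF] at habove
  have h1 := hM.rk_univ
  have h2 := hM.rk_dual_univ
  omega

/-- Adding the two height bounds eliminates the height and gives `|q.F ∩ q.G| ≤ |L ∩ q.G| + |T ∩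
q.F|`. The two sets on the right are disjoint subsets of `q.F ∩ q.G` that both miss `e`. -/
theorem IsGreedy.xmono_mul_eq_zero_of_ne_univ (hM : IsGood M r) (h : IsGreedy M L T)
    (he : e ∈ gapSet M L T) (hF : e ∈ q.F) (hG : e ∈ q.G) (hqF : q.F ≠ Set.univ)
    (hqG : q.G ≠ Set.univ) (hc : L.card + T.card + 1 + m + k = n - 1) :
    xmono M (insert q (greedyBiflag M L T)) * delta M ^ m * gamma M ^ k = 0 := by
  by_contra hne
  have hb : IsBiflag M (insert q (greedyBiflag M L T)) := by
    by_contra hb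
    exact hne (by rw [xmono_eq_zero hb, zero_mul, zero_mul])
  have hE := hM.ground
  have h1 := h.ht_add_le hM hb he hF hG hqF hqG hc hne
  have h2 := h.le_ht_add hM hb he hF hG hqF hqG hc hne
  have h3 : (q.F ∩ q.G).ncard + (q.Fᶜ.ncard + q.Gᶜ.ncard) = n + 1 := by
    have hdisj : Disjoint q.Fᶜ q.Gᶜ := by
      rw [Set.disjoint_left]
      exact fun x hx hx' => (q.mem_union hE x).elim hx hx'
    rw [← Set.ncard_union_eq hdisj, ← Set.compl_inter, Set.ncard_add_ncard_compl,
      Nat.card_eq_fintype_card, Fintype.card_fin]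
  have hLF : ∀ x ∈ L, x ∈ q.F := fun x hx =>
    h.subset_F hM hb he hF (self_mem_closure hE hx)
  have hTG : ∀ x ∈ T, x ∈ q.G := fun x hx =>
    h.subset_G hM hb he hG (self_mem_closure (by simpa using hE) hx)
  have heL : e ∉ L := fun hx => (mem_gapSet.1 he).1 (self_mem_closure hE hx)
  have heT : e ∉ T := fun hx => (mem_gapSet.1 he).2 (self_mem_closure (by simpa using hE) hx)
  have h4 : ((insert e (L.filter (· ∈ q.G) ∪ T.filter (· ∈ q.F)) : Finset (Fin (n + 1))) :
      Set (Fin (n + 1))) ⊆ q.F ∩ q.G := by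
    intro x hx
    rw [Finset.mem_coe, Finset.mem_insert, Finset.mem_union, Finset.mem_filter,
      Finset.mem_filter] at hx
    rcases hx with rfl | hx | hx
    · exact ⟨hF, hG⟩
    · exact ⟨hLF x hx.1, hx.2⟩
    · exact ⟨hx.2, hTG x hx.1⟩
  have h5 := Set.ncard_le_ncard h4 (Set.toFinite _)
  rw [Set.ncard_coe_finset, Finset.card_insert_of_notMem (by simp [heL, heT]),
    Finset.card_union_of_disjoint (Finset.disjoint_filter_filter h.disjoint)] at h5
  have h6 := Finset.card_filter_add_card_filter_not (s := L) (· ∈ q.G)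
  have h7 := Finset.card_filter_add_card_filter_not (s := T) (· ∈ q.F)
  omega

end Greedy

end Kill

/-! ### Extended nbc biflags -/

section Lists

theorem coe_take_sort (X : Finset (Fin (n + 1))) {d : ℕ} {x : Fin (n + 1)}
    (hd : (X.sort fun a b => b ≤ a)[d]? = some x) :
    {e | e ∈ (X.sort fun a b => b ≤ a).take (d + 1)} = (atLeast X x : Set (Fin (n + 1))) := by
  have hs := List.pairwise_iff_getElem.1 (X.pairwise_sort fun a b => b ≤ a)
  have hnd := X.sort_nodup fun a b => b ≤ a
  have hmem : ∀ y, y ∈ X ↔ y ∈ X.sort fun a b => b ≤ a := fun y => (Finset.mem_sort _).symm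
  ext y
  rw [Finset.mem_coe, mem_atLeast, hmem]
  generalize (X.sort fun a b => b ≤ a) = l at *
  obtain ⟨hdl, rfl⟩ := List.getElem?_eq_some_iff.1 hd
  rw [Set.mem_ofPred_eq, List.mem_take_iff_getElem]
  constructor
  · rintro ⟨j, hj, rfl⟩
    refine ⟨List.getElem_mem _, ?_⟩
    rcases Nat.lt_or_ge j d with h | h
    · exact hs j d _ _ h
    · have : j = d := by omega
      subst this
      exact le_rfl
  · rintro ⟨hy, hle⟩
    obtain ⟨j, hj, rfl⟩ := List.mem_iff_getElem.1 hy
    refine ⟨j, ?_, rfl⟩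
    by_contra hcon
    have h1 : d < j := by omega
    exact h1.ne (hnd.getElem_inj_iff.1 (le_antisymm hle (hs d j hdl hj h1)))

theorem coe_drop_sort (X : Finset (Fin (n + 1))) {d : ℕ} {x : Fin (n + 1)}
    (hd : (X.sort fun a b => a ≤ b)[d]? = some x) :
    {e | e ∈ (X.sort fun a b => a ≤ b).drop d} = (atLeast X x : Set (Fin (n + 1))) := by
  have hs := List.pairwise_iff_getElem.1 (X.pairwise_sort fun a b => a ≤ b)
  have hnd := X.sort_nodup fun a b => a ≤ b
  have hmem : ∀ y, y ∈ X ↔ y ∈ X.sort fun a b => a ≤ b := fun y => (Finset.mem_sort _).symm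
  ext y
  rw [Finset.mem_coe, mem_atLeast, hmem]
  generalize (X.sort fun a b => a ≤ b) = l at *
  obtain ⟨hdl, rfl⟩ := List.getElem?_eq_some_iff.1 hd
  rw [Set.mem_ofPred_eq, List.mem_drop_iff_getElem]
  constructor
  · rintro ⟨j, hj, rfl⟩
    refine ⟨List.getElem_mem _, ?_⟩
    rcases Nat.eq_zero_or_pos j with h | h
    · subst h
      exact le_rfl
    · exact hs d (d + j) _ _ (by omega)
  · rintro ⟨hy, hle⟩
    obtain ⟨j, hj, rfl⟩ := List.mem_iff_getElem.1 hy
    have h1 : d ≤ j := by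
      by_contra hcon
      have h1 : j < d := by omega
      exact h1.ne' (hnd.getElem_inj_iff.1 (le_antisymm hle (hs j d hj hdl h1)))
    exact ⟨j - d, by omega, by congr 1; omega⟩

end Lists

/-! ### Multiplication of greedy biflags by powers of `γ` -/

section Extended

variable {M : Matroid (Fin (n + 1))} {B : Finset (Fin (n + 1))} {k : ℕ}

theorem IsGreedy.card_greedyBiflag (hM : IsGood M r) {L T : Finset (Fin (n + 1))}
    (h : IsGreedy M L T) : (greedyBiflag M L T).card = L.card + T.card := by
  have h1 := card_filter_greedyBiflag hM h
  have h2 := card_filter_greedyBiflag hM.dual h.dual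
  rw [← image_swap_greedyBiflag, Finset.filter_image,
    Finset.card_image_of_injective _ Biflat.swap_injective] at h2
  have h3 := Finset.card_filter_add_card_filter_not (s := greedyBiflag M L T)
    fun p => p.G = Set.univ
  rw [← h3, h1, ← h2]
  congr 2
  refine Finset.filter_congr fun p hp => ⟨fun hG => ?_, fun hF hG => p.not_univ hM.ground ⟨hF, hG⟩⟩
  exact (mem_greedyBiflag.1 hp).elim (fun h => absurd h.1 hG) fun h => h.1

theorem notMem_closure_of_base (hB : M.IsBase (B : Set (Fin (n + 1)))) {Y : Set (Fin (n + 1))}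
    (hY : Y ⊆ B) {x : Fin (n + 1)} (hx : x ∈ B) (hxY : x ∉ Y) : x ∉ M.closure Y := fun h =>
  hB.indep.notMem_closure_sdiff_of_mem (Finset.mem_coe.2 hx) (M.closure_subset_closure
    (Set.subset_sdiff_singleton hY hxY) h)

/-- The elements of `S` together with the `t` largest internally active elements. -/
def lowSet (M : Matroid (Fin (n + 1))) (B : Finset (Fin (n + 1))) (t : ℕ) : Set (Fin (n + 1)) :=
  (setS M B : Set (Fin (n + 1))) ∪ {e | e ∈ (listC M B).take t}

/-- The coflat paired with `cl(lowSet M B t)` in the extended nbc biflag. -/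
def lowCoflat (M : Matroid (Fin (n + 1))) (B : Finset (Fin (n + 1))) (t : ℕ) : Set (Fin (n + 1)) :=
  if t < switchIndex M B then Set.univ else M✶.closure (setT B)

theorem mem_intActive_iff_exists {x : Fin (n + 1)} :
    x ∈ intActive M B ↔ ∃ u : ℕ, (listC M B)[u]? = some x := by
  rw [← List.mem_iff_getElem?, listC, Finset.mem_sort]

theorem length_listC : (listC M B).length = (intActive M B).card := Finset.length_sort _

theorem mem_lowSet {t : ℕ} {x : Fin (n + 1)} :
    x ∈ lowSet M B t ↔ x ∈ setS M B ∨ ∃ u < t, (listC M B)[u]? = some x := by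
  rw [lowSet, Set.mem_union, Finset.mem_coe, Set.mem_ofPred_eq, List.mem_take_iff_getElem]
  refine or_congr_right ⟨?_, ?_⟩
  · rintro ⟨j, hj, rfl⟩
    exact ⟨j, by omega, List.getElem?_eq_getElem _⟩
  · rintro ⟨u, hu, h⟩
    obtain ⟨h1, h2⟩ := List.getElem?_eq_some_iff.1 h
    exact ⟨u, by omega, h2⟩

theorem lowSet_mono {t u : ℕ} (h : t ≤ u) : lowSet M B t ⊆ lowSet M B u := fun x hx => by
  rw [mem_lowSet] at hx ⊢
  exact hx.imp id fun ⟨v, hv, h'⟩ => ⟨v, by omega, h'⟩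

theorem setS_subset_lowSet (t : ℕ) : (setS M B : Set (Fin (n + 1))) ⊆ lowSet M B t :=
  Set.subset_union_left

theorem intActive_subset : intActive M B ⊆ B := fun _ h => ((Finset.mem_filter_univ _).1 h).1

theorem lowSet_subset (t : ℕ) : lowSet M B t ⊆ B := fun x hx => by
  rcases mem_lowSet.1 hx with h | ⟨u, -, h⟩
  · exact setS_subset h
  · exact intActive_subset (mem_intActive_iff_exists.2 ⟨u, h⟩)

theorem index_unique {t u : ℕ} {x : Fin (n + 1)} (ht : (listC M B)[t]? = some x)
    (hu : (listC M B)[u]? = some x) : t = u := by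
  obtain ⟨h1, h2⟩ := List.getElem?_eq_some_iff.1 ht
  obtain ⟨h3, h4⟩ := List.getElem?_eq_some_iff.1 hu
  exact (Finset.sort_nodup _ _).getElem_inj_iff.1 (h2.trans h4.symm)

theorem notMem_setS_of_getElem {t : ℕ} {x : Fin (n + 1)} (ht : (listC M B)[t]? = some x) :
    x ∉ setS M B := fun h => (Finset.mem_sdiff.1 h).2 (mem_intActive_iff_exists.2 ⟨t, ht⟩)

theorem notMem_lowSet {t u : ℕ} {x : Fin (n + 1)} (ht : (listC M B)[t]? = some x) (hu : u ≤ t) :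
    x ∉ lowSet M B u := fun h => by
  rcases mem_lowSet.1 h with h | ⟨v, hv, h⟩
  · exact notMem_setS_of_getElem ht h
  · have := index_unique ht h
    omega

theorem notMem_closure_lowSet (hB : M.IsBase (B : Set (Fin (n + 1)))) {t u : ℕ} {x : Fin (n + 1)}
    (ht : (listC M B)[t]? = some x) (hu : u ≤ t) : x ∉ M.closure (lowSet M B u) :=
  notMem_closure_of_base hB (lowSet_subset u)
    (intActive_subset (mem_intActive_iff_exists.2 ⟨t, ht⟩)) (notMem_lowSet ht hu)

theorem lowSet_zero : lowSet M B 0 = setS M B := by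
  simp [lowSet]

theorem lowSet_succ {t : ℕ} {x : Fin (n + 1)} (ht : (listC M B)[t]? = some x) :
    lowSet M B (t + 1) = insert x (lowSet M B t) := by
  ext y
  rw [Set.mem_insert_iff, mem_lowSet, mem_lowSet]
  constructor
  · rintro (h | ⟨u, hu, h⟩)
    · exact Or.inr (Or.inl h)
    · rcases Nat.lt_succ_iff_lt_or_eq.1 hu with hu | rfl
      · exact Or.inr (Or.inr ⟨u, hu, h⟩)
      · rw [ht] at h
        exact Or.inl (Option.some.inj h).symm
  · rintro (rfl | h | ⟨u, hu, h⟩)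
    · exact Or.inr ⟨t, Nat.lt_succ_self t, ht⟩
    · exact Or.inl h
    · exact Or.inr ⟨u, by omega, h⟩

theorem exists_getElem {t : ℕ} (ht : t < (intActive M B).card) :
    ∃ x, (listC M B)[t]? = some x := by
  rw [← length_listC] at ht
  exact ⟨_, List.getElem?_eq_getElem ht⟩

theorem rk_lowSet (hM : IsGood M r) (hB : M.IsBase (B : Set (Fin (n + 1)))) {t : ℕ}
    (ht : t ≤ (intActive M B).card) : rk M (lowSet M B t) = (setS M B).card + t := by
  induction t with
  | zero =>
    rw [lowSet_zero, rk_of_indep (hB.indep.subset (Finset.coe_subset.2 setS_subset)),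
      Set.ncard_coe_finset, add_zero]
  | succ t ih =>
    obtain ⟨x, hx⟩ := exists_getElem (M := M) (B := B) (t := t) (by omega)
    rw [lowSet_succ hx, rk_insert hM.ground (notMem_closure_lowSet hB hx le_rfl), ih (by omega),
      add_assoc]

theorem closure_lowSet_ne_univ (hB : M.IsBase (B : Set (Fin (n + 1)))) {t : ℕ}
    (ht : t < (intActive M B).card) : M.closure (lowSet M B t) ≠ Set.univ := fun h => by
  obtain ⟨x, hx⟩ := exists_getElem ht
  refine notMem_closure_lowSet hB hx le_rfl ?_
  rw [h]; trivial

theorem mem_switch_filter {i : ℕ} : i ∈ ({i ∈ Finset.Icc 1 (intActive M B).card |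
    ∃ c, (listC M B)[i - 1]? = some c ∧ c ∉ M.closure (setS M B) ∪ M✶.closure (setT B)} :
      Finset ℕ) ↔ 1 ≤ i ∧ ∃ c ∈ gapSet M (setS M B) (setT B), (listC M B)[i - 1]? = some c := by
  rw [Finset.mem_filter, Finset.mem_Icc]
  constructor
  · rintro ⟨h1, c, h2, h3⟩
    exact ⟨h1.1, c, h3, h2⟩
  · rintro ⟨h1, c, h2, h3⟩
    obtain ⟨h4, -⟩ := List.getElem?_eq_some_iff.1 h3
    rw [length_listC] at h4
    exact ⟨⟨h1, by omega⟩, c, h3, h2⟩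

theorem lt_switchIndex {t : ℕ} {c : Fin (n + 1)} (hc : (listC M B)[t]? = some c)
    (hg : c ∈ gapSet M (setS M B) (setT B)) : t < switchIndex M B :=
  Finset.le_sup (f := id) (mem_switch_filter.2 ⟨Nat.le_add_left 1 t, c, hg, hc⟩)

/-- Elements outside of `cl^⊥(T)` and `cl(S)` come before the switch index. -/
theorem IsNbcBasis.mem_closure_lowSet (hM : IsGood M r) (hB : IsNbcBasis M B) {t : ℕ}
    (ht : ∀ u c, (listC M B)[u]? = some c → c ∈ gapSet M (setS M B) (setT B) → u < t)
    {x : Fin (n + 1)} (hx : x ∉ M✶.closure (setT B : Set (Fin (n + 1)))) :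
    x ∈ M.closure (lowSet M B t) := by
  have hE := hM.ground
  obtain ⟨z, hz⟩ := exists_isLeast_compl hM hB.1
  have key : ∀ x ∈ B, x ∉ M✶.closure (setT B : Set (Fin (n + 1))) →
      x ∈ M.closure (lowSet M B t) := by
    intro x hxB hx
    refine M.mem_closure_of_mem' (mem_lowSet.2 ?_) (by rw [hE]; trivial)
    by_cases hxS : x ∈ setS M B
    · exact Or.inl hxS
    · right
      have hxI : x ∈ intActive M B := by
        by_contra h
        exact hxS (Finset.mem_sdiff.2 ⟨hxB, h⟩)
      obtain ⟨u, hu⟩ := mem_intActive_iff_exists.1 hxI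
      exact ⟨u, ht u x hu (mem_gapSet.2 ⟨notMem_closure_of_base hB.1
        (Finset.coe_subset.2 setS_subset) hxB hxS, hx⟩), hu⟩
  by_cases hxB : x ∈ B
  · exact key x hxB hx
  · have hxz : x = z := by
      by_contra hne
      refine hx (self_mem_closure (by simpa using hE) ?_)
      rw [setT_eq hz, Finset.mem_erase, Finset.mem_compl]
      exact ⟨hne, hxB⟩
    subst hxz
    -- The element `z` is spanned by its exchange partners in `B`, and these avoid `cl^⊥(T)` by
    -- duality of exchange.
    refine mem_closure_of_exchange hE hB.1 hz.1 fun f hf hcl => key f hf ?_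
    rw [coe_setT_eq hz]
    exact (notMem_closure_iff_dual hE hB.1 hz.1 hf).1 hcl

/-- If no active element were in the gap, everything outside `cl^⊥(T)` would be in `cl(S)`,
including `z`. So the supremum defining the switch index is attained, not the default value zero. -/
theorem IsNbcBasis.exists_switch (hM : IsGood M r) (hB : IsNbcBasis M B) :
    ∃ t c, switchIndex M B = t + 1 ∧ (listC M B)[t]? = some c ∧
      c ∈ gapSet M (setS M B) (setT B) := by
  have hne : ({i ∈ Finset.Icc 1 (intActive M B).card | ∃ c, (listC M B)[i - 1]? = some c ∧
      c ∉ M.closure (setS M B) ∪ M✶.closure (setT B)} : Finset ℕ).Nonempty := by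
    by_contra hcon
    rw [Finset.not_nonempty_iff_eq_empty] at hcon
    obtain ⟨z, hz⟩ := exists_isLeast_compl hM hB.1
    have hzg := mem_gapSet.1 (hB.isGreatest hM.ground hz).1
    refine hzg.1 ?_
    rw [← lowSet_zero]
    refine hB.mem_closure_lowSet hM (fun u c hu hc => ?_) hzg.2
    have : u + 1 ∈ (∅ : Finset ℕ) := by
      rw [← hcon]
      exact mem_switch_filter.2 ⟨Nat.le_add_left 1 u, c, hc, hu⟩
    simp at this
  obtain ⟨i, hi, hsup⟩ := Finset.exists_mem_eq_sup _ hne id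
  obtain ⟨h1, c, hc, hic⟩ := mem_switch_filter.1 hi
  exact ⟨i - 1, c, hsup.trans (by simp only [id]; omega), hic, hc⟩

theorem IsNbcBasis.closure_union_eq_univ (hM : IsGood M r) (hB : IsNbcBasis M B) {t : ℕ}
    (ht : switchIndex M B ≤ t) :
    M.closure (lowSet M B t) ∪ M✶.closure (setT B : Set (Fin (n + 1))) = Set.univ := by
  refine Set.eq_univ_of_forall fun x => ?_
  by_contra hcon
  rw [Set.mem_union, not_or] at hcon
  exact hcon.1 (hB.mem_closure_lowSet hM (fun u c hu hc => (lt_switchIndex hu hc).trans_le ht)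
    hcon.2)

theorem IsNbcBasis.exists_notMem_union (hM : IsGood M r) (hB : IsNbcBasis M B) :
    ∃ c ∈ gapSet M (setS M B) (setT B), ∀ t < switchIndex M B, c ∉ M.closure (lowSet M B t) := by
  obtain ⟨t, c, hs, hc, hg⟩ := hB.exists_switch hM
  exact ⟨c, hg, fun u hu => notMem_closure_lowSet hB.1 hc (by omega)⟩

theorem IsNbcBasis.isBiflat (hM : IsGood M r) (hB : IsNbcBasis M B) {t : ℕ} (h0 : 0 < t)
    (ht : t < (intActive M B).card) :
    IsBiflat M (M.closure (lowSet M B t)) (lowCoflat M B t) := by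
  have hne := closure_lowSet_ne_univ hB.1 ht
  obtain ⟨x, hx⟩ := exists_getElem (M := M) (B := B) (t := 0) (by omega)
  have hx' : x ∈ M.closure (lowSet M B t) := M.mem_closure_of_mem'
    (mem_lowSet.2 (Or.inr ⟨0, h0, hx⟩)) (by rw [hM.ground]; trivial)
  rw [lowCoflat]
  split_ifs with hs
  · exact isBiflat_univ hM (M.isFlat_closure _) ⟨x, hx'⟩ hne
  · have hun := hB.closure_union_eq_univ hM (not_lt.1 hs)
    refine ⟨M.isFlat_closure _, M✶.isFlat_closure _, ⟨x, hx'⟩, ?_, fun h => hne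
      (h.1.trans hM.ground), hun.trans hM.ground.symm⟩
    by_contra hcon
    rw [Set.not_nonempty_iff_eq_empty] at hcon
    rw [hcon, Set.union_empty] at hun
    exact hne hun

/-- The first columns of the extended nbc biflag of `B`, together with its columns `E|G`. -/
def partialBiflag (M : Matroid (Fin (n + 1))) (B : Finset (Fin (n + 1))) (t : ℕ) :
    Finset (Biflat M) :=
  greedyBiflag M (setS M B) (setT B) ∪
    Finset.univ.filter fun p => ∃ u, 0 < u ∧ u ≤ t ∧
      p.F = M.closure (lowSet M B u) ∧ p.G = lowCoflat M B u

theorem mem_partialBiflag {t : ℕ} {p : Biflat M} : p ∈ partialBiflag M B t ↔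
    p ∈ greedyBiflag M (setS M B) (setT B) ∨
      ∃ u, 0 < u ∧ u ≤ t ∧ p.F = M.closure (lowSet M B u) ∧ p.G = lowCoflat M B u := by
  simp only [partialBiflag, Finset.mem_union, Finset.mem_filter, Finset.mem_univ, true_and]

theorem partialBiflag_zero : partialBiflag M B 0 = greedyBiflag M (setS M B) (setT B) := by
  ext p
  rw [mem_partialBiflag]
  refine ⟨fun h => h.resolve_right ?_, Or.inl⟩
  rintro ⟨u, h1, h2, -⟩
  omega

theorem partialBiflag_succ {t : ℕ} {p : Biflat M} (hF : p.F = M.closure (lowSet M B (t + 1)))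
    (hG : p.G = lowCoflat M B (t + 1)) :
    partialBiflag M B (t + 1) = insert p (partialBiflag M B t) := by
  ext q
  rw [Finset.mem_insert, mem_partialBiflag, mem_partialBiflag]
  constructor
  · rintro (h | ⟨u, h1, h2, h3, h4⟩)
    · exact Or.inr (Or.inl h)
    · rcases Nat.lt_or_ge t u with h | h
      · have : u = t + 1 := by omega
        subst this
        exact Or.inl (biflat_ext (h3.trans hF.symm) (h4.trans hG.symm))
      · exact Or.inr (Or.inr ⟨u, h1, h, h3, h4⟩)
  · rintro (rfl | h | ⟨u, h1, h2, h3, h4⟩)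
    · exact Or.inr ⟨t + 1, Nat.succ_pos t, le_rfl, hF, hG⟩
    · exact Or.inl h
    · exact Or.inr ⟨u, h1, by omega, h3, h4⟩

theorem F_subset_of_mem_greedyBiflag {L T : Finset (Fin (n + 1))} {p : Biflat M}
    (hp : p ∈ greedyBiflag M L T) (hF : p.F ≠ Set.univ) :
    p.F ⊆ M.closure (L : Set (Fin (n + 1))) := by
  rcases mem_greedyBiflag.1 hp with ⟨-, x, -, h⟩ | ⟨h, -⟩
  · rw [h]; exact closure_atLeast_subset _ _ _
  · exact absurd h hF

theorem F_subset_of_mem_partialBiflag {t : ℕ} {p : Biflat M} (hp : p ∈ partialBiflag M B t)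
    (hF : p.F ≠ Set.univ) : p.F ⊆ M.closure (lowSet M B t) := by
  rcases mem_partialBiflag.1 hp with h | ⟨u, -, hu, h, -⟩
  · exact (F_subset_of_mem_greedyBiflag h hF).trans
      (M.closure_subset_closure (setS_subset_lowSet t))
  · rw [h]
    exact M.closure_subset_closure (lowSet_mono hu)

theorem IsNbcBasis.card_partialBiflag (hM : IsGood M r) (hB : IsNbcBasis M B) {t : ℕ}
    (ht : t < (intActive M B).card) :
    (partialBiflag M B t).card = (setS M B).card + (setT B).card + t := by
  induction t with
  | zero => rw [partialBiflag_zero, (hB.isGreedy hM).card_greedyBiflag hM, add_zero]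
  | succ t ih =>
    obtain ⟨x, hx⟩ := exists_getElem (M := M) (B := B) (t := t) (by omega)
    obtain ⟨p, hF, hG⟩ : ∃ p : Biflat M, p.F = M.closure (lowSet M B (t + 1)) ∧
        p.G = lowCoflat M B (t + 1) := ⟨⟨(_, _), hB.isBiflat hM (Nat.succ_pos t) ht⟩, rfl, rfl⟩
    have hne : p.F ≠ Set.univ := hF ▸ closure_lowSet_ne_univ hB.1 ht
    rw [partialBiflag_succ hF hG, Finset.card_insert_of_notMem, ih (by omega), add_assoc]
    refine fun hp => notMem_closure_lowSet hB.1 hx le_rfl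
      (F_subset_of_mem_partialBiflag hp hne ?_)
    rw [hF]
    exact M.mem_closure_of_mem' (mem_lowSet.2 (Or.inr ⟨t, Nat.lt_succ_self t, hx⟩))
      (by rw [hM.ground]; trivial)

theorem closure_atLeast_anti (N : Matroid (Fin (n + 1))) (L : Finset (Fin (n + 1)))
    {e f : Fin (n + 1)} (h : e ≤ f) :
    N.closure (atLeast L f : Set (Fin (n + 1))) ⊆ N.closure (atLeast L e : Set (Fin (n + 1))) :=
  N.closure_subset_closure fun x hx => by
    have := mem_atLeast.1 (Finset.mem_coe.1 hx)
    exact mem_atLeast.2 ⟨this.1, h.trans this.2⟩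

theorem lowCoflat_anti {t u : ℕ} (h : t ≤ u) : lowCoflat M B u ⊆ lowCoflat M B t := by
  unfold lowCoflat
  split_ifs with h1 h2
  · exact subset_rfl
  · omega
  · exact Set.subset_univ _
  · exact subset_rfl

theorem closure_setT_subset_lowCoflat (t : ℕ) :
    M✶.closure (setT B : Set (Fin (n + 1))) ⊆ lowCoflat M B t := by
  unfold lowCoflat
  split_ifs
  · exact Set.subset_univ _
  · exact subset_rfl

/-- The active element at the switch index witnesses the gap: columns before the switch miss it in
the flat, later ones in the coflat. -/
theorem IsNbcBasis.isBiflag_partialBiflag (hM : IsGood M r) (hB : IsNbcBasis M B) (t : ℕ) :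
    IsBiflag M (partialBiflag M B t) := by
  have hS : ∀ e u, M.closure (atLeast (setS M B) e : Set (Fin (n + 1))) ⊆
      M.closure (lowSet M B u) := fun e u => (closure_atLeast_subset _ _ _).trans
    (M.closure_subset_closure (setS_subset_lowSet u))
  have hT : ∀ e u, M✶.closure (atLeast (setT B) e : Set (Fin (n + 1))) ⊆ lowCoflat M B u :=
    fun e u => (closure_atLeast_subset _ _ _).trans (closure_setT_subset_lowCoflat u)
  refine (isBiflag_iff hM.ground).2 ⟨fun p hp q hq => ?_, ?_⟩
  · rw [mem_partialBiflag, mem_greedyBiflag] at hp hq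
    simp only [biflat_le_iff]
    rcases hp with (⟨pG, e, -, pF⟩ | ⟨pF, e, -, pG⟩) | ⟨u, -, -, pF, pG⟩ <;>
    rcases hq with (⟨qG, f, -, qF⟩ | ⟨qF, f, -, qG⟩) | ⟨v, -, -, qF, qG⟩ <;>
    rw [pF, pG, qF, qG]
    · rcases le_total e f with h | h
      · exact Or.inr ⟨closure_atLeast_anti _ _ h, subset_rfl⟩
      · exact Or.inl ⟨closure_atLeast_anti _ _ h, subset_rfl⟩
    · exact Or.inl ⟨Set.subset_univ _, Set.subset_univ _⟩
    · exact Or.inl ⟨hS e v, Set.subset_univ _⟩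
    · exact Or.inr ⟨Set.subset_univ _, Set.subset_univ _⟩
    · rcases le_total e f with h | h
      · exact Or.inl ⟨subset_rfl, closure_atLeast_anti _ _ h⟩
      · exact Or.inr ⟨subset_rfl, closure_atLeast_anti _ _ h⟩
    · exact Or.inr ⟨Set.subset_univ _, hT e v⟩
    · exact Or.inr ⟨hS f u, Set.subset_univ _⟩
    · exact Or.inl ⟨Set.subset_univ _, hT f u⟩
    · rcases le_total u v with h | h
      · exact Or.inl ⟨M.closure_subset_closure (lowSet_mono h), lowCoflat_anti h⟩
      · exact Or.inr ⟨M.closure_subset_closure (lowSet_mono h), lowCoflat_anti h⟩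
  · obtain ⟨c, hc, hlow⟩ := hB.exists_notMem_union hM
    refine ⟨c, fun p hp => ?_⟩
    rcases mem_partialBiflag.1 hp with h | ⟨u, -, -, hF, hG⟩
    · exact notMem_gap_of_mem_greedyBiflag h hc
    · rw [hF, hG, lowCoflat]
      split_ifs with hu
      · exact fun h => hlow u hu h.1
      · exact fun h => (mem_gapSet.1 hc).2 h.2

theorem IsNbcBasis.extBiflag_eq (hM : IsGood M r) (hB : IsNbcBasis M B)
    (hk : (intActive M B).card = k + 1) : extBiflag M B = partialBiflag M B k := by
  have hE := hM.ground
  have h1 := card_setS hM hB.1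
  have h2 := card_setT hM hB.1
  have hr := hM.r_lt
  obtain ⟨i, c, hi, hic, -⟩ := hB.exists_switch hM
  have hile : i < (intActive M B).card := by
    rw [← length_listC]
    exact (List.getElem?_eq_some_iff.1 hic).1
  have hlS : (listS M B).length = (setS M B).card := Finset.length_sort _
  have hlT : (listT B).length = (setT B).card := Finset.length_sort _
  ext p
  simp only [extBiflag, Finset.mem_filter, Finset.mem_univ, true_and]
  rw [mem_partialBiflag, mem_greedyBiflag]
  constructor
  · rintro ⟨j, hj, hF, hG⟩
    rw [Finset.mem_Icc] at hj
    unfold extF at hF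
    unfold extG at hG
    by_cases hjs : j ≤ (setS M B).card
    · left; left
      rw [if_pos hjs] at hF
      -- The switch index is at least one, so every column up to `|S|` has coflat `E`.
      rw [if_pos (by omega), hE] at hG
      obtain ⟨d, rfl⟩ : ∃ d, j = d + 1 := ⟨j - 1, by omega⟩
      have hdl : d < (listS M B).length := by omega
      have hd := List.getElem?_eq_getElem hdl
      rw [listS, coe_take_sort _ hd] at hF
      exact ⟨hG, _, (Finset.mem_sort _).1 (List.getElem_mem hdl), hF⟩
    · rw [if_neg hjs] at hF
      by_cases hjr : j + 1 ≤ (setS M B).card + (intActive M B).card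
      · right
        rw [if_pos hjr] at hF
        refine ⟨j - (setS M B).card, by omega, by omega, hF, ?_⟩
        rw [hG, lowCoflat]
        by_cases hji : j + 1 ≤ (setS M B).card + switchIndex M B
        · rw [if_pos hji, if_pos (by omega), hE]
        · rw [if_neg hji, if_pos hjr, if_neg (by omega)]
      · left; right
        rw [if_neg hjr, hE] at hF
        rw [if_neg (by omega), if_neg hjr] at hG
        generalize hdd : j - ((setS M B).card + (intActive M B).card) = d at hG
        have hdl : d < (listT B).length := by omega
        have hd := List.getElem?_eq_getElem hdl
        rw [listT, coe_drop_sort _ hd] at hG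
        exact ⟨hF, _, (Finset.mem_sort _).1 (List.getElem_mem hdl), hG⟩
  · rintro ((⟨hG, e, he, hF⟩ | ⟨hF, e, he, hG⟩) | ⟨u, hu0, huk, hF, hG⟩)
    · have he' : e ∈ listS M B := (Finset.mem_sort _).2 he
      obtain ⟨d, hd⟩ := List.mem_iff_getElem?.1 he'
      have hdl := (List.getElem?_eq_some_iff.1 hd).1
      refine ⟨d + 1, Finset.mem_Icc.2 ⟨by omega, by omega⟩, ?_, ?_⟩
      · rw [extF, if_pos (by omega), hF, listS, coe_take_sort _ hd]
      · rw [extG, if_pos (by omega), hG, hE]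
    · have he' : e ∈ listT B := (Finset.mem_sort _).2 he
      obtain ⟨d, hd⟩ := List.mem_iff_getElem?.1 he'
      have hdl := (List.getElem?_eq_some_iff.1 hd).1
      -- Since `|S| + |IA(B)| = r + 1`, the first column with flat `E` is column `r + 1`, where no
      -- entry of `T` has been dropped.
      refine ⟨d + (r + 1), Finset.mem_Icc.2 ⟨by omega, by omega⟩, ?_, ?_⟩
      · rw [extF, if_neg (by omega), if_neg (by omega), hF, hE]
      · rw [extG, if_neg (by omega), if_neg (by omega), hG, h1, Nat.add_sub_cancel, listT,
          coe_drop_sort _ hd]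
    · refine ⟨(setS M B).card + u, Finset.mem_Icc.2 ⟨by omega, by omega⟩, ?_, ?_⟩
      · rw [extF, if_neg (by omega), if_pos (by omega), hF, Nat.add_sub_cancel_left, lowSet]
      · rw [extG, hG, lowCoflat]
        by_cases hui : u < switchIndex M B
        · rw [if_pos hui, if_pos (by omega), hE]
        · rw [if_neg hui, if_neg (by omega), if_pos (by omega)]

/-- The extended nbc biflags are biflags of length `n - 1`. -/
theorem isBiflag_extBiflag (hM : IsGood M r) (hB : B ∈ nbcBases M (k + 1)) :
    IsBiflag M (extBiflag M B) ∧ (extBiflag M B).card = n - 1 := by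
  obtain ⟨hB, hk⟩ := (Finset.mem_filter_univ _).1 hB
  rw [hB.extBiflag_eq hM hk]
  refine ⟨hB.isBiflag_partialBiflag hM k, ?_⟩
  have h1 := card_setS hM hB.1
  have h2 := card_setT hM hB.1
  rw [hB.card_partialBiflag hM (by omega)]
  omega

/-- Represent `γ` at the next active element `x`, which is outside all proper flats so far. The
factors still to come bound the rank of the new flat, leaving only the closure of the next `lowSet`.
-/
theorem IsNbcBasis.xmono_partialBiflag_mul_gamma (hM : IsGood M r) (hB : IsNbcBasis M B)
    {t m : ℕ} (ht : t + 1 + m + 1 = (intActive M B).card) :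
    xmono M (partialBiflag M B t) * gamma M ^ (m + 1) =
      xmono M (partialBiflag M B (t + 1)) * gamma M ^ m := by
  have hE := hM.ground
  have hgr := hB.isGreedy hM
  obtain ⟨x, hx⟩ := exists_getElem (M := M) (B := B) (t := t) (by omega)
  have hxcl := notMem_closure_lowSet hB.1 hx le_rfl
  obtain ⟨p, hpF, hpG⟩ : ∃ p : Biflat M, p.F = M.closure (lowSet M B (t + 1)) ∧
      p.G = lowCoflat M B (t + 1) :=
    ⟨⟨(_, _), hB.isBiflat hM (Nat.succ_pos t) (by omega)⟩, rfl, rfl⟩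
  have hne : p.F ≠ Set.univ := hpF ▸ closure_lowSet_ne_univ hB.1 (by omega)
  have hxp : x ∈ p.F := by
    rw [hpF]
    exact M.mem_closure_of_mem' (mem_lowSet.2 (Or.inr ⟨t, Nat.lt_succ_self t, hx⟩))
      (by rw [hE]; trivial)
  have hsubσ : greedyBiflag M (setS M B) (setT B) ⊆ partialBiflag M B t := fun q hq =>
    mem_partialBiflag.2 (Or.inl hq)
  rw [pow_succ', ← mul_assoc, mul_comm (xmono M _), gamma_mul_xmono hE (i := x) ?_, Finset.sum_mul,
    partialBiflag_succ hpF hpG]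
  swap
  · intro q hq hxq
    by_contra hqF
    exact hxcl (F_subset_of_mem_partialBiflag hq hqF hxq)
  refine Finset.sum_eq_single p (fun q hq hqp => ?_) fun hp => ?_
  · by_contra hq0
    refine hqp ?_
    obtain ⟨⟨hxq, hqF⟩, hb⟩ := (Finset.mem_filter.1 hq).2
    obtain ⟨S, -, -, -, -, hrk⟩ := exists_gamma_survivor hM hb hq0
    have hrk := hrk q (Finset.mem_insert_self _ _) hqF
    have hcomp : ∀ s ∈ partialBiflag M B t, s ≤ q ∨ q ≤ s := fun s hs =>
      hb.le_or_le (Finset.mem_insert_of_mem hs) (Finset.mem_insert_self _ _)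
    have hlow : M.closure (lowSet M B t) ⊆ q.F := by
      rcases Nat.eq_zero_or_pos t with rfl | h0
      · rw [← q.flatF.closure]
        refine M.closure_subset_closure fun y hy => ?_
        have hyS : y ∈ setS M B := by rwa [lowSet_zero] at hy
        obtain ⟨s, hsF, hsG⟩ : ∃ s : Biflat M,
            s.F = M.closure (atLeast (setS M B) y : Set (Fin (n + 1))) ∧ s.G = Set.univ :=
          ⟨⟨(_, _), hgr.isBiflat hM hyS⟩, rfl, rfl⟩
        have hsσ : s ∈ greedyBiflag M (setS M B) (setT B) :=
          mem_greedyBiflag.2 (Or.inl ⟨hsG, y, hyS, hsF⟩)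
        refine ((hcomp s (hsubσ hsσ)).resolve_right fun h => hxcl ?_).1 ?_
        · exact F_subset_of_mem_partialBiflag (hsubσ hsσ) (fun h' => s.not_univ hE ⟨h', hsG⟩)
            (h.1 hxq)
        · rw [hsF]
          exact self_mem_closure hE (mem_atLeast.2 ⟨hyS, le_rfl⟩)
      · obtain ⟨s, hsF, hsG⟩ : ∃ s : Biflat M, s.F = M.closure (lowSet M B t) ∧
            s.G = lowCoflat M B t := ⟨⟨(_, _), hB.isBiflat hM h0 (by omega)⟩, rfl, rfl⟩
        rw [← hsF]
        refine ((hcomp s (mem_partialBiflag.2 (Or.inr ⟨t, h0, le_rfl, hsF, hsG⟩))).resolve_right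
          fun h => hxcl ?_).1
        rw [← hsF]
        exact h.1 hxq
    have hlowG : M✶.closure (setT B : Set (Fin (n + 1))) ⊆ q.G := by
      rw [← q.flatG.closure]
      refine M✶.closure_subset_closure fun y hy => ?_
      have hym := self_mem_closure (M := M✶) (by simpa using hE)
        (mem_atLeast.2 ⟨hy, le_rfl⟩ : y ∈ atLeast (setT B) y)
      obtain ⟨g, hg⟩ := hgr.nonempty
      obtain ⟨s, hsF, hsG⟩ := exists_biflat_of_coflat hM (M✶.isFlat_closure _) hym
        fun h => (mem_gapSet.1 hg).2 (closure_atLeast_subset _ _ _ h)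
      have hsσ : s ∈ greedyBiflag M (setS M B) (setT B) :=
        mem_greedyBiflag.2 (Or.inr ⟨hsF, y, hy, hsG⟩)
      refine ((hcomp s (hsubσ hsσ)).resolve_left fun h => hqF (Set.univ_subset_iff.1 ?_)).2 ?_
      · rw [← hsF]; exact h.1
      · rw [hsG]; exact hym
    have hr0 := rk_lowSet hM hB.1 (t := t) (by omega)
    have h1 := card_setS hM hB.1
    have h2 := card_setT hM hB.1
    have hF : q.F = p.F := by
      rw [hpF, lowSet_succ hx, ← M.closure_insert_closure_eq_closure_insert]
      exact flat_eq_closure_insert hE (M.isFlat_closure _) q.flatF hlow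
        (by rw [rk_closure]; omega) hxq hxcl
    have hrT := rk_of_indep (hgr.dual_indep hE)
    rw [Set.ncard_coe_finset, ← rk_closure] at hrT
    have hru := hM.rk_dual_univ
    refine biflat_ext hF ?_
    rw [hpG, lowCoflat]
    -- The coflat `cl^⊥(T)` has corank one, so only it and `E` are possible. Before the switch the
    -- smaller one leaves an element uncovered by the pair; from the switch on `E` would close the
    -- gap.
    have hor := flat_eq_or_eq (M := M✶) (by simpa using hE) (M✶.isFlat_closure (setT B)) q.flatG
      hlowG (Set.subset_univ _) (by omega)
    split_ifs with hs
    · refine hor.resolve_left fun hG => ?_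
      obtain ⟨c, hc, hcl⟩ := hB.exists_notMem_union hM
      refine (q.mem_union hE c).elim (fun h => hcl _ hs ?_) fun h => (mem_gapSet.1 hc).2 ?_
      · rwa [hF, hpF] at h
      · rwa [hG] at h
    · refine hor.resolve_right fun hG => ?_
      obtain ⟨g, hg⟩ := ((isBiflag_iff hE).1 hb).2
      have hgT := hgr.notMem_dual_closure hM fun s hs => hg s (Finset.mem_insert_of_mem (hsubσ hs))
      have hgu : g ∈ M.closure (lowSet M B (t + 1)) ∪ M✶.closure (setT B : Set _) := by
        rw [hB.closure_union_eq_univ hM (not_lt.1 hs)]; trivial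
      refine hg q (Finset.mem_insert_self _ _) ⟨?_, by rw [hG]; trivial⟩
      rw [hF, hpF]
      exact hgu.resolve_right hgT
  · rw [xmono_eq_zero fun hb => hp (Finset.mem_filter.2 ⟨Finset.mem_univ _, ⟨hxp, hne⟩, hb⟩),
      zero_mul]

theorem xmono_greedyBiflag_mul_gamma_pow (hM : IsGood M r) (hB : B ∈ nbcBases M (k + 1)) :
    xmono M (greedyBiflag M (setS M B) (setT B)) * gamma M ^ k = xmono M (extBiflag M B) := by
  obtain ⟨hB, hk⟩ := (Finset.mem_filter_univ _).1 hB
  have key : ∀ t ≤ k, xmono M (greedyBiflag M (setS M B) (setT B)) * gamma M ^ k =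
      xmono M (partialBiflag M B t) * gamma M ^ (k - t) := by
    intro t
    induction t with
    | zero => intro _; rw [partialBiflag_zero, Nat.sub_zero]
    | succ t ih =>
      intro ht
      rw [ih (by omega), show k - t = k - (t + 1) + 1 by omega]
      exact hB.xmono_partialBiflag_mul_gamma hM (by omega)
  rw [key k le_rfl, Nat.sub_self, pow_zero, mul_one, hB.extBiflag_eq hM hk]

end Extended

/-! ### The expansion of `γ^k δ^{n-k-1}` -/

section Expansion

variable {M : Matroid (Fin (n + 1))} {L T : Finset (Fin (n + 1))} {e : Fin (n + 1)} {m k : ℕ}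

theorem IsGreedy.eq_closure_insert (hM : IsGood M r) (h : IsGreedy M L T) {q : Biflat M}
    (hb : IsBiflag M (insert q (greedyBiflag M L T))) (he : e ∈ gapSet M L T) (hF : e ∈ q.F)
    (hrk : rk M q.F ≤ L.card + 1) : q.F = M.closure (insert e L : Finset (Fin (n + 1))) := by
  have hE := hM.ground
  have h1 := rk_of_indep (h.indep hE)
  rw [Set.ncard_coe_finset, ← rk_closure] at h1
  rw [flat_eq_closure_insert hE (M.isFlat_closure _) q.flatF (h.subset_F hM hb he hF) (by omega) hF
    (mem_gapSet.1 he).1, M.closure_insert_closure_eq_closure_insert, Finset.coe_insert]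

/-- Only two biflats survive a greedy step. -/
theorem IsGreedy.eq_or_eq_of_ne_zero (hM : IsGood M r) (h : IsGreedy M L T) {q : Biflat M}
    (he : e ∈ gapSet M L T) (hF : e ∈ q.F) (hG : e ∈ q.G)
    (hc : L.card + T.card + 1 + m + k = n - 1)
    (hne : xmono M (insert q (greedyBiflag M L T)) * delta M ^ m * gamma M ^ k ≠ 0) :
    (q.F = M.closure (insert e L : Finset (Fin (n + 1))) ∧ q.G = Set.univ) ∨
      (q.F = Set.univ ∧ q.G = M✶.closure (insert e T : Finset (Fin (n + 1)))) := by
  have hb : IsBiflag M (insert q (greedyBiflag M L T)) := by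
    by_contra hb
    exact hne (by rw [xmono_eq_zero hb, zero_mul, zero_mul])
  by_cases hqG : q.G = Set.univ
  · exact Or.inl ⟨h.eq_closure_insert hM hb he hF (h.rk_F_le hM hb he hF hqG hc hne), hqG⟩
  · by_cases hqF : q.F = Set.univ
    · exact Or.inr ⟨hqF, h.dual.eq_closure_insert (q := q.swap) hM.dual (swap_greedy hM hb)
        (by rwa [gapSet_dual]) hG (h.rk_G_le hM hb he hG hqF hc hne)⟩
    · exact absurd (h.xmono_mul_eq_zero_of_ne_univ hM he hF hG hqF hqG hc) hne

theorem sum_ite_eq_of_forall_iff {S : Finset (Biflat M)} {f : Biflat M → ChowRing M}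
    (hf : ∀ q, ¬ IsBiflag M (insert q S) → f q = 0) {Q R : Biflat M → Prop}
    [DecidablePred Q] [DecidablePred R] {q₀ : Biflat M}
    (hR : ∀ q, R q ↔ q = q₀) (hQ : Q q₀) :
    ∑ q : Biflat M with Q q ∧ IsBiflag M (insert q S), (if R q then f q else 0) = f q₀ := by
  rw [Finset.sum_eq_single q₀, if_pos ((hR q₀).2 rfl)]
  · exact fun q _ hne => if_neg fun h => hne ((hR q).1 h)
  · intro hq
    rw [if_pos ((hR q₀).2 rfl)]
    refine hf q₀ fun hb => hq (Finset.mem_filter.2 ⟨Finset.mem_univ _, hQ, hb⟩)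

/-- One branching of the tree. A branch whose gap becomes empty is absent, as the corresponding set
of biflats is not a biflag. -/
theorem IsGreedy.xmono_mul_delta_pow (hM : IsGood M r) (h : IsGreedy M L T)
    (he : e ∈ gapSet M L T) (hc : L.card + T.card + 1 + m + k = n - 1) :
    xmono M (greedyBiflag M L T) * delta M ^ (m + 1) * gamma M ^ k =
      (if (gapSet M (insert e L) T).Nonempty then
        xmono M (greedyBiflag M (insert e L) T) * delta M ^ m * gamma M ^ k else 0) +
      (if (gapSet M L (insert e T)).Nonempty then
        xmono M (greedyBiflag M L (insert e T)) * delta M ^ m * gamma M ^ k else 0) := by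
  have hE := hM.ground
  have hE' : M✶.E = Set.univ := by simpa using hE
  set f : Biflat M → ChowRing M := fun q =>
    xmono M (insert q (greedyBiflag M L T)) * delta M ^ m * gamma M ^ k with hfdef
  have hf : ∀ q, ¬ IsBiflag M (insert q (greedyBiflag M L T)) → f q = 0 := fun q hb => by
    rw [hfdef]; simp only; rw [xmono_eq_zero hb, zero_mul, zero_mul]
  set RL : Biflat M → Prop := fun q =>
    q.F = M.closure (insert e L : Finset (Fin (n + 1))) ∧ q.G = Set.univ with hRL
  set RR : Biflat M → Prop := fun q =>
    q.F = Set.univ ∧ q.G = M✶.closure (insert e T : Finset (Fin (n + 1))) with hRR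
  have h1 : xmono M (greedyBiflag M L T) * delta M ^ (m + 1) * gamma M ^ k =
      ∑ q : Biflat M with (e ∈ q.F ∧ e ∈ q.G) ∧
        IsBiflag M (insert q (greedyBiflag M L T)), f q := by
    rw [pow_succ', ← mul_assoc, mul_comm (xmono M _), delta_mul_xmono hE
      fun p hp => notMem_gap_of_mem_greedyBiflag hp he, Finset.sum_mul, Finset.sum_mul]
  have h2 : ∀ q ∈ Finset.univ.filter (fun q : Biflat M => (e ∈ q.F ∧ e ∈ q.G) ∧
      IsBiflag M (insert q (greedyBiflag M L T))),
      f q = (if RL q then f q else 0) + (if RR q then f q else 0) := by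
    intro q hq
    obtain ⟨⟨hF, hG⟩, hb⟩ := (Finset.mem_filter.1 hq).2
    by_cases hL : RL q
    · have hR : ¬ RR q := fun hR => q.not_univ hE ⟨hR.1, hL.2⟩
      rw [if_pos hL, if_neg hR, add_zero]
    · by_cases hR : RR q
      · rw [if_neg hL, if_pos hR, zero_add]
      · rw [if_neg hL, if_neg hR, add_zero]
        by_contra hne
        exact (h.eq_or_eq_of_ne_zero hM he hF hG hc hne).elim hL hR
  rw [h1, Finset.sum_congr rfl h2, Finset.sum_add_distrib]
  have heL : e ∈ M.closure (insert e L : Finset (Fin (n + 1))) :=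
    self_mem_closure hE (Finset.mem_insert_self _ _)
  have heT : e ∈ M✶.closure (insert e T : Finset (Fin (n + 1))) :=
    self_mem_closure hE' (Finset.mem_insert_self _ _)
  congr 1
  · split_ifs with hne
    · obtain ⟨g, hg⟩ := hne
      obtain ⟨q, hF, hG⟩ := exists_biflat_of_flat hM (M.isFlat_closure _) heL (mem_gapSet.1 hg).1
      rw [greedyBiflag_insert_left hE h he hF hG]
      refine sum_ite_eq_of_forall_iff hf (q₀ := q) (R := RL)
        (Q := fun q => e ∈ q.F ∧ e ∈ q.G) (fun p => ⟨fun hp => biflat_ext (hp.1.trans hF.symm)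
        (hp.2.trans hG.symm), ?_⟩) ⟨by rw [hF]; exact heL, by rw [hG]; trivial⟩
      rintro rfl
      exact ⟨hF, hG⟩
    · refine Finset.sum_eq_zero fun q hq => if_neg fun hqL => hne ?_
      obtain ⟨i, hi⟩ := ((isBiflag_iff hE).1 (Finset.mem_filter.1 hq).2.2).2
      refine ⟨i, mem_gapSet.2 ⟨fun hcl => hi q (Finset.mem_insert_self _ _) ?_,
        h.notMem_dual_closure hM fun p hp => hi p (Finset.mem_insert_of_mem hp)⟩⟩
      rw [hqL.1, hqL.2]
      exact ⟨hcl, trivial⟩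
  · split_ifs with hne
    · obtain ⟨g, hg⟩ := hne
      obtain ⟨q, hF, hG⟩ := exists_biflat_of_coflat hM (M✶.isFlat_closure _) heT (mem_gapSet.1 hg).2
      rw [greedyBiflag_insert_right hE h he hF hG]
      refine sum_ite_eq_of_forall_iff hf (q₀ := q) (R := RR)
        (Q := fun q => e ∈ q.F ∧ e ∈ q.G) (fun p => ⟨fun hp => biflat_ext (hp.1.trans hF.symm)
        (hp.2.trans hG.symm), ?_⟩) ⟨by rw [hF]; trivial, by rw [hG]; exact heT⟩
      rintro rfl
      exact ⟨hF, hG⟩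
    · refine Finset.sum_eq_zero fun q hq => if_neg fun hqL => hne ?_
      obtain ⟨i, hi⟩ := ((isBiflag_iff hE).1 (Finset.mem_filter.1 hq).2.2).2
      refine ⟨i, mem_gapSet.2 ⟨h.notMem_closure hM fun p hp => hi p (Finset.mem_insert_of_mem hp),
        fun hcl => hi q (Finset.mem_insert_self _ _) ?_⟩⟩
      rw [hqL.1, hqL.2]
      exact ⟨trivial, hcl⟩

/-- `L` and `T` consist of the elements of `S` and `T` of the basis `B` above some bound. -/
def IsInitial (M : Matroid (Fin (n + 1))) (L T B : Finset (Fin (n + 1))) : Prop :=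
  L ⊆ setS M B ∧ T ⊆ setT B ∧ ∀ x, x ∈ setS M B ∨ x ∈ setT B → x ∉ L → x ∉ T →
    ∀ y, y ∈ L ∨ y ∈ T → x < y

/-- The next element of `S ∪ T` below those already used is, since the pair of `B` is greedy, the
greatest element of the current gap, namely `e`. -/
theorem IsInitial.insert_or (hM : IsGood M r) {B : Finset (Fin (n + 1))} (hB : IsNbcBasis M B)
    (h : IsInitial M L T B) (he : IsGreatest (gapSet M L T) e)
    (hlt : L.card + T.card < (setS M B).card + (setT B).card) :
    IsInitial M (insert e L) T B ∨ IsInitial M L (insert e T) B := by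
  obtain ⟨hL, hT, hinit⟩ := h
  have hBg := hB.isGreedy hM
  have hne : (((setS M B) ∪ (setT B)) \ (L ∪ T)).Nonempty := by
    rw [Finset.sdiff_nonempty]
    intro hsub
    have h1 := Finset.card_le_card hsub
    have h2 := Finset.card_union_le L T
    rw [Finset.card_union_of_disjoint hBg.disjoint] at h1
    omega
  obtain ⟨x, hm, hmax⟩ : ∃ x ∈ ((setS M B) ∪ (setT B)) \ (L ∪ T),
      ∀ y ∈ ((setS M B) ∪ (setT B)) \ (L ∪ T), y ≤ x :=
    ⟨_, Finset.max'_mem _ hne, fun y hy => Finset.le_max' _ y hy⟩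
  simp only [Finset.mem_sdiff, Finset.mem_union, not_or] at hm hmax
  have haL : above (setS M B) x = L := by
    ext y
    rw [mem_above]
    refine ⟨fun hy => ?_, fun hy => ⟨hL hy, hinit x hm.1 hm.2.1 hm.2.2 y (Or.inl hy)⟩⟩
    by_contra hyL
    exact absurd (hmax y ⟨Or.inl hy.1, hyL, fun hyT => Finset.disjoint_left.1 hBg.disjoint hy.1
      (hT hyT)⟩) (not_le.2 hy.2)
  have haT : above (setT B) x = T := by
    ext y
    rw [mem_above]
    refine ⟨fun hy => ?_, fun hy => ⟨hT hy, hinit x hm.1 hm.2.1 hm.2.2 y (Or.inr hy)⟩⟩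
    by_contra hyT
    exact absurd (hmax y ⟨Or.inr hy.1, fun hyL => Finset.disjoint_left.1 hBg.disjoint (hL hyL)
      hy.1, hyT⟩) (not_le.2 hy.2)
  have hx := hBg.isGreatest x hm.1
  rw [haL, haT] at hx
  have hxe : x = e := hx.unique he
  rw [hxe] at hm hmax
  have hlast : ∀ y, y ∈ setS M B ∨ y ∈ setT B → y ∉ L → y ∉ T → y ≠ e → y < e :=
    fun y hy hyL hyT hye => lt_of_le_of_ne (hmax y ⟨hy, hyL, hyT⟩) hye
  rcases hm.1 with heS | heT
  · refine Or.inl ⟨Finset.insert_subset heS hL, hT, fun y hy hyL hyT z hz => ?_⟩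
    rw [Finset.mem_insert, not_or] at hyL
    rw [Finset.mem_insert] at hz
    rcases hz with (rfl | hz) | hz
    · exact hlast y hy hyL.2 hyT hyL.1
    · exact hinit y hy hyL.2 hyT z (Or.inl hz)
    · exact hinit y hy hyL.2 hyT z (Or.inr hz)
  · refine Or.inr ⟨hL, Finset.insert_subset heT hT, fun y hy hyL hyT z hz => ?_⟩
    rw [Finset.mem_insert, not_or] at hyT
    rw [Finset.mem_insert] at hz
    rcases hz with hz | (rfl | hz)
    · exact hinit y hy hyL hyT.2 z (Or.inl hz)
    · exact hlast y hy hyL hyT.2 hyT.1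
    · exact hinit y hy hyL hyT.2 z (Or.inr hz)

theorem IsInitial.of_insert (hE : M.E = Set.univ) {B : Finset (Fin (n + 1))} (h : IsGreedy M L T)
    (he : e ∈ gapSet M L T)
    (hi : IsInitial M (insert e L) T B ∨ IsInitial M L (insert e T) B) : IsInitial M L T B := by
  have hlt : ∀ y, y ∈ L ∨ y ∈ T → e < y := fun y hy => h.lt_of_mem_gapSet hE hy he
  rcases hi with ⟨hL, hT, hinit⟩ | ⟨hL, hT, hinit⟩
  · refine ⟨(Finset.subset_insert _ _).trans hL, hT, fun x hx hxL hxT y hy => ?_⟩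
    by_cases hxe : x = e
    · exact hxe ▸ hlt y hy
    · exact hinit x hx (by simp [hxe, hxL]) hxT y (by rw [Finset.mem_insert]; tauto)
  · refine ⟨hL, (Finset.subset_insert _ _).trans hT, fun x hx hxL hxT y hy => ?_⟩
    by_cases hxe : x = e
    · exact hxe ▸ hlt y hy
    · exact hinit x hx hxL (by simp [hxe, hxT]) y (by rw [Finset.mem_insert]; tauto)

theorem filter_isInitial_insert (hM : IsGood M r) (h : IsGreedy M L T)
    (he : IsGreatest (gapSet M L T) e) (hc : L.card + T.card + 1 + m + k = n - 1) :
    (nbcBases M (k + 1)).filter (IsInitial M L T) =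
      (nbcBases M (k + 1)).filter (IsInitial M (insert e L) T) ∪
        (nbcBases M (k + 1)).filter (IsInitial M L (insert e T)) := by
  rw [← Finset.filter_or]
  refine Finset.filter_congr fun B hB => ⟨fun hi => ?_, IsInitial.of_insert hM.ground h he.1⟩
  obtain ⟨hB, hIA⟩ := (Finset.mem_filter_univ _).1 hB
  refine hi.insert_or hM hB he ?_
  have h1 := card_setS hM hB.1
  have h2 := card_setT hM hB.1
  omega

theorem disjoint_filter_isInitial (hM : IsGood M r) :
    Disjoint ((nbcBases M (k + 1)).filter (IsInitial M (insert e L) T))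
      ((nbcBases M (k + 1)).filter (IsInitial M L (insert e T))) := by
  refine Finset.disjoint_filter.2 fun B hB h1 h2 => ?_
  obtain ⟨hB, -⟩ := (Finset.mem_filter_univ _).1 hB
  exact Finset.disjoint_left.1 (hB.isGreedy hM).disjoint (h1.1 (Finset.mem_insert_self _ _))
    (h2.2.1 (Finset.mem_insert_self _ _))

theorem filter_isInitial_eq_empty (hM : IsGood M r) (h : ¬ (gapSet M L T).Nonempty) :
    (nbcBases M (k + 1)).filter (IsInitial M L T) = ∅ := by
  refine Finset.filter_false_of_mem fun B hB hi => h ?_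
  obtain ⟨hB, -⟩ := (Finset.mem_filter_univ _).1 hB
  exact (hB.isGreedy hM).nonempty.mono (gapSet_anti hi.1 hi.2.1)

/-- The flat `cl(L)` has rank `|L|`, and `k` proper flats of larger ranks must fit above it. -/
theorem IsGreedy.xmono_mul_gamma_pow_eq_zero (hM : IsGood M r) (hk : k ≤ r) (h : IsGreedy M L T)
    (hc : r < L.card + k) : xmono M (greedyBiflag M L T) * gamma M ^ k = 0 := by
  by_contra hne
  have hb : IsBiflag M (greedyBiflag M L T) := by
    by_contra hb
    exact hne (by rw [xmono_eq_zero hb, zero_mul])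
  obtain ⟨S, -, -, -, -, hrk⟩ := exists_gamma_survivor hM hb hne
  have hL : L.Nonempty := Finset.card_pos.1 (by omega)
  have hmin := L.min'_mem hL
  have hall : atLeast L (L.min' hL) = L :=
    Finset.filter_true_of_mem fun x hx => L.min'_le x hx
  obtain ⟨p, hpF, hpG⟩ : ∃ p : Biflat M, p.F = M.closure (atLeast L (L.min' hL) : Set _) ∧
    p.G = Set.univ := ⟨⟨(_, _), h.isBiflat hM hmin⟩, rfl, rfl⟩
  have h1 := hrk p (mem_greedyBiflag.2 (Or.inl ⟨hpG, _, hmin, hpF⟩))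
    fun hF => p.not_univ hM.ground ⟨hF, hpG⟩
  rw [hpF, hall, rk_closure, rk_of_indep (h.indep hM.ground), Set.ncard_coe_finset] at h1
  omega

theorem IsGreedy.xmono_mul_gamma_pow (hM : IsGood M r) (hk : k ≤ r) (h : IsGreedy M L T)
    (hc : L.card + T.card + k + 1 = n) : xmono M (greedyBiflag M L T) * gamma M ^ k =
      ∑ B ∈ (nbcBases M (k + 1)).filter (IsInitial M L T), xmono M (extBiflag M B) := by
  have hr := hM.r_lt
  -- For internal activity `k + 1`, `|S| + |T|` is `n - k - 1`, already the size of the given pair,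
  -- so both inclusions are equalities.
  have hcard : ∀ B ∈ (nbcBases M (k + 1)).filter (IsInitial M L T),
      IsNbcBasis M B ∧ setS M B = L ∧ setT B = T := by
    intro B hB
    obtain ⟨hB, hL, hT, -⟩ := Finset.mem_filter.1 hB
    obtain ⟨hB, hIA⟩ := (Finset.mem_filter_univ _).1 hB
    have h1 := card_setS hM hB.1
    have h2 := card_setT hM hB.1
    have h3 := Finset.card_le_card hL
    have h4 := Finset.card_le_card hT
    exact ⟨hB, (Finset.eq_of_subset_of_card_le hL (by omega)).symm,
      (Finset.eq_of_subset_of_card_le hT (by omega)).symm⟩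
  have hTle : T.card ≤ n - r - 1 := by
    rw [← Set.ncard_coe_finset, ← rk_of_indep (h.dual_indep hM.ground), ← rk_closure]
    exact hM.dual.rk_le_of_ne_univ (M✶.isFlat_closure _) h.dual.closure_ne_univ
  by_cases hTc : T.card + r + 1 = n
  · obtain ⟨B, hB, hS, hT⟩ := h.exists_nbcBasis hM (h.dual_indep hM.ground) hTc
    have h1 := card_setS hM hB.1
    have hBk : B ∈ nbcBases M (k + 1) := (Finset.mem_filter_univ _).2 ⟨hB, by rw [hS] at h1; omega⟩
    have hset : (nbcBases M (k + 1)).filter (IsInitial M L T) = {B} := by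
      refine Finset.eq_singleton_iff_unique_mem.2 ⟨Finset.mem_filter.2 ⟨hBk, ?_⟩, fun B' hB' => ?_⟩
      · rw [← hS, ← hT]
        exact ⟨subset_rfl, subset_rfl, fun x hx hxS hxT => absurd hx (not_or.2 ⟨hxS, hxT⟩)⟩
      · obtain ⟨hB', hS', hT'⟩ := hcard B' hB'
        exact hB'.eq_of_setT_eq hM hB (hS'.trans hS.symm) (hT'.trans hT.symm)
    rw [hset, Finset.sum_singleton, ← hS, ← hT]
    exact xmono_greedyBiflag_mul_gamma_pow hM hBk
  -- Here `T` is too small, hence `L` too large: the product vanishes, and no nbc basis matches the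
  -- pair.
  · rw [h.xmono_mul_gamma_pow_eq_zero hM hk (by omega), Finset.sum_eq_zero]
    intro B hB
    obtain ⟨hB, -, hT⟩ := hcard B hB
    have h2 := card_setT hM hB.1
    rw [hT] at h2
    exact absurd h2 hTc

/-- The sum over nbc bases branches in the same way as the product: each basis extending the pair
has `e` in exactly one of `S` and `T`. -/
theorem IsGreedy.xmono_mul_delta_pow_mul_gamma_pow (hM : IsGood M r) (hk : k ≤ r) (m : ℕ) :
    ∀ {L T : Finset (Fin (n + 1))}, IsGreedy M L T → L.card + T.card + m + k + 1 = n →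
      xmono M (greedyBiflag M L T) * delta M ^ m * gamma M ^ k =
        ∑ B ∈ (nbcBases M (k + 1)).filter (IsInitial M L T), xmono M (extBiflag M B) := by
  induction m with
  | zero =>
    intro L T h hc
    rw [pow_zero, mul_one]
    exact h.xmono_mul_gamma_pow hM hk hc
  | succ m ih =>
    intro L T h hc
    have hE := hM.ground
    obtain ⟨e, he⟩ : ∃ e, IsGreatest (gapSet M L T) e :=
      ⟨_, h.nonempty.csSup_mem (gapSet M L T).toFinite,
        fun _ hx => le_csSup (gapSet M L T).toFinite.bddAbove hx⟩
    have hc' : L.card + T.card + 1 + m + k = n - 1 := by omega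
    have heL : e ∉ L := fun hx => (mem_gapSet.1 he.1).1 (self_mem_closure hE hx)
    have heT : e ∉ T := fun hx => (mem_gapSet.1 he.1).2 (self_mem_closure (by simpa using hE) hx)
    rw [h.xmono_mul_delta_pow hM he.1 hc', filter_isInitial_insert hM h he hc',
      Finset.sum_union (disjoint_filter_isInitial hM)]
    congr 1
    · split_ifs with hne
      · exact ih (h.insert_left hE he hne) (by rw [Finset.card_insert_of_notMem heL]; omega)
      · rw [filter_isInitial_eq_empty hM hne, Finset.sum_empty]
    · split_ifs with hne
      · exact ih (h.insert_right hE he hne) (by rw [Finset.card_insert_of_notMem heT]; omega)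
      · rw [filter_isInitial_eq_empty hM hne, Finset.sum_empty]

/-- The expansion of `γ^k δ^{n-k-1}` into the monomials of the extended nbc biflags. -/
theorem gamma_pow_mul_delta_pow (hM : IsGood M r) (hk : k ≤ r) :
    gamma M ^ k * delta M ^ (n - k - 1) = ∑ B ∈ nbcBases M (k + 1), xmono M (extBiflag M B) := by
  have hr := hM.r_lt
  have h := IsGreedy.xmono_mul_delta_pow_mul_gamma_pow hM hk (n - k - 1) (IsGreedy.empty hM)
    (by rw [Finset.card_empty]; omega)
  have h0 : greedyBiflag M ∅ ∅ = ∅ := Finset.eq_empty_of_forall_notMem fun p hp => by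
    simp [mem_greedyBiflag] at hp
  have h1 : xmono M ∅ = 1 := by simp [xmono, mono]
  rw [h0, h1, one_mul, mul_comm, Finset.filter_true_of_mem] at h
  · exact h
  · exact fun B _ => ⟨Finset.empty_subset _, Finset.empty_subset _,
    fun x _ _ _ y hy => by simp at hy⟩

end Expansion

end LagrangianMatroid

end

open LagrangianMatroid in
theorem theorem1p1 {n r : ℕ} (M : Matroid (Fin (n + 1))) (hE : M.E = Set.univ)
    (hloop : M.loops = ∅) (hcoloop : M.coloops = ∅) (hr : M.eRank = (r : ℕ∞) + 1)
    (k : ℕ) (hk : k ≤ r) :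
    -- the extended nbc biflags are biflags of length `n - 1`
    (∀ B ∈ nbcBases M (k + 1),
      IsBiflag M (extBiflag M B) ∧ (extBiflag M B).card = n - 1) ∧
    -- the identity in the conormal Chow ring
    gamma M ^ k * delta M ^ (n - k - 1) = ∑ B ∈ nbcBases M (k + 1), xmono M (extBiflag M B) ∧
    -- the degree map exists and is unique
    (∃! deg : chowPiece M (n - 1) →ₗ[ℝ] ℝ, IsDegreeMap M deg) ∧
    -- each monomial has degree one, and there are `h_{r-k}` of them
    (∀ deg : chowPiece M (n - 1) →ₗ[ℝ] ℝ, IsDegreeMap M deg →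
      (∀ B ∈ nbcBases M (k + 1),
        ∃ hB : xmono M (extBiflag M B) ∈ chowPiece M (n - 1),
          deg ⟨xmono M (extBiflag M B), hB⟩ = 1) ∧
      ∃ hd : gamma M ^ k * delta M ^ (n - k - 1) ∈ chowPiece M (n - 1),
        deg ⟨gamma M ^ k * delta M ^ (n - k - 1), hd⟩
          = (hVec (brokenCircuitComplex M) (r - k) : ℝ)) ∧
    ((nbcBases M (k + 1)).card : ℤ) = hVec (brokenCircuitComplex M) (r - k) := by
  have hM := IsGood.of_eRank hE hloop hcoloop hr
  have hid := gamma_pow_mul_delta_pow hM hk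
  have hcard := hVec_brokenCircuitComplex hM hk
  refine ⟨fun B hB => isBiflag_extBiflag hM hB, hid, existsUnique_degreeMap hM,
    fun deg hdeg => ?_, hcard.symm⟩
  have hmem : ∀ B ∈ nbcBases M (k + 1), xmono M (extBiflag M B) ∈ chowPiece M (n - 1) :=
    fun B hB => xmono_mem_chowPiece M _ (isBiflag_extBiflag hM hB).2
  have hone : ∀ B (hB : B ∈ nbcBases M (k + 1)), deg ⟨_, hmem B hB⟩ = 1 := fun B hB => by
    obtain ⟨hb, hc⟩ := isBiflag_extBiflag hM hB
    rw [hdeg _ hc, if_pos hb]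
  have hd : gamma M ^ k * delta M ^ (n - k - 1) ∈ chowPiece M (n - 1) :=
    hid ▸ Submodule.sum_mem _ hmem
  refine ⟨fun B hB => ⟨hmem B hB, hone B hB⟩, hd, ?_⟩
  have hsum : (⟨_, hd⟩ : chowPiece M (n - 1)) =
      ∑ B ∈ (nbcBases M (k + 1)).attach, ⟨_, hmem B.1 B.2⟩ := Subtype.ext <| by
    rw [Submodule.coe_sum, Finset.sum_attach _ fun B => xmono M (extBiflag M B)]
    exact hid
  rw [hsum, map_sum, Finset.sum_congr rfl fun B _ => hone B.1 B.2, Finset.sum_const,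
    Finset.card_attach, nsmul_one, hcard, Int.cast_natCast]
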